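/- Let $(P_t)_{t\ge 1}$ be $\mathbb R^p$-valued square-integrable predictors and $(\varepsilon_t)_{t\ge1}$ integrable centered real errors. Assume that both sequences are strictly stationary, that they are independent of each other, and that $M=\mathbb E[P_1P_1^\top]$ is non-singular. Consider the linear model $Y_t=P_t^\top\beta_t+\varepsilon_t$ and put $\mathcal{IF}_t=M^{-1}\big(P_tY_t-\mathbb E[P_tY_t]\big)$ and $\hat\beta_i^j=\frac{M^{-1}}{j-i+1}\sum_{t=i}^jP_tY_t$. For a vector $v$ and a positive definite matrix $A$ let $\|v\|_A^2=v^\top Av$, and let $|\cdot|$ be the Euclidean norm. Weight function. Let $w(t)=\tilde w(t)\,I\{t_w\le t\le T_w\}$ for $t\ge0$, where $t_w\ge 0$, $T_w\in(0,\infty]$, and $\tilde w:[0,\infty)\to(0,\infty)$ is continuous; if $T_w=\infty$, assume moreover that $\limsup_{t\to\infty}t\tilde w(t)<\infty$ and that $1/\tilde w$ is uniformly continuous on $[0,\infty)$. Statistic. For positive definite $\hat\Gamma_m$ (an estimator of the long-run variance of $Y_tP_t$) put $\hat\Sigma_m=M^{-1}\hat\Gamma_mM^{-1}$ and $$\hat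 E_m(k)=m^{-1/2}\max_{0\le j\le k-1}(k-j)\big\|\hat\beta_1^{m+j}-\hat\beta_{m+j+1}^{m+k}\big\|_{\hat\Sigma_m^{-1}} .$$ Then for all $m,k\ge1$ $$\hat E_m(k)=m^{-1/2}\max_{0\le j\le k-1}(k-j)\Big\|\frac1{m+j}\sum_{t=1}^{m+j}Y_tP_t-\frac1{k-j}\sum_{t=m+j+1}^{m+k}Y_tP_t\Big\|_{\hat\Gamma_m^{-1}},$$ so that $\hat E_m(k)$ is computed from averages of $Y_tP_t$ and does not depend on $M$. In (i) and (ii), $\hat\Gamma_m$ are random matrices which, for all large $m$, are almost surely positive definite. (i) Null hypothesis. Suppose $\beta_1=\beta_2=\cdots$. Then $(\mathcal{IF}_t)_{t\ge1}$ is strictly stationary. Assume further that $(\mathcal{IF}_t)$ has finite second moments, that its long-run variance $\Sigma=\sum_{h\in\mathbb Z}\mathrm{Cov}(\mathcal{IF}_0,\mathcal{IF}_h)$ exists and is non-singular, and that there are $0<\xi<1/2$ and, for each $m$, two independent standard $p$-dimensional Brownian motions $W_{m,1},W_{m,2}$ such that, as $m\to\infty$, $$\sup_{k\ge1}\frac1{k^\xi}\Big|\sum_{t=m+1}^{m+k}\mathcal{IF}_t-\sqrt\Sigma\,W_{m,1}(k)\Big|=O_{\mathbb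 P}(1),\qquad \frac1{m^\xi}\Big|\sum_{t=1}^{m}\mathcal{IF}_t-\sqrt\Sigma\,W_{m,2}(m)\Big|=O_{\mathbb P}(1).$$ Assume also that $\hat\Gamma_m$ converges in probability to the non-singular long-run variance $\Gamma=\sum_{h\in\mathbb Z}\mathrm{Cov}(Y_0P_0,Y_hP_h)$. (Lag-$h$ covariances of a stationary sequence are computed from any two times $s,s+h\ge1$, and the sums over $\mathbb Z$ are limits of the sums over $|h|\le n$.) Let $\alpha\in(0,1)$ and let $c(\alpha)\in\mathbb R$ satisfy $$\mathbb P\Big(\sup_{0\le t<\infty}\max_{0\le s\le t}(t+1)w(t)\Big|W\Big(\frac s{s+1}\Big)-W\Big(\frac t{t+1}\Big)\Big|>c(\alpha)\Big)\le\alpha$$ for a $p$-dimensional Brownian motion $W$ with independent components. Then monitoring has asymptotic level $\alpha$: $$\limsup_{m\to\infty}\mathbb P\Big(\sup_{k\ge1}w(k/m)\hat E_m(k)>c(\alpha)\Big)\le\alpha .$$ (ii) Alternative. Suppose that for each $m\ge1$ the parameters $\beta_t=\beta_{m,t}$ (and with them $Y_t$, $\mathcal{IF}_t$) satisfy $\beta_{m,t}=\beta^{(1)}_m$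 for $1\le t<m+k^*_m$ and $\beta_{m,t}=\beta^{(2)}_m\ne\beta^{(1)}_m$ for $t\ge m+k_m^*$, with $k_m^*\ge1$, that $\sqrt m\,|\beta^{(1)}_m-\beta^{(2)}_m|\to\infty$, and that $(m+k_m^*)^{-1/2}\big|\sum_{t=1}^{m+k_m^*-1}\mathcal{IF}_t\big|=O_{\mathbb P}(1)$. Suppose further that there is a constant $c_a>0$ such that one of the following holds: (1) $k_m^*/m=O(1)$, $\ m^{-1/2}\big|\sum_{t=m+k_m^*}^{m+k_m^*+\lfloor c_am\rfloor}\mathcal{IF}_t\big|=O_{\mathbb P}(1)$, and $t_w<k_m^*/m+c_a\le T_w$ for all large $m$; (2) $k_m^*/m\to\infty$, $\ (k_m^*)^{-1/2}\big|\sum_{t=m+k_m^*}^{m+k_m^*+\lfloor c_ak_m^*\rfloor}\mathcal{IF}_t\big|=O_{\mathbb P}(1)$, $\ T_w=\infty$, and $\liminf_{t\to\infty}t\tilde w(t)>0$. If $\hat\Gamma_m$ converges weakly to a non-singular deterministic matrix, then monitoring is consistent: $\sup_{k\ge1}w(k/m)\hat E_m(k)\to\infty$ in probability, that is, for every $c\in\mathbb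 R$, $$\lim_{m\to\infty}\mathbb P\Big(\sup_{k\ge1}w(k/m)\hat E_m(k)>c\Big)=1 .$$ -/

import Mathlib

open MeasureTheory ProbabilityTheory Filter Topology
open scoped NNReal ENNReal Matrix

namespace LinearMonitoring

noncomputable section

/-- `ℝ^p` with the Euclidean norm. -/
abbrev Vec (p : ℕ) := EuclideanSpace ℝ (Fin p)

/-! ### Probabilistic vocabulary.  Processes are observed at the times `t = 1, 2, …`;
the value at index `0` plays no role. -/

/-- Strict stationarity of `(X_t)_{t ≥ 1}`: all time shifts have the same law on the sequence
space. -/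
def StrictlyStationary {Ω E : Type*} [MeasurableSpace Ω] [MeasurableSpace E]
    (μ : Measure Ω) (X : ℕ → Ω → E) : Prop :=
  ∀ h : ℕ, IdentDistrib (fun ω (t : ℕ) => X (t + 1 + h) ω) (fun ω (t : ℕ) => X (t + 1) ω) μ μ

/-- `X_m = O_ℙ(1)` as `m → ∞`, for random variables with values in `[0, ∞]`. -/
def BoundedInProb {Ω : Type*} [MeasurableSpace Ω] (μ : Measure Ω) (X : ℕ → Ω → ℝ≥0∞) : Prop :=
  ∀ δ : ℝ≥0∞, 0 < δ → ∃ K : ℝ≥0, ∀ᶠ m in atTop, μ {ω | (K : ℝ≥0∞) < X m ω} ≤ δ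

/-- Entrywise convergence in probability of random matrices to a deterministic matrix
(equivalently, weak convergence to this deterministic limit). -/
def MatrixTendstoInProb {Ω : Type*} [MeasurableSpace Ω] {p : ℕ} (μ : Measure Ω)
    (A : ℕ → Ω → Matrix (Fin p) (Fin p) ℝ) (G : Matrix (Fin p) (Fin p) ℝ) : Prop :=
  ∀ i j, TendstoInMeasure μ (fun m ω => A m ω i j) atTop (fun _ => G i j)

/-- A standard `p`-dimensional Brownian motion with independent components. -/
structure IsStdBrownian {Ω : Type*} [MeasurableSpace Ω] {p : ℕ} (μ : Measure Ω)
    (W : ℝ≥0 → Ω → Vec p) : Prop where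
  measurable : ∀ t, Measurable (W t)
  brownian : ∀ i, IsBrownianReal (fun t ω => W t ω i) μ
  indep : iIndepFun (fun i ω (t : ℝ≥0) => W t ω i) μ

/-- The lag-`h` autocovariance matrix `Cov(Z_s, Z_{s+h})`, `h ∈ ℤ`, of a stationary process
observed from time `1` on; the smallest admissible `s` is used. -/
def autocov {Ω : Type*} [MeasurableSpace Ω] {p : ℕ} (μ : Measure Ω) (Z : ℕ → Ω → Vec p)
    (h : ℤ) : Matrix (Fin p) (Fin p) ℝ :=
  Matrix.of fun i j => cov[fun ω => Z (1 + (-h).toNat) ω i, fun ω => Z (1 + h.toNat) ω j; μ]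

/-- The long-run variance matrix `∑_{h ∈ ℤ} Cov(Z_0, Z_h)` exists and equals `G`: the process has
second moments and the partial sums over `|h| ≤ n` converge to `G`. -/
def HasLongRunVariance {Ω : Type*} [MeasurableSpace Ω] {p : ℕ} (μ : Measure Ω)
    (Z : ℕ → Ω → Vec p) (G : Matrix (Fin p) (Fin p) ℝ) : Prop :=
  (∀ t, 1 ≤ t → MemLp (Z t) 2 μ) ∧
    Tendsto (fun n : ℕ => ∑ h ∈ Finset.Icc (-(n : ℤ)) n, autocov μ Z h) atTop (𝓝 G)

open scoped MatrixOrder in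
/-- The uniform invariance principle for the process `Z = (Z_t)_{t ≥ 1}`: its long-run variance
matrix `S` exists and is non-singular, and for each `m` there are two independent standard
Brownian motions `W₁ m`, `W₂ m` which, multiplied by the symmetric square root of `S`, approximate
the partial sums after and up to time `m`. -/
def ApproximationAssumption {Ω : Type*} [MeasurableSpace Ω] {p : ℕ} (μ : Measure Ω)
    (Z : ℕ → Ω → Vec p) : Prop :=
  ∃ S : Matrix (Fin p) (Fin p) ℝ, HasLongRunVariance μ Z S ∧ IsUnit S.det ∧
    ∃ ξ : ℝ, 0 < ξ ∧ ξ < 1 / 2 ∧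
    ∃ W₁ W₂ : ℕ → ℝ≥0 → Ω → Vec p,
      (∀ m, IsStdBrownian μ (W₁ m) ∧ IsStdBrownian μ (W₂ m) ∧
        IndepFun (fun ω t => W₁ m t ω) (fun ω t => W₂ m t ω) μ) ∧
      BoundedInProb μ (fun m ω => ⨆ k : ℕ, ⨆ _ : 1 ≤ k, ENNReal.ofReal
        (‖(∑ t ∈ Finset.Icc (m + 1) (m + k), Z t ω)
            - Matrix.toEuclideanLin (CFC.sqrt S) (W₁ m (k : ℝ≥0) ω)‖ / (k : ℝ) ^ ξ)) ∧
      BoundedInProb μ (fun m ω => ENNReal.ofReal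
        (‖(∑ t ∈ Finset.Icc 1 m, Z t ω)
            - Matrix.toEuclideanLin (CFC.sqrt S) (W₂ m (m : ℝ≥0) ω)‖ / (m : ℝ) ^ ξ))

/-! ### Weight functions -/

/-- `w(t) = w̃(t) 1{t_w ≤ t ≤ T_w}`. -/
def cutoffWeight (wt : ℝ≥0 → ℝ) (tw : ℝ≥0) (Tw : ℝ≥0∞) : ℝ≥0 → ℝ :=
  fun t => open scoped Classical in if tw ≤ t ∧ (t : ℝ≥0∞) ≤ Tw then wt t else 0

/-- Conditions on the weight function `cutoffWeight wt tw Tw`, where `Tw ∈ (0, ∞]`. -/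
structure IsWeight (wt : ℝ≥0 → ℝ) (tw : ℝ≥0) (Tw : ℝ≥0∞) : Prop where
  Tw_pos : 0 < Tw
  pos : ∀ t, 0 < wt t
  continuous : Continuous wt
  limsup_lt : Tw = ⊤ → limsup (fun t : ℝ≥0 => (((t : ℝ) * wt t : ℝ) : EReal)) atTop < ⊤
  uniformContinuous_inv : Tw = ⊤ → UniformContinuous (fun t => 1 / wt t)

/-! ### The monitoring scheme -/

/-- `‖v‖_A = (vᵀ A v)^{1/2}`. -/
def weightedNorm {p : ℕ} (A : Matrix (Fin p) (Fin p) ℝ) (v : Vec p) : ℝ :=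
  √(v.ofLp ⬝ᵥ (A *ᵥ v.ofLp))

/-- `m^{-1/2} max_{0 ≤ j < k} (k - j) ‖θ̂_1^{m+j} - θ̂_{m+j+1}^{m+k}‖_{A⁻¹}`, for the values
`θ i j` of the estimators `θ̂_i^j` and the value `A` of the long-run variance estimator. -/
def monitorStat {p : ℕ} (θ : ℕ → ℕ → Vec p) (A : Matrix (Fin p) (Fin p) ℝ) (m k : ℕ) : ℝ :=
  (√(m : ℝ))⁻¹ * ⨆ j : Fin k,
    ((k : ℝ) - (j : ℕ)) * weightedNorm A⁻¹ (θ 1 (m + j) - θ (m + j + 1) (m + k))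

/-- `sup_{k ≥ 1} w(k/m) E(k)`, as an extended real number. -/
def monitorSup (w : ℝ≥0 → ℝ) (m : ℕ) (E : ℕ → ℝ) : EReal :=
  ⨆ k : ℕ, ⨆ _ : 1 ≤ k, ((w ((k : ℝ≥0) / (m : ℝ≥0)) * E k : ℝ) : EReal)

/-- `sup_{0 ≤ t < ∞} max_{0 ≤ s ≤ t} (t+1) w(t) |W(s/(s+1)) - W(t/(t+1))|` for a path `W`, as an
extended real number. -/
def limitSup {p : ℕ} (w : ℝ≥0 → ℝ) (W : ℝ≥0 → Vec p) : EReal :=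
  ⨆ t : ℝ≥0, ⨆ s : ℝ≥0, ⨆ _ : s ≤ t,
    ((((t : ℝ) + 1) * w t * ‖W (s / (s + 1)) - W (t / (t + 1))‖ : ℝ) : EReal)

/-! ### The linear model -/

/-- Standing assumptions on the predictors `P_t` and the errors `ε_t`, `t ≥ 1`. -/
structure IsLinearModel {Ω : Type*} [MeasurableSpace Ω] {p : ℕ} (μ : Measure Ω)
    (P : ℕ → Ω → Vec p) (ε : ℕ → Ω → ℝ) : Prop where
  stationary_predictors : StrictlyStationary μ P
  stationary_errors : StrictlyStationary μ ε
  indep : IndepFun (fun ω (t : ℕ) => P (t + 1) ω) (fun ω (t : ℕ) => ε (t + 1) ω) μ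
  memLp_predictors : ∀ t, 1 ≤ t → MemLp (P t) 2 μ
  integrable_errors : ∀ t, 1 ≤ t → Integrable (ε t) μ
  centered_errors : ∀ t, 1 ≤ t → ∫ ω, ε t ω ∂μ = 0

/-- `M = 𝔼[P_1 P_1ᵀ]`. -/
def momentMatrix {Ω : Type*} [MeasurableSpace Ω] {p : ℕ} (μ : Measure Ω)
    (P : ℕ → Ω → Vec p) : Matrix (Fin p) (Fin p) ℝ :=
  Matrix.of fun i j => ∫ ω, P 1 ω i * P 1 ω j ∂μ

/-- The response `Y_t = P_tᵀ β_t + ε_t`. -/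
def response {Ω : Type*} {p : ℕ} (P : ℕ → Ω → Vec p) (ε : ℕ → Ω → ℝ) (β : ℕ → Vec p)
    (t : ℕ) (ω : Ω) : ℝ :=
  (P t ω).ofLp ⬝ᵥ (β t).ofLp + ε t ω

/-- The product `Y_t P_t`. -/
def score {Ω : Type*} {p : ℕ} (P : ℕ → Ω → Vec p) (ε : ℕ → Ω → ℝ) (β : ℕ → Vec p)
    (t : ℕ) (ω : Ω) : Vec p :=
  response P ε β t ω • P t ω

/-- The average of `Y_t P_t` over `i ≤ t ≤ j`. -/
def scoreMean {Ω : Type*} {p : ℕ} (P : ℕ → Ω → Vec p) (ε : ℕ → Ω → ℝ) (β : ℕ → Vec p)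
    (ω : Ω) (i j : ℕ) : Vec p :=
  ((j : ℝ) - i + 1)⁻¹ • ∑ t ∈ Finset.Icc i j, score P ε β t ω

/-- The estimator `β̂_i^j = M⁻¹ (j - i + 1)⁻¹ ∑_{t=i}^j P_t Y_t`. -/
def betaHat {Ω : Type*} [MeasurableSpace Ω] {p : ℕ} (μ : Measure Ω) (P : ℕ → Ω → Vec p)
    (ε : ℕ → Ω → ℝ) (β : ℕ → Vec p) (ω : Ω) (i j : ℕ) : Vec p :=
  Matrix.toEuclideanLin (momentMatrix μ P)⁻¹ (scoreMean P ε β ω i j)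

/-- `IF_t = M⁻¹ (P_t Y_t - 𝔼[P_t Y_t])`. -/
def influence {Ω : Type*} [MeasurableSpace Ω] {p : ℕ} (μ : Measure Ω) (P : ℕ → Ω → Vec p)
    (ε : ℕ → Ω → ℝ) (β : ℕ → Vec p) (t : ℕ) (ω : Ω) : Vec p :=
  Matrix.toEuclideanLin (momentMatrix μ P)⁻¹
    (score P ε β t ω - ∫ ω', score P ε β t ω' ∂μ)

/-- The supremum `sup_{k ≥ 1} w(k/m) Ê_m(k)` of the weighted statistic computed from the averages
of `Y_t P_t` and the estimate `A` of the long-run variance of `Y_t P_t`. -/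
def detector {Ω : Type*} {p : ℕ} (P : ℕ → Ω → Vec p) (ε : ℕ → Ω → ℝ) (β : ℕ → Vec p)
    (w : ℝ≥0 → ℝ) (A : Matrix (Fin p) (Fin p) ℝ) (m : ℕ) (ω : Ω) : EReal :=
  monitorSup w m (fun k => monitorStat (scoreMean P ε β ω) A m k)

/-! ### The alternative -/

/-- After-change condition for early changes, `k*_m / m = O(1)`. -/
def EarlyChange {Ω : Type*} [MeasurableSpace Ω] {p : ℕ} (μ : Measure Ω)
    (Z : ℕ → ℕ → Ω → Vec p) (kstar : ℕ → ℕ) (tw : ℝ≥0) (Tw : ℝ≥0∞) (ca : ℝ) : Prop :=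
  ((fun m => (kstar m : ℝ) / m) =O[atTop] fun _ => (1 : ℝ)) ∧
  BoundedInProb μ (fun m ω => ENNReal.ofReal ((√(m : ℝ))⁻¹ *
    ‖∑ t ∈ Finset.Icc (m + kstar m) (m + kstar m + ⌊ca * m⌋₊), Z m t ω‖)) ∧
  ∀ᶠ m : ℕ in atTop, (tw : ℝ) < (kstar m : ℝ) / m + ca ∧
    ENNReal.ofReal ((kstar m : ℝ) / m + ca) ≤ Tw

/-- After-change condition for late changes, `k*_m / m → ∞`. -/
def LateChange {Ω : Type*} [MeasurableSpace Ω] {p : ℕ} (μ : Measure Ω)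
    (Z : ℕ → ℕ → Ω → Vec p) (kstar : ℕ → ℕ) (wt : ℝ≥0 → ℝ) (Tw : ℝ≥0∞) (ca : ℝ) : Prop :=
  Tendsto (fun m => (kstar m : ℝ) / m) atTop atTop ∧
  BoundedInProb μ (fun m ω => ENNReal.ofReal ((√(kstar m : ℝ))⁻¹ *
    ‖∑ t ∈ Finset.Icc (m + kstar m) (m + kstar m + ⌊ca * kstar m⌋₊), Z m t ω‖)) ∧
  Tw = ⊤ ∧ 0 < liminf (fun t : ℝ≥0 => (((t : ℝ) * wt t : ℝ) : EReal)) atTop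

/-- The alternative: for a training sample of size `m`, the parameters `β m t` change once, at time
`m + kstar m`, from `b₁ m` to `b₂ m`.  The remainder terms of the linearization vanish identically
in the linear model, so that they do not appear. -/
structure AlternativeAssumption {Ω : Type*} [MeasurableSpace Ω] {p : ℕ} (μ : Measure Ω)
    (P : ℕ → Ω → Vec p) (ε : ℕ → Ω → ℝ) (β : ℕ → ℕ → Vec p) (kstar : ℕ → ℕ)
    (b₁ b₂ : ℕ → Vec p) (wt : ℝ≥0 → ℝ) (tw : ℝ≥0) (Tw : ℝ≥0∞) : Prop where
  one_le : ∀ m, 1 ≤ m → 1 ≤ kstar m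
  before_eq : ∀ m, 1 ≤ m → ∀ t, 1 ≤ t → t < m + kstar m → β m t = b₁ m
  after_eq : ∀ m, 1 ≤ m → ∀ t, m + kstar m ≤ t → β m t = b₂ m
  ne : ∀ m, 1 ≤ m → b₁ m ≠ b₂ m
  size : Tendsto (fun m : ℕ => √(m : ℝ) * ‖b₁ m - b₂ m‖) atTop atTop
  before_change : BoundedInProb μ (fun m ω => ENNReal.ofReal ((√((m : ℝ) + kstar m))⁻¹ *
    ‖∑ t ∈ Finset.Icc 1 (m + kstar m - 1), influence μ P ε (β m) t ω‖))
  after_change : ∃ ca : ℝ, 0 < ca ∧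
    (EarlyChange μ (fun m => influence μ P ε (β m)) kstar tw Tw ca ∨
      LateChange μ (fun m => influence μ P ε (β m)) kstar wt Tw ca)

end

end LinearMonitoring

open LinearMonitoring

namespace LinearMonitoring

/-! ### Weighted norms -/

/-! Let s(n) be the sum of Y_t P_t - b over t ≤ n. The mean up to m+k is a convex combination of the
means of its two blocks, so the j-th term of the maximum is (m+k) times the norm of s(m+j)/(m+j) -
s(m+k)/(m+k), for any b (`sub_mul_weightedNorm_mean_sub`). Moreover E[P_t Y_t] = M β_t, so Y_t P_t =
M (IF_t + β_t) and Γ = M Σ M.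

Level. With b = M β_1 the sums s(m+j) are M applied to sums of influence functions, which lie within
O(m+j)^ξ of √Σ (W₂(m) + W₁(j)); the Γ⁻¹-norm turns M √Σ into an isometry
(`weightedNorm_inv_mul_sqrt`). As (t+1) w(t) is bounded, the error in the weighted statistic is
O(m^(ξ-1/2)) uniformly in j and k (`lt_of_lt_contrast`). The remaining Gaussian family has, for
every m, exactly the law of W on the points j/(m+j) (`identDistrib_bridgeProcess`), and t = k/m
gives t/(t+1) = k/(m+k). So the discretized supremum is dominated by the limit one, and no
convergence in law is needed. What remains is to lower the level slightly, from c to c', at small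
cost in probability (`IsStdBrownian.exists_measure_limitStat_le`).

This requires that the limit supremum have no atom at c > 0 (`IsStdBrownian.measure_iSup_eq_zero`).
Split W into its increments on a grid of mesh 1/n and the independent residual of linear
interpolation. Given the residual, the supremum is a convex function of the increments, which have a
density. If its value at zero increments is below c, the level set {sup = c} lies in the frontier of
a convex set, a null set (`volume_iSup_convex_eq_zero`). By continuity of paths the value at zero
increments is at most c/2 once n is large. Levels c ≤ 0 are treated separately, using α < 1.

Consistency. Compare the mean just before the change with the mean up to a time n = ⌊c_a N⌋ after
it, where N = m for an early and N = k* for a late change. The contrast contains the drift (n+1)(b₁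
- b₂), while the noise is of order √(m + k*) (`drift_sub_noise_le`). After weighting, the drift is
of order √m |b₁ - b₂| → ∞ and the noise stays bounded (`lt_detector_of_change`). -/

lemma weightedNorm_smul {p : ℕ} (A : Matrix (Fin p) (Fin p) ℝ) {c : ℝ} (hc : 0 ≤ c) (v : Vec p) :
    weightedNorm A (c • v) = c * weightedNorm A v := by
  unfold weightedNorm
  have : (c • v).ofLp ⬝ᵥ (A *ᵥ (c • v).ofLp) = c ^ 2 * (v.ofLp ⬝ᵥ (A *ᵥ v.ofLp)) := by
    simp [Matrix.mulVec_smul]; ring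
  rw [this, Real.sqrt_mul (sq_nonneg c), Real.sqrt_sq hc]

lemma ofLp_toEuclideanLin {p : ℕ} (B : Matrix (Fin p) (Fin p) ℝ) (v : Vec p) :
    (Matrix.toEuclideanLin B v).ofLp = B *ᵥ v.ofLp := rfl

lemma weightedNorm_toEuclideanLin {p : ℕ} (A B : Matrix (Fin p) (Fin p) ℝ) (v : Vec p) :
    weightedNorm A (Matrix.toEuclideanLin B v) = weightedNorm (Bᵀ * A * B) v := by
  unfold weightedNorm
  congr 1
  rw [ofLp_toEuclideanLin, ← Matrix.mulVec_mulVec, ← Matrix.mulVec_mulVec, Matrix.dotProduct_mulVec v.ofLp Bᵀ,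
    Matrix.vecMul_transpose]

lemma weightedNorm_one {p : ℕ} (v : Vec p) : weightedNorm 1 v = ‖v‖ := by
  unfold weightedNorm
  rw [EuclideanSpace.norm_eq, Matrix.one_mulVec]
  simp [dotProduct, pow_two]

lemma weightedNorm_transpose_mul_self {p : ℕ} (B : Matrix (Fin p) (Fin p) ℝ) (v : Vec p) :
    weightedNorm (Bᵀ * B) v = ‖Matrix.toEuclideanLin B v‖ := by
  rw [← weightedNorm_one, weightedNorm_toEuclideanLin, Matrix.mul_one]

open scoped MatrixOrder in
-- Take the square root of G⁻¹. The lower bound `l`, from the inverse of this root, later converts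
-- absolute errors of quadratic forms into relative ones.
lemma exists_clm_weightedNorm_inv {p : ℕ} {G : Matrix (Fin p) (Fin p) ℝ} (hG : G.PosDef) :
    ∃ L : Vec p →L[ℝ] Vec p, (∀ v, weightedNorm G⁻¹ v = ‖L v‖) ∧
      ∃ l : ℝ, 0 < l ∧ ∀ v, l * ‖v‖ ≤ ‖L v‖ := by
  set B := CFC.sqrt G⁻¹ with hB
  have hn : (0 : Matrix (Fin p) (Fin p) ℝ) ≤ B := CFC.sqrt_nonneg _
  have hT : Bᵀ = B := by simpa using (Matrix.nonneg_iff_posSemidef.mp hn).isHermitian.eq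
  have hsq : B * B = G⁻¹ :=
    CFC.sqrt_mul_sqrt_self _ (Matrix.nonneg_iff_posSemidef.mpr hG.inv.posSemidef)
  have hR : IsUnit B.det := by
    have h := (Matrix.isUnit_iff_isUnit_det _).mp hG.inv.isUnit
    rw [← hsq, Matrix.det_mul] at h
    exact isUnit_of_mul_isUnit_left h
  set C := Matrix.toEuclideanCLM (𝕜 := ℝ) B⁻¹
  refine ⟨Matrix.toEuclideanCLM (𝕜 := ℝ) B, fun v => ?_, (‖C‖ + 1)⁻¹, by positivity, fun v => ?_⟩
  · rw [← hsq]
    nth_rw 1 [← hT]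
    exact weightedNorm_transpose_mul_self B v
  · have h : C (Matrix.toEuclideanCLM (𝕜 := ℝ) B v) = v := by
      rw [← mul_apply_eq_comp, ← map_mul, Matrix.nonsing_inv_mul _ hR, map_one]
      rfl
    rw [inv_mul_le_iff₀ (by positivity)]
    calc ‖v‖ = ‖C (Matrix.toEuclideanCLM (𝕜 := ℝ) B v)‖ := by rw [h]
      _ ≤ ‖C‖ * ‖Matrix.toEuclideanCLM (𝕜 := ℝ) B v‖ := C.le_opNorm _
      _ ≤ _ := by gcongr; linarith

/-- Inversion is continuous at a nonsingular matrix, and the operator norm of A⁻¹ - G⁻¹ bounds the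
difference of the forms for all v at once. -/
lemma eventually_inv_quadratic_close {p : ℕ} {G : Matrix (Fin p) (Fin p) ℝ} (hG : IsUnit G.det)
    {η : ℝ} (hη : 0 < η) :
    ∀ᶠ A in 𝓝 G, ∀ v : Vec p,
      |v.ofLp ⬝ᵥ (A⁻¹ *ᵥ v.ofLp) - v.ofLp ⬝ᵥ (G⁻¹ *ᵥ v.ofLp)| ≤ η * ‖v‖ ^ 2 := by
  have hinv : ContinuousAt (fun A : Matrix (Fin p) (Fin p) ℝ => A⁻¹) G := by
    have : (fun A : Matrix (Fin p) (Fin p) ℝ => A⁻¹) = fun A => (A.det)⁻¹ • A.adjugate := by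
      funext A; rw [Matrix.inv_def, Ring.inverse_eq_inv']
    rw [this]
    exact (ContinuousAt.inv₀ (Continuous.matrix_det continuous_id).continuousAt hG.ne_zero).smul
      (Continuous.matrix_adjugate continuous_id).continuousAt
  have hlin : Continuous (Matrix.toEuclideanCLM (n := Fin p) (𝕜 := ℝ)) :=
    LinearMap.continuous_of_finiteDimensional
      (Matrix.toEuclideanCLM (n := Fin p) (𝕜 := ℝ)).toAlgEquiv.toLinearMap
  have h := (hlin.continuousAt.comp hinv).eventually (Metric.ball_mem_nhds _ hη)
  filter_upwards [h] with A hA v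
  have e : v.ofLp ⬝ᵥ (A⁻¹ *ᵥ v.ofLp) - v.ofLp ⬝ᵥ (G⁻¹ *ᵥ v.ofLp)
      = inner ℝ v ((Matrix.toEuclideanCLM (𝕜 := ℝ) A⁻¹ - Matrix.toEuclideanCLM (𝕜 := ℝ) G⁻¹) v) := by
    rw [sub_apply, inner_sub_right]
    congr 1 <;>
    · rw [EuclideanSpace.inner_eq_star_dotProduct, dotProduct_comm]
      rfl
  rw [e]
  refine (abs_real_inner_le_norm _ _).trans ?_
  have h2 : ‖Matrix.toEuclideanCLM (𝕜 := ℝ) A⁻¹ - Matrix.toEuclideanCLM (𝕜 := ℝ) G⁻¹‖ ≤ η := by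
    rw [← dist_eq_norm]; exact le_of_lt hA
  calc ‖v‖ * _ ≤ ‖v‖ * (η * ‖v‖) := by
        gcongr; exact (ContinuousLinearMap.le_opNorm _ _).trans (by gcongr)
    _ = _ := by ring

lemma eventually_weightedNorm_inv_le {p : ℕ} {G : Matrix (Fin p) (Fin p) ℝ} (hG : G.PosDef)
    {δ : ℝ} (hδ : 0 < δ) :
    ∀ᶠ A in 𝓝 G, ∀ v : Vec p, weightedNorm A⁻¹ v ≤ (1 + δ) * weightedNorm G⁻¹ v := by
  obtain ⟨L, hL, l, hl, hlL⟩ := exists_clm_weightedNorm_inv hG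
  have hG' : IsUnit G.det := (Matrix.isUnit_iff_isUnit_det _).mp hG.isUnit
  -- With this η the error is at most δ ‖L v‖², and 1 + δ ≤ (1 + δ)².
  filter_upwards [eventually_inv_quadratic_close hG' (η := δ * l ^ 2) (by positivity)] with A hA v
  have h0 : 0 ≤ v.ofLp ⬝ᵥ (G⁻¹ *ᵥ v.ofLp) := by
    simpa using hG.inv.posSemidef.dotProduct_mulVec_nonneg v.ofLp
  have h1 : v.ofLp ⬝ᵥ (G⁻¹ *ᵥ v.ofLp) = ‖L v‖ ^ 2 := by
    rw [← hL, weightedNorm, Real.sq_sqrt h0]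
  rw [hL]
  refine Real.sqrt_le_iff.mpr ⟨by positivity, ?_⟩
  have h2 := (abs_le.mp (hA v)).2
  have h3 : (l * ‖v‖) ^ 2 ≤ ‖L v‖ ^ 2 := by gcongr; exact hlL v
  nlinarith [sq_nonneg ‖L v‖, mul_nonneg (sq_nonneg δ) (sq_nonneg ‖L v‖), mul_le_mul_of_nonneg_left h3 hδ.le]

lemma eventually_le_weightedNorm_inv {p : ℕ} {G : Matrix (Fin p) (Fin p) ℝ} (hG : G.PosDef) :
    ∃ l : ℝ, 0 < l ∧ ∀ᶠ A in 𝓝 G, ∀ v : Vec p, l * ‖v‖ ≤ weightedNorm A⁻¹ v := by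
  obtain ⟨L, hL, l, hl, hlL⟩ := exists_clm_weightedNorm_inv hG
  have hG' : IsUnit G.det := (Matrix.isUnit_iff_isUnit_det _).mp hG.isUnit
  refine ⟨l / 2, by positivity, ?_⟩
  -- At least l² ‖v‖² / 2 of the form survives, which exceeds (l/2)² ‖v‖².
  filter_upwards [eventually_inv_quadratic_close hG' (η := l ^ 2 / 2) (by positivity)] with A hA v
  have h0 : 0 ≤ v.ofLp ⬝ᵥ (G⁻¹ *ᵥ v.ofLp) := by
    simpa using hG.inv.posSemidef.dotProduct_mulVec_nonneg v.ofLp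
  have h1 : v.ofLp ⬝ᵥ (G⁻¹ *ᵥ v.ofLp) = ‖L v‖ ^ 2 := by
    rw [← hL, weightedNorm, Real.sq_sqrt h0]
  refine Real.le_sqrt_of_sq_le ?_
  have h2 := (abs_le.mp (hA v)).1
  have h3 : (l * ‖v‖) ^ 2 ≤ ‖L v‖ ^ 2 := by gcongr; exact hlL v
  nlinarith [sq_nonneg (l * ‖v‖)]

/-- The influence-function form and the score form of the weighted norm agree. -/
lemma weightedNorm_conj_inv {p : ℕ} {M G : Matrix (Fin p) (Fin p) ℝ} (hMs : Mᵀ = M)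
    (hM : IsUnit M.det) (v : Vec p) :
    weightedNorm (M⁻¹ * G * M⁻¹)⁻¹ (Matrix.toEuclideanLin M⁻¹ v) = weightedNorm G⁻¹ v := by
  rw [weightedNorm_toEuclideanLin, Matrix.transpose_nonsing_inv, hMs, Matrix.mul_inv_rev,
    Matrix.mul_inv_rev, Matrix.nonsing_inv_nonsing_inv _ hM]
  congr 1
  rw [← Matrix.mul_assoc, ← Matrix.mul_assoc, Matrix.nonsing_inv_mul _ hM, Matrix.one_mul,
    Matrix.mul_assoc, Matrix.mul_nonsing_inv _ hM, Matrix.mul_one]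

open scoped MatrixOrder in
-- With R = √S symmetric, R M (M S M)⁻¹ M R = R S⁻¹ R = 1. Hence the approximating process M √Σ W is
-- measured by the plain Euclidean norm of W.
lemma weightedNorm_inv_mul_sqrt {p : ℕ} {M S : Matrix (Fin p) (Fin p) ℝ} (hMs : Mᵀ = M)
    (hM : IsUnit M.det) (hS : S.PosDef) (v : Vec p) :
    weightedNorm (M * S * M)⁻¹
      (Matrix.toEuclideanLin M (Matrix.toEuclideanLin (CFC.sqrt S) v)) = ‖v‖ := by
  have hS' : IsUnit S.det := (Matrix.isUnit_iff_isUnit_det _).mp hS.isUnit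
  have hn : (0 : Matrix (Fin p) (Fin p) ℝ) ≤ CFC.sqrt S := CFC.sqrt_nonneg S
  have hT : (CFC.sqrt S)ᵀ = CFC.sqrt S := by
    have := (Matrix.nonneg_iff_posSemidef.mp hn).isHermitian.eq
    simpa using this
  have hsq : CFC.sqrt S * CFC.sqrt S = S :=
    CFC.sqrt_mul_sqrt_self S (Matrix.nonneg_iff_posSemidef.mpr hS.posSemidef)
  have hR : IsUnit (CFC.sqrt S).det := by
    rw [← hsq, Matrix.det_mul] at hS'
    exact isUnit_of_mul_isUnit_left hS'
  rw [weightedNorm_toEuclideanLin, weightedNorm_toEuclideanLin, hMs, hT, Matrix.mul_inv_rev,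
    Matrix.mul_inv_rev, ← weightedNorm_one v]
  congr 1
  have : M * (M⁻¹ * (S⁻¹ * M⁻¹)) * M = S⁻¹ := by
    rw [← Matrix.mul_assoc, Matrix.mul_nonsing_inv _ hM, Matrix.one_mul, Matrix.mul_assoc,
      Matrix.nonsing_inv_mul _ hM, Matrix.mul_one]
  rw [this]
  have h2 : S⁻¹ = (CFC.sqrt S)⁻¹ * (CFC.sqrt S)⁻¹ := by rw [← Matrix.mul_inv_rev, hsq]
  rw [h2, ← Matrix.mul_assoc, Matrix.mul_nonsing_inv _ hR, Matrix.one_mul,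
    Matrix.nonsing_inv_mul _ hR]

/-! ### Gaussian processes -/

lemma integral_id_map_toLp_eq_zero {Ω T : Type*} [MeasurableSpace Ω] {μ : Measure Ω}
    {X : T → Ω → ℝ} (hX : IsGaussianProcess X μ) (mX : ∀ t, ∫ ω, X t ω ∂μ = 0) (I : Finset T) :
    ∫ x, id x ∂(Measure.map (fun ω => WithLp.toLp 2 fun t : I => X t ω) μ) = 0 := by
  have aX : AEMeasurable (fun ω => WithLp.toLp 2 fun t : I => X t ω) μ :=
    (MeasurableEquiv.toLp 2 (I → ℝ)).measurable.comp_aemeasurable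
      (aemeasurable_pi_lambda _ fun t => hX.aemeasurable t)
  rw [integral_map aX (by fun_prop)]
  ext t
  simp only [id]
  rw [eval_integral_piLp]
  · simpa using mX t
  · intro i; exact (hX.hasGaussianLaw_eval _).integrable

/-- Two centered real Gaussian processes with the same covariance function have the same law. -/
lemma identDistrib_of_covariance_eq {Ω Ω' T : Type*} [Countable T] [MeasurableSpace Ω]
    [MeasurableSpace Ω'] {μ : Measure Ω} {ν : Measure Ω'} {X : T → Ω → ℝ} {Y : T → Ω' → ℝ}
    (hX : IsGaussianProcess X μ) (hY : IsGaussianProcess Y ν)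
    (mX : ∀ t, ∫ ω, X t ω ∂μ = 0) (mY : ∀ t, ∫ ω, Y t ω ∂ν = 0)
    (h : ∀ s t, cov[X s, X t; μ] = cov[Y s, Y t; ν]) :
    IdentDistrib (fun ω t => X t ω) (fun ω t => Y t ω) μ ν := by
  have aX : AEMeasurable (fun ω t => X t ω) μ := aemeasurable_pi_lambda _ fun t => hX.aemeasurable t
  have aY : AEMeasurable (fun ω t => Y t ω) ν := aemeasurable_pi_lambda _ fun t => hY.aemeasurable t
  have := hX.isProbabilityMeasure
  have := hY.isProbabilityMeasure
  have key : ∀ I : Finset T, μ.map (fun ω => I.restrict (X · ω)) = ν.map (fun ω => I.restrict (Y · ω)) := by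
    intro I
    have aXI : AEMeasurable (fun ω => I.restrict (X · ω)) μ :=
      (Finset.measurable_restrict I).comp_aemeasurable aX
    have aYI : AEMeasurable (fun ω => I.restrict (Y · ω)) ν :=
      (Finset.measurable_restrict I).comp_aemeasurable aY
    -- Pass to the Euclidean structure, where a Gaussian law is determined by its mean and
    -- covariance form.
    apply (MeasurableEquiv.toLp 2 (_ → ℝ)).map_measurableEquiv_injective
    have gX := ((hX.hasGaussianLaw I).toLp_pi 2).isGaussian_map
    have gY := ((hY.hasGaussianLaw I).toLp_pi 2).isGaussian_map
    have mtl : Measurable (MeasurableEquiv.toLp 2 (I → ℝ)) := (MeasurableEquiv.toLp 2 (I → ℝ)).measurable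
    rw [AEMeasurable.map_map_of_aemeasurable mtl.aemeasurable aXI,
      AEMeasurable.map_map_of_aemeasurable mtl.aemeasurable aYI]
    change Measure.map (fun ω => WithLp.toLp 2 fun t : I => X t ω) μ
      = Measure.map (fun ω => WithLp.toLp 2 fun t : I => Y t ω) ν
    have gX' : IsGaussian (Measure.map (fun ω => WithLp.toLp 2 fun t : I => X t ω) μ) := gX
    have gY' : IsGaussian (Measure.map (fun ω => WithLp.toLp 2 fun t : I => Y t ω) ν) := gY
    apply IsGaussian.ext
    · rw [integral_id_map_toLp_eq_zero hX mX, integral_id_map_toLp_eq_zero hY mY]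
    · ext x y
      rw [covarianceBilin_apply_pi fun i => (hX.hasGaussianLaw_eval _).memLp_two,
        covarianceBilin_apply_pi fun i => (hY.hasGaussianLaw_eval _).memLp_two]
      simp_rw [h]
  refine ⟨aX, aY, ?_⟩
  -- A finite law on the product space is determined by its finite-dimensional marginals.
  have hX' := isProjectiveLimit_map aX
  simp_rw [key] at hX'
  have := fun I : Finset T => Measure.isProbabilityMeasure_map
    ((Finset.measurable_restrict I).comp_aemeasurable aY)
  exact hX'.unique (isProjectiveLimit_map aY)

/-- Finitely many independent Gaussian processes are jointly Gaussian. -/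
lemma isGaussianProcess_of_iIndepFun {Ω ι T : Type*} [Fintype ι] [MeasurableSpace Ω]
    {μ : Measure Ω} {X : ι → T → Ω → ℝ} (hX : ∀ i, IsGaussianProcess (X i) μ)
    (hI : iIndepFun (fun i ω t => X i t ω) μ) :
    IsGaussianProcess (fun q : ι × T => X q.1 q.2) μ where
  hasGaussianLaw I := by
    classical
    -- `J` collects the times occurring in `I`; the restriction to `I` is then a linear image of the
    -- independent restrictions to `J`.
    set J := I.image Prod.snd
    have h1 : iIndepFun (fun i ω => J.restrict (X i · ω)) μ :=
      hI.comp (fun _ => J.restrict) fun _ => Finset.measurable_restrict J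
    have h2 := iIndepFun.hasGaussianLaw (fun i => (hX i).hasGaussianLaw J) h1
    let K : (ι → J → ℝ) →L[ℝ] I → ℝ :=
      { toFun x q := x q.1.1 ⟨q.1.2, Finset.mem_image_of_mem _ q.2⟩
        map_add' x y := rfl
        map_smul' c x := rfl }
    exact h2.map K

/-- Two independent Gaussian processes are jointly Gaussian. -/
lemma isGaussianProcess_sumElim {Ω S T : Type*} [MeasurableSpace Ω]
    {μ : Measure Ω} {X : S → Ω → ℝ} {Y : T → Ω → ℝ} (hX : IsGaussianProcess X μ)
    (hY : IsGaussianProcess Y μ) (hI : IndepFun (fun ω s => X s ω) (fun ω t => Y t ω) μ) :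
    IsGaussianProcess (Sum.elim X Y) μ where
  hasGaussianLaw I := by
    classical
    have h1 : IndepFun (fun ω => I.toLeft.restrict (X · ω)) (fun ω => I.toRight.restrict (Y · ω)) μ :=
      hI.comp (Finset.measurable_restrict _) (Finset.measurable_restrict _)
    have h2 := IndepFun.hasGaussianLaw (hX.hasGaussianLaw I.toLeft) (hY.hasGaussianLaw I.toRight) h1
    let K : (I.toLeft → ℝ) × (I.toRight → ℝ) →L[ℝ] I → ℝ :=
      { toFun x q := match q with
          | ⟨Sum.inl s, hs⟩ => x.1 ⟨s, Finset.mem_toLeft.mpr hs⟩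
          | ⟨Sum.inr t, ht⟩ => x.2 ⟨t, Finset.mem_toRight.mpr ht⟩
        map_add' x y := by ext ⟨q | q, _⟩ <;> rfl
        map_smul' c x := by ext ⟨q | q, _⟩ <;> rfl
        cont := by
          refine continuous_pi fun q => ?_
          rcases q with ⟨q | q, _⟩
          · exact (continuous_apply _).comp continuous_fst
          · exact (continuous_apply _).comp continuous_snd }
    have e : (fun ω => I.restrict (Sum.elim X Y · ω)) = K ∘ fun ω =>
        (I.toLeft.restrict (X · ω), I.toRight.restrict (Y · ω)) := by
      funext ω q
      rcases q with ⟨q | q, _⟩ <;> rfl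
    rw [e]
    exact h2.map K

/-! ### Product densities and level sets of convex functions. -/

lemma pi_absolutelyContinuous_fin {n : ℕ} {μ ν : Fin n → Measure ℝ} [∀ i, SigmaFinite (μ i)]
    [∀ i, SigmaFinite (ν i)] (h : ∀ i, μ i ≪ ν i) : Measure.pi μ ≪ Measure.pi ν := by
  induction n with
  | zero => rw [Measure.pi_of_empty, Measure.pi_of_empty]
  | succ n ih =>
    have hμ := measurePreserving_piFinSuccAbove μ 0
    have hν := measurePreserving_piFinSuccAbove ν 0
    have h1 := (h 0).prod (ih fun i => h (Fin.succAbove 0 i))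
    rw [← hμ.map_eq, ← hν.map_eq] at h1
    have h2 := h1.map (MeasurableEquiv.piFinSuccAbove (fun _ : Fin (n+1) => ℝ) 0).symm.measurable
    rwa [MeasurableEquiv.map_symm_map, MeasurableEquiv.map_symm_map] at h2

lemma pi_absolutelyContinuous {ι : Type*} [Fintype ι] {μ ν : ι → Measure ℝ}
    [∀ i, SigmaFinite (μ i)] [∀ i, SigmaFinite (ν i)] (h : ∀ i, μ i ≪ ν i) :
    Measure.pi μ ≪ Measure.pi ν := by
  have e := (Fintype.equivFin ι).symm
  have hμ := measurePreserving_piCongrLeft μ e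
  have hν := measurePreserving_piCongrLeft ν e
  rw [← hμ.map_eq, ← hν.map_eq]
  exact (pi_absolutelyContinuous_fin fun i => h (e i)).map (MeasurableEquiv.measurable _)

/-- A convex function takes a value above its value at the origin on a null set only. -/
lemma volume_iSup_convex_eq_zero {E ι : Type*} [NormedAddCommGroup E] [NormedSpace ℝ E]
    [MeasurableSpace E] [BorelSpace E] [FiniteDimensional ℝ E] (ρ : Measure E)
    [ρ.IsAddHaarMeasure] {f : ι → E → ℝ} (hf : ∀ κ, ConvexOn ℝ Set.univ (f κ)) {b c : ℝ}
    (hbc : b < c) (h0 : ∀ κ, f κ 0 ≤ b) :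
    ρ {x | (∀ κ, f κ x ≤ c) ∧ ∀ q : ℕ, ∃ κ, c - 1 / ((q : ℝ) + 1) < f κ x} = 0 := by
  have hconv : Convex ℝ {x | ∀ κ, f κ x ≤ c} := by
    rw [Set.ofPred_forall]
    refine convex_iInter fun κ => ?_
    simpa using (hf κ).convex_le c
  refine measure_mono_null ?_ (hconv.addHaar_frontier ρ)
  rintro x ⟨hx, hx'⟩
  refine ⟨subset_closure hx, fun hi => ?_⟩
  -- If x were interior, some (1 + l) x would still satisfy all the bounds. As x lies between it and
  -- the origin, convexity gives f κ x ≤ c - (l/(1+l)) (c - b) for all κ, a gap that contradicts the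
  -- supremum reaching c.
  have ht : Tendsto (fun n : ℕ => (1 + 1 / ((n : ℝ) + 1)) • x) atTop (𝓝 x) := by
    have := (tendsto_one_div_add_atTop_nhds_zero_nat (𝕜 := ℝ)).const_add 1
    simpa using this.smul_const x
  obtain ⟨n, hn⟩ := (ht.eventually (mem_interior_iff_mem_nhds.mp hi)).exists
  set l : ℝ := 1 / ((n : ℝ) + 1) with hl
  have hl0 : 0 < l := by positivity
  have hb : ∀ κ, f κ x ≤ (1 + l)⁻¹ * c + l / (1 + l) * b := by
    intro κ
    have h1 := @(hf κ).2 ((1 + l) • x) (Set.mem_univ _) 0 (Set.mem_univ _) (1 + l)⁻¹ (l / (1 + l))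
      (by positivity) (by positivity) (by field_simp)
    rw [smul_smul, inv_mul_cancel₀ (by positivity), one_smul, smul_zero, add_zero] at h1
    refine h1.trans ?_
    simp only [smul_eq_mul]
    gcongr
    · exact hn κ
    · exact h0 κ
  obtain ⟨q, hq⟩ := exists_nat_one_div_lt (show 0 < l / (1 + l) * (c - b) by
    have := sub_pos.mpr hbc; positivity)
  obtain ⟨κ, hκ⟩ := hx' q
  have h3 := hb κ
  have h4 : (1 + l)⁻¹ * c = c - l / (1 + l) * c := by field_simp; ring
  nlinarith

/-- A process whose values are finite linear combinations of a Gaussian process is Gaussian. -/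
lemma isGaussianProcess_of_mem_span {Ω S T : Type*} [MeasurableSpace Ω] {μ : Measure Ω}
    {X : T → Ω → ℝ} {Y : S → Ω → ℝ} (hX : IsGaussianProcess X μ)
    (h : ∀ s, Y s ∈ Submodule.span ℝ (Set.range X)) : IsGaussianProcess Y μ := by
  refine hX.of_isGaussianProcess fun s => ?_
  obtain ⟨c, hc⟩ := (Finsupp.mem_span_range_iff_exists_finsupp).mp (h s)
  refine ⟨c.support, ∑ i : c.support, c i • ContinuousLinearMap.proj i, fun ω => ?_⟩
  rw [← hc, Finsupp.sum, ← Finset.sum_coe_sort]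
  simp

/-! ### Standard Brownian motion -/

section Brownian

variable {Ω : Type*} [MeasurableSpace Ω] {p : ℕ} {μ : Measure Ω} {W : ℝ≥0 → Ω → Vec p}

lemma IsStdBrownian.jointlyGaussian (hW : IsStdBrownian μ W) :
    IsGaussianProcess (fun (q : Fin p × ℝ≥0) ω => W q.2 ω q.1) μ :=
  isGaussianProcess_of_iIndepFun (X := fun i t ω => W t ω i)
    (fun i => IsPreBrownianReal.isGaussianProcess (hW.brownian i).toIsPreBrownianReal) hW.indep

lemma IsStdBrownian.memLp (hW : IsStdBrownian μ W) (i : Fin p) (t : ℝ≥0) :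
    MemLp (fun ω => W t ω i) 2 μ :=
  ((IsPreBrownianReal.isGaussianProcess (hW.brownian i).toIsPreBrownianReal).hasGaussianLaw_eval t).memLp_two

lemma IsStdBrownian.integral_eq_zero (hW : IsStdBrownian μ W) (i : Fin p) (t : ℝ≥0) :
    ∫ ω, W t ω i ∂μ = 0 :=
  (hW.brownian i).integral_eval t

lemma IsStdBrownian.covariance_eq (hW : IsStdBrownian μ W) (i j : Fin p) (s t : ℝ≥0) :
    cov[fun ω => W s ω i, fun ω => W t ω j; μ] = if i = j then min (s : ℝ) t else 0 := by
  have := (IsPreBrownianReal.isGaussianProcess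
    (hW.brownian i).toIsPreBrownianReal).isProbabilityMeasure
  split_ifs with h
  · subst h
    rw [(hW.brownian i).covariance_fun_eval]; simp
  · have h1 := (hW.indep.indepFun h).comp (measurable_pi_apply s) (measurable_pi_apply t)
    exact h1.covariance_eq_zero (hW.memLp i s) (hW.memLp j t)

lemma IsStdBrownian.ae_zero (hW : IsStdBrownian μ W) : ∀ᵐ ω ∂μ, W 0 ω = 0 := by
  have : ∀ᵐ ω ∂μ, ∀ i, W 0 ω i = 0 := ae_all_iff.2 fun i => (hW.brownian i).eval_zero_ae_eq_zero
  filter_upwards [this] with ω h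
  ext i; exact h i

lemma IsStdBrownian.ae_continuous (hW : IsStdBrownian μ W) :
    ∀ᵐ ω ∂μ, Continuous fun t => W t ω := by
  have : ∀ᵐ ω ∂μ, ∀ i, Continuous fun t => W t ω i := ae_all_iff.2 fun i => (hW.brownian i).cont
  filter_upwards [this] with ω h
  exact (PiLp.continuous_toLp 2 _).comp (continuous_pi h)

end Brownian

/-! ### Piecewise linear interpolation -/

/-- The ramp that increases from `0` to `1` on `[l / n, (l + 1) / n]`. -/
noncomputable def ramp (n l : ℕ) (u : ℝ) : ℝ := max 0 (min 1 (n * u - l))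

/-- The left side is the covariance of a Brownian motion at u with its increment over the l-th grid
cell. So interpolation coefficients and covariances with grid increments agree up to the factor n.
-/
lemma ramp_eq_min_sub_min {n : ℕ} (hn : 0 < n) (l : ℕ) (u : ℝ) :
    min u ((l + 1) / n) - min u (l / n) = ramp n l u / n := by
  have hn' : (0 : ℝ) < n := by exact_mod_cast hn
  unfold ramp
  have h1 : (l : ℝ) / n ≤ (l + 1) / n := by gcongr; linarith
  rcases le_total u (l / n) with h | h
  · have h3 : n * u ≤ l := by rw [le_div_iff₀ hn'] at h; linarith
    rw [min_eq_left h, min_eq_left (h.trans h1), min_eq_right (by linarith), max_eq_left (by linarith)]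
    simp
  · have h3 : l ≤ n * u := by rw [div_le_iff₀ hn'] at h; linarith
    rw [min_eq_right h]
    rcases le_total u ((l + 1) / n) with h2 | h2
    · have h4 : n * u ≤ l + 1 := by rw [le_div_iff₀ hn'] at h2; linarith
      rw [min_eq_left h2, min_eq_right (by linarith), max_eq_right (by linarith)]
      field_simp
    · have h4 : l + 1 ≤ n * u := by rw [div_le_iff₀ hn'] at h2; linarith
      rw [min_eq_right h2, min_eq_left (by linarith), max_eq_right (by linarith)]
      field_simp; ring

lemma ramp_grid_sub {n : ℕ} (hn : 0 < n) (l k : ℕ) :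
    ramp n l ((k + 1) / n) - ramp n l (k / n) = if k = l then 1 else 0 := by
  have hn' : (n : ℝ) ≠ 0 := by positivity
  unfold ramp
  rw [mul_div_cancel₀ _ hn', mul_div_cancel₀ _ hn']
  split_ifs with h
  · subst h; simp
  · rcases lt_or_gt_of_ne h with h | h
    · have : (k : ℝ) + 1 ≤ l := by exact_mod_cast h
      rw [min_eq_right (by linarith), min_eq_right (by linarith), max_eq_left (by linarith),
        max_eq_left (by linarith), sub_zero]
    · have : (l : ℝ) + 1 ≤ k := by exact_mod_cast h
      rw [min_eq_left (by linarith), min_eq_left (by linarith), sub_self]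

/-- With k = ⌊n u⌋ the ramps equal 1 below k and 0 above it. The sum telescopes to g(k/n) plus a
fraction of one increment, and both corrections are at most η. -/
lemma norm_sub_interpolation_le {E : Type*} [NormedAddCommGroup E] [NormedSpace ℝ E]
    {g : ℝ≥0 → E} (g0 : g 0 = 0) {n : ℕ} (hn : 0 < n) {η : ℝ}
    (hg : ∀ x y : ℝ≥0, x ≤ 1 → y ≤ 1 → dist x y ≤ 1 / n → ‖g x - g y‖ ≤ η)
    {u : ℝ≥0} (hu : u ≤ 1) :
    ‖g u - ∑ l : Fin n, ramp n l u •
      (g ((((l : ℕ) : ℝ≥0) + 1) / n) - g (((l : ℕ) : ℝ≥0) / n))‖ ≤ 2 * η := by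
  have hn' : (0 : ℝ) < n := by exact_mod_cast hn
  have hn'' : (0 : ℝ≥0) < n := by exact_mod_cast hn
  have hη : 0 ≤ η := (norm_nonneg _).trans (hg 0 0 zero_le_one zero_le_one (by simp))
  have hu' : (u : ℝ) ≤ 1 := by exact_mod_cast hu
  set k := ⌊(n : ℝ) * u⌋₊ with hk
  have hk1 : (k : ℝ) ≤ n * u := Nat.floor_le (by positivity)
  have hk2 : (n : ℝ) * u < k + 1 := Nat.lt_floor_add_one _
  have hkn : k ≤ n := by
    have : (k : ℝ) ≤ n := hk1.trans (by nlinarith)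
    exact_mod_cast this
  rw [Fin.sum_univ_eq_sum_range
    (fun l => ramp n l u • (g (((l : ℝ≥0) + 1) / n) - g ((l : ℝ≥0) / n))) n]
  have hlow : ∑ l ∈ Finset.range k, ramp n l u • (g (((l : ℝ≥0) + 1) / n) - g ((l : ℝ≥0) / n))
      = g ((k : ℝ≥0) / n) := by
    have : ∀ l ∈ Finset.range k, ramp n l u • (g (((l : ℝ≥0) + 1) / n) - g ((l : ℝ≥0) / n))
        = g (((l + 1 : ℕ) : ℝ≥0) / n) - g ((l : ℝ≥0) / n) := by
      intro l hl
      have hl' : (l : ℝ) + 1 ≤ k := by exact_mod_cast Finset.mem_range.mp hl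
      have : ramp n l u = 1 := by
        unfold ramp; rw [min_eq_left (by linarith)]; simp
      rw [this, one_smul]; push_cast; rfl
    rw [Finset.sum_congr rfl this, Finset.sum_range_sub (fun l : ℕ => g ((l : ℝ≥0) / n))]
    simp [g0]
  have hclose : ‖g u - g ((k : ℝ≥0) / n)‖ ≤ η := by
    refine hg _ _ hu (by rw [div_le_one hn'']; exact_mod_cast hkn) ?_
    rw [NNReal.dist_eq]; push_cast
    rw [abs_of_nonneg (by rw [sub_nonneg, div_le_iff₀ hn']; linarith), sub_le_iff_le_add,
      ← add_div, le_div_iff₀ hn']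
    linarith
  -- The case k = n occurs only at u = 1, where no fractional cell remains.
  rcases hkn.eq_or_lt with h | h
  · have hr : Finset.range n = Finset.range k := by rw [h]
    rw [hr, hlow]; linarith
  · have hsub : Finset.range (k + 1) ⊆ Finset.range n := Finset.range_subset_range.mpr h
    rw [← Finset.sum_subset hsub, Finset.sum_range_succ, hlow, ← sub_sub]
    · refine (norm_sub_le _ _).trans ?_
      have h1 : ‖ramp n k u • (g (((k : ℝ≥0) + 1) / n) - g ((k : ℝ≥0) / n))‖ ≤ η := by
        rw [norm_smul]
        have h2 : ‖ramp n k u‖ ≤ 1 := by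
          unfold ramp
          rw [Real.norm_eq_abs, abs_of_nonneg (le_max_left _ _)]
          exact max_le zero_le_one (min_le_left _ _)
        have h3 : ‖g (((k : ℝ≥0) + 1) / n) - g ((k : ℝ≥0) / n)‖ ≤ η := by
          refine hg _ _ ?_ (by rw [div_le_one hn'']; exact_mod_cast hkn) ?_
          · rw [div_le_one hn'']; exact_mod_cast h
          · rw [NNReal.dist_eq]; push_cast
            rw [← sub_div]; simp [abs_of_nonneg]
        calc _ ≤ 1 * η := by gcongr
          _ = η := one_mul _
      linarith
    · intro l hl hl'
      have : (k : ℝ) + 1 ≤ l := by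
        simp only [Finset.mem_range, not_lt] at hl'; exact_mod_cast hl'
      have : ramp n l u = 0 := by
        unfold ramp; rw [min_eq_right (by linarith), max_eq_left (by linarith)]
      rw [this, zero_smul]

/-! ### Grid increments, interpolation residual, and the absence of atoms. -/

/-- The increments of `W` over the grid of mesh `1 / n` on `[0, 1]`. -/
noncomputable def gridIncrement {Ω : Type*} {p : ℕ} (W : ℝ≥0 → Ω → Vec p) (n : ℕ) (q : Fin n × Fin p) (ω : Ω) : ℝ :=
  W ((((q.1 : ℕ) : ℝ≥0) + 1) / n) ω q.2 - W (((q.1 : ℕ) : ℝ≥0) / n) ω q.2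

/-- The increment of `W` from `v` to `u` minus that of its piecewise linear interpolation. -/
noncomputable def gridResidual {Ω ι : Type*} {p : ℕ} (W : ℝ≥0 → Ω → Vec p) (u v : ι → ℝ≥0)
    (n : ℕ) (q : Fin p × ι) (ω : Ω) : ℝ :=
  W (u q.2) ω q.1 - W (v q.2) ω q.1
    - ∑ l : Fin n, (ramp n l (u q.2) - ramp n l (v q.2)) * gridIncrement W n (l, q.1) ω

lemma gridIncrement_mem_span {Ω : Type*} {p n : ℕ} (W : ℝ≥0 → Ω → Vec p) (q : Fin n × Fin p) :
    gridIncrement W n q ∈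
      Submodule.span ℝ (Set.range fun (q : Fin p × ℝ≥0) ω => W q.2 ω q.1) :=
  Submodule.sub_mem _ (Submodule.subset_span ⟨(q.2, _), rfl⟩) (Submodule.subset_span ⟨(q.2, _), rfl⟩)

lemma gridResidual_mem_span {Ω ι : Type*} {p n : ℕ} (W : ℝ≥0 → Ω → Vec p) (u v : ι → ℝ≥0) (q : Fin p × ι) :
    gridResidual W u v n q ∈
      Submodule.span ℝ (Set.range fun (q : Fin p × ℝ≥0) ω => W q.2 ω q.1) := by
  have : gridResidual W u v n q = (fun ω => W (u q.2) ω q.1) - (fun ω => W (v q.2) ω q.1)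
      - ∑ l : Fin n, (ramp n l (u q.2) - ramp n l (v q.2)) • gridIncrement W n (l, q.1) := by
    funext ω; simp [gridResidual]
  rw [this]
  refine Submodule.sub_mem _ (Submodule.sub_mem _ (Submodule.subset_span ⟨(q.1, _), rfl⟩)
    (Submodule.subset_span ⟨(q.1, _), rfl⟩)) (Submodule.sum_mem _ fun l _ => ?_)
  exact Submodule.smul_mem _ _ (gridIncrement_mem_span W _)

/-- The increment of the path with interpolation error `r` and grid increments `x`. -/
noncomputable def gridPath {ι : Type*} {p : ℕ} (u v : ι → ℝ≥0) (n : ℕ) (κ : ι) (r : Fin p × ι → ℝ)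
    (x : Fin n × Fin p → ℝ) : Vec p :=
  WithLp.toLp 2 fun i => r (i, κ) + ∑ l : Fin n, (ramp n l (u κ) - ramp n l (v κ)) * x (l, i)

lemma gridPath_gridResidual {Ω ι : Type*} {p : ℕ} (W : ℝ≥0 → Ω → Vec p) (u v : ι → ℝ≥0) (n : ℕ) (κ : ι) (ω : Ω) :
    gridPath u v n κ (fun q => gridResidual W u v n q ω) (fun q => gridIncrement W n q ω)
      = W (u κ) ω - W (v κ) ω := by
  ext i
  simp [gridPath, gridResidual]

lemma measurable_gridPath {ι : Type*} {p : ℕ} (u v : ι → ℝ≥0) (n : ℕ) (κ : ι) :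
    Measurable fun z : (Fin p × ι → ℝ) × (Fin n × Fin p → ℝ) => gridPath u v n κ z.1 z.2 := by
  refine (WithLp.measurable_toLp 2 _).comp (measurable_pi_lambda _ fun i => ?_)
  refine ((measurable_pi_apply _).comp measurable_fst).add
    (Finset.measurable_fun_sum _ fun l _ => Measurable.const_mul ?_ _)
  exact (measurable_pi_apply _).comp measurable_snd

/-- For a fixed residual the path increment is affine in the grid increments. -/
lemma convexOn_norm_gridPath {ι : Type*} {p : ℕ} (u v : ι → ℝ≥0) (n : ℕ) (κ : ι)
    (r : Fin p × ι → ℝ) :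
    ConvexOn ℝ Set.univ fun x : Fin n × Fin p → ℝ => ‖gridPath u v n κ r x‖ := by
  refine ⟨convex_univ, fun x _ y _ s t hs ht hst => ?_⟩
  have e : gridPath u v n κ r (s • x + t • y)
      = s • gridPath u v n κ r x + t • gridPath u v n κ r y := by
    ext i
    simp only [gridPath, PiLp.add_apply, PiLp.smul_apply, Pi.add_apply, Pi.smul_apply,
      smul_eq_mul, mul_add, Finset.sum_add_distrib, Finset.mul_sum]
    have : r (i, κ) = s * r (i, κ) + t * r (i, κ) := by rw [← add_mul, hst, one_mul]
    nth_rw 1 [this]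
    simp only [mul_left_comm]
    ring
  change ‖gridPath u v n κ r (s • x + t • y)‖ ≤ _
  rw [e]
  refine (norm_add_le _ _).trans ?_
  rw [norm_smul, norm_smul, Real.norm_of_nonneg hs, Real.norm_of_nonneg ht]
  rfl

/-- By independence and Fubini the residual may be frozen at r. Either some f κ r 0 exceeds b and
the slice is empty, or the convexity lemma makes the slice a null set. -/
lemma ae_not_iSup_convex_eq {Ω E F ι : Type*} [MeasurableSpace Ω] {μ : Measure Ω}
    [IsProbabilityMeasure μ] [Countable ι] [MeasurableSpace E] [NormedAddCommGroup F]
    [NormedSpace ℝ F] [MeasurableSpace F] [BorelSpace F] [FiniteDimensional ℝ F] (ρ : Measure F)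
    [ρ.IsAddHaarMeasure] {R : Ω → E} {I : Ω → F} (hR : AEMeasurable R μ) (hI : AEMeasurable I μ)
    (hRI : IndepFun R I μ) (hac : μ.map I ≪ ρ) {f : ι → E → F → ℝ}
    (fm : ∀ κ, Measurable fun z : E × F => f κ z.1 z.2)
    (hf : ∀ κ r, ConvexOn ℝ Set.univ (f κ r)) {b c : ℝ} (hbc : b < c) :
    ∀ᵐ ω ∂μ, ¬ ((∀ κ, f κ (R ω) (I ω) ≤ c) ∧
      (∀ q : ℕ, ∃ κ, c - 1 / ((q : ℝ) + 1) < f κ (R ω) (I ω)) ∧ ∀ κ, f κ (R ω) 0 ≤ b) := by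
  have fm0 : ∀ κ, Measurable fun z : E × F => f κ z.1 0 :=
    fun κ => (fm κ).comp (measurable_fst.prodMk measurable_const)
  let B : Set (E × F) :=
    {z | (∀ κ, f κ z.1 z.2 ≤ c) ∧ (∀ q : ℕ, ∃ κ, c - 1 / ((q : ℝ) + 1) < f κ z.1 z.2) ∧
      ∀ κ, f κ z.1 0 ≤ b}
  have Bm : MeasurableSet B := by
    refine measurableSet_setOfPred.mpr (Measurable.and (Measurable.forall fun κ => ?_)
      (Measurable.and (Measurable.forall fun q => Measurable.exists fun κ => ?_)
        (Measurable.forall fun κ => ?_)))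
    · exact measurableSet_setOfPred.mp (measurableSet_le (fm κ) measurable_const)
    · exact measurableSet_setOfPred.mp (measurableSet_lt measurable_const (fm κ))
    · exact measurableSet_setOfPred.mp (measurableSet_le (fm0 κ) measurable_const)
  have hnull : (μ.map fun ω => (R ω, I ω)) B = 0 := by
    have := Measure.isProbabilityMeasure_map hI
    rw [(indepFun_iff_map_prod_eq_prod_map_map hR hI).mp hRI, Measure.measure_prod_null Bm]
    refine Eventually.of_forall fun r => hac ?_
    by_cases h0 : ∀ κ, f κ r 0 ≤ b
    · refine measure_mono_null ?_ (volume_iSup_convex_eq_zero ρ (fun κ => hf κ r) hbc h0)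
      rintro x ⟨h1, h2, -⟩
      exact ⟨h1, h2⟩
    · have : Prod.mk r ⁻¹' B = ∅ :=
        Set.eq_empty_iff_forall_notMem.mpr fun x h => h0 h.2.2
      rw [this, measure_empty]
  rw [Measure.map_apply_of_aemeasurable (hR.prodMk hI) Bm] at hnull
  rw [ae_iff]
  simp only [not_not]
  exact hnull

lemma IsStdBrownian.memLp_gridIncrement {Ω : Type*} [MeasurableSpace Ω] {p n : ℕ} {μ : Measure Ω}
    {W : ℝ≥0 → Ω → Vec p} (hW : IsStdBrownian μ W) (q : Fin n × Fin p) :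
    MemLp (gridIncrement W n q) 2 μ :=
  (hW.memLp q.2 _).sub (hW.memLp q.2 _)

section Brownian

variable {Ω ι : Type*} [MeasurableSpace Ω] {p : ℕ} {μ : Measure Ω} [IsProbabilityMeasure μ]
  {W : ℝ≥0 → Ω → Vec p} {u v : ι → ℝ≥0} {n : ℕ}

lemma IsStdBrownian.covariance_gridIncrement (hW : IsStdBrownian μ W) (hn : 0 < n) (i : Fin p)
    (s : ℝ≥0) (q : Fin n × Fin p) :
    cov[fun ω => W s ω i, gridIncrement W n q; μ] = if i = q.2 then ramp n q.1 s / n else 0 := by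
  unfold gridIncrement
  rw [covariance_fun_sub_right (hW.memLp i s) (hW.memLp q.2 _) (hW.memLp q.2 _), hW.covariance_eq,
    hW.covariance_eq]
  split_ifs with h
  · rw [← ramp_eq_min_sub_min hn]; push_cast; rfl
  · simp

lemma IsStdBrownian.covariance_gridIncrement_gridIncrement (hW : IsStdBrownian μ W) (hn : 0 < n)
    (q r : Fin n × Fin p) :
    cov[gridIncrement W n q, gridIncrement W n r; μ] = if q = r then 1 / (n : ℝ) else 0 := by
  conv_lhs => enter [1]; unfold gridIncrement
  rw [covariance_fun_sub_left (hW.memLp q.2 _) (hW.memLp q.2 _) (hW.memLp_gridIncrement r),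
    hW.covariance_gridIncrement hn, hW.covariance_gridIncrement hn]
  by_cases h2 : q.2 = r.2
  · rw [if_pos h2, if_pos h2, ← sub_div]
    push_cast
    rw [ramp_grid_sub hn]
    by_cases h1 : q.1 = r.1
    · rw [if_pos (Prod.ext h1 h2), if_pos (by rw [h1])]
    · rw [if_neg (fun h => h1 (Fin.ext h)), if_neg (fun h => h1 (by rw [h])), zero_div]
  · rw [if_neg h2, if_neg h2, if_neg (fun h => h2 (by rw [h])), sub_zero]

/-- Linear interpolation is the orthogonal projection onto the grid increments: an increment has
variance 1/n and covariance `ramp` / n with W, so the two contributions cancel. Joint Gaussianity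
upgrades this to independence. -/
lemma IsStdBrownian.covariance_gridResidual (hW : IsStdBrownian μ W) (hn : 0 < n)
    (q : Fin p × ι) (r : Fin n × Fin p) :
    cov[gridResidual W u v n q, gridIncrement W n r; μ] = 0 := by
  have hr := hW.memLp_gridIncrement r
  have hs : ∀ l : Fin n, MemLp (fun ω => (ramp n l (u q.2) - ramp n l (v q.2)) *
      gridIncrement W n (l, q.1) ω) 2 μ := fun l => (hW.memLp_gridIncrement _).const_mul _
  have hd : MemLp (fun ω => W (u q.2) ω q.1 - W (v q.2) ω q.1) 2 μ :=
    (hW.memLp _ _).sub (hW.memLp _ _)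
  unfold gridResidual
  rw [covariance_fun_sub_left hd (memLp_finsetSum _ fun l _ => hs l) hr,
    covariance_fun_sub_left (hW.memLp _ _) (hW.memLp _ _) hr, covariance_fun_sum_left hs hr,
    hW.covariance_gridIncrement hn, hW.covariance_gridIncrement hn]
  simp_rw [covariance_const_mul_left, hW.covariance_gridIncrement_gridIncrement hn]
  by_cases h : q.1 = r.2
  · have : ∀ l : Fin n, ((l, r.2) = r) ↔ l = r.1 := fun l =>
      ⟨fun h => by rw [← h], fun h' => Prod.ext h' rfl⟩
    simp [h, this]
    ring
  · have : ∀ l : Fin n, (l, q.1) ≠ r := fun l h' => h (by rw [← h'])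
    simp [h, this]

/-- The increments are jointly Gaussian and uncorrelated, hence independent, and each has a
nondegenerate Gaussian law. -/
lemma IsStdBrownian.map_gridIncrement_absolutelyContinuous (hW : IsStdBrownian μ W) (hn : 0 < n) :
    μ.map (fun ω q => gridIncrement W n q ω) ≪ volume := by
  have hG : IsGaussianProcess (gridIncrement W n) μ :=
    isGaussianProcess_of_mem_span hW.jointlyGaussian (gridIncrement_mem_span W)
  let K : (↥(Finset.univ : Finset (Fin n × Fin p)) → ℝ) →L[ℝ] (Fin n × Fin p) → ℝ :=
    { toFun x q := x ⟨q, Finset.mem_univ q⟩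
      map_add' x y := rfl
      map_smul' c x := rfl }
  have hL : HasGaussianLaw (fun ω q => gridIncrement W n q ω) μ :=
    (hG.hasGaussianLaw Finset.univ).map K
  have hI : iIndepFun (gridIncrement W n) μ := hL.iIndepFun_of_covariance_eq_zero fun q r hqr => by
    rw [hW.covariance_gridIncrement_gridIncrement hn, if_neg hqr]
  rw [(iIndepFun_iff_map_fun_eq_pi_map fun q => hG.aemeasurable q).mp hI, volume_pi]
  have := fun q => Measure.isProbabilityMeasure_map (hG.aemeasurable q)
  refine pi_absolutelyContinuous fun q => ?_
  have h1 := ((hW.brownian q.2).hasLaw_sub ((((q.1 : ℕ) : ℝ≥0) + 1) / n) (((q.1 : ℕ) : ℝ≥0) / n)).map_eq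
  have h2 : μ.map (gridIncrement W n q) = gaussianReal 0 _ := h1
  rw [h2]
  refine gaussianReal_absolutelyContinuous _ ?_
  intro h0
  have h3 : (((q.1 : ℕ) : ℝ≥0) + 1) / n = ((q.1 : ℕ) : ℝ≥0) / n := Subtype.ext (nndist_eq_zero.mp h0)
  have hn' : (n : ℝ≥0) ≠ 0 := by exact_mod_cast hn.ne'
  rw [div_left_inj' hn'] at h3
  simp at h3

lemma IsStdBrownian.indepFun_gridResidual (hW : IsStdBrownian μ W) (hn : 0 < n) :
    IndepFun (fun ω q => gridResidual W u v n q ω) (fun ω q => gridIncrement W n q ω) μ := by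
  have hG : IsGaussianProcess (Sum.elim (gridResidual W u v n) (gridIncrement W n)) μ := by
    refine isGaussianProcess_of_mem_span hW.jointlyGaussian ?_
    rintro (q | q)
    · exact gridResidual_mem_span W u v q
    · exact gridIncrement_mem_span W q
  exact hG.indepFun_of_covariance_eq_zero (fun q => hG.aemeasurable (Sum.inl q))
    (fun q => hG.aemeasurable (Sum.inr q)) fun q r => hW.covariance_gridResidual hn q r

lemma IsStdBrownian.ae_not_iSup_eq [Countable ι] (hW : IsStdBrownian μ W) {a : ι → ℝ}
    (ha : ∀ κ, 0 ≤ a κ) {c : ℝ} (hc : 0 < c) (hn : 0 < n) :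
    ∀ᵐ ω ∂μ, ¬ ((∀ κ, a κ * ‖W (u κ) ω - W (v κ) ω‖ ≤ c) ∧
      (∀ q : ℕ, ∃ κ, c - 1 / ((q : ℝ) + 1) < a κ * ‖W (u κ) ω - W (v κ) ω‖) ∧
      ∀ κ, a κ * ‖gridPath u v n κ (fun q => gridResidual W u v n q ω) 0‖ ≤ c / 2) := by
  have aR : AEMeasurable (fun ω q => gridResidual W u v n q ω) μ := aemeasurable_pi_lambda _ fun q =>
    (isGaussianProcess_of_mem_span hW.jointlyGaussian (gridResidual_mem_span W u v)).aemeasurable q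
  have aI : AEMeasurable (fun ω q => gridIncrement W n q ω) μ := aemeasurable_pi_lambda _ fun q =>
    (hW.memLp_gridIncrement q).aestronglyMeasurable.aemeasurable
  have h := ae_not_iSup_convex_eq (volume : Measure (Fin n × Fin p → ℝ)) aR aI
    (hW.indepFun_gridResidual (u := u) (v := v) hn) (hW.map_gridIncrement_absolutelyContinuous hn)
    (f := fun κ r x => a κ * ‖gridPath u v n κ r x‖)
    (fun κ => (measurable_gridPath u v n κ).norm.const_mul _)
    (fun κ r => (convexOn_norm_gridPath u v n κ r).smul (ha κ)) (half_lt_self hc)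
  simpa only [gridPath_gridResidual] using h

/-- The supremum of countably many weighted norms of increments of a Brownian motion on `[0, 1]`
has no atom in `(0, ∞)`. -/
lemma IsStdBrownian.measure_iSup_eq_zero [Countable ι] (hW : IsStdBrownian μ W) {a : ι → ℝ}
    (ha : ∀ κ, 0 ≤ a κ) {A : ℝ} (haA : ∀ κ, a κ ≤ A) (hu : ∀ κ, u κ ≤ 1) (hv : ∀ κ, v κ ≤ 1)
    {c : ℝ} (hc : 0 < c) :
    μ {ω | (∀ κ, a κ * ‖W (u κ) ω - W (v κ) ω‖ ≤ c) ∧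
      ∀ q : ℕ, ∃ κ, c - 1 / ((q : ℝ) + 1) < a κ * ‖W (u κ) ω - W (v κ) ω‖} = 0 := by
  have h1 : ∀ᵐ ω ∂μ, ∀ n : ℕ, 0 < n → ¬ ((∀ κ, a κ * ‖W (u κ) ω - W (v κ) ω‖ ≤ c) ∧
      (∀ q : ℕ, ∃ κ, c - 1 / ((q : ℝ) + 1) < a κ * ‖W (u κ) ω - W (v κ) ω‖) ∧
      ∀ κ, a κ * ‖gridPath u v n κ (fun q => gridResidual W u v n q ω) 0‖ ≤ c / 2) := by
    rw [ae_all_iff]; intro n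
    by_cases hn : 0 < n
    · filter_upwards [hW.ae_not_iSup_eq ha hc hn] with ω h _ using h
    · exact Eventually.of_forall fun ω h => absurd h hn
  have h2 : ∀ᵐ ω ∂μ, ¬ ((∀ κ, a κ * ‖W (u κ) ω - W (v κ) ω‖ ≤ c) ∧
      ∀ q : ℕ, ∃ κ, c - 1 / ((q : ℝ) + 1) < a κ * ‖W (u κ) ω - W (v κ) ω‖) := by
    filter_upwards [h1, hW.ae_zero, hW.ae_continuous] with ω hω h0 hcont hbad
    -- The interpolation errors at u and v are at most 2η each, and |A| · 4η ≤ c/2.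
    set η : ℝ := c / (8 * (|A| + 1)) with hη
    have hη0 : 0 < η := by positivity
    have huc : UniformContinuousOn (fun t => W t ω) (Set.Icc 0 1) :=
      isCompact_Icc.uniformContinuousOn_of_continuous hcont.continuousOn
    obtain ⟨δ, hδ, hδ'⟩ := Metric.uniformContinuousOn_iff.mp huc η hη0
    obtain ⟨m, hm⟩ := exists_nat_one_div_lt hδ
    refine hω (m + 1) m.succ_pos ⟨hbad.1, hbad.2, fun κ => ?_⟩
    have hg : ∀ x y : ℝ≥0, x ≤ 1 → y ≤ 1 → dist x y ≤ 1 / ((m + 1 : ℕ) : ℝ) →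
        ‖W x ω - W y ω‖ ≤ η := by
      intro x y hx hy hxy
      rw [← dist_eq_norm]
      refine (hδ' x ⟨zero_le, hx⟩ y ⟨zero_le, hy⟩ (hxy.trans_lt ?_)).le
      push_cast; exact hm
    have i1 := norm_sub_interpolation_le (g := fun t => W t ω) h0 m.succ_pos hg (hu κ)
    have i2 := norm_sub_interpolation_le (g := fun t => W t ω) h0 m.succ_pos hg (hv κ)
    -- Zero grid increments leave the residual, that is, the difference of the interpolation errors
    -- at u and v.
    have e : gridPath u v (m + 1) κ (fun q => gridResidual W u v (m + 1) q ω) 0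
        = (W (u κ) ω - ∑ l : Fin (m + 1), ramp (m + 1) l (u κ) •
            (W ((((l : ℕ) : ℝ≥0) + 1) / ((m + 1 : ℕ) : ℝ≥0)) ω
              - W (((l : ℕ) : ℝ≥0) / ((m + 1 : ℕ) : ℝ≥0)) ω))
          - (W (v κ) ω - ∑ l : Fin (m + 1), ramp (m + 1) l (v κ) •
            (W ((((l : ℕ) : ℝ≥0) + 1) / ((m + 1 : ℕ) : ℝ≥0)) ω
              - W (((l : ℕ) : ℝ≥0) / ((m + 1 : ℕ) : ℝ≥0)) ω)) := by
      ext i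
      simp only [gridPath, gridResidual, gridIncrement, Pi.zero_apply, mul_zero,
        Finset.sum_const_zero, add_zero, PiLp.sub_apply, WithLp.ofLp_sum, Finset.sum_apply,
        PiLp.smul_apply, smul_eq_mul, sub_mul, Finset.sum_sub_distrib]
      ring
    rw [e]
    have hA : a κ ≤ |A| := (haA κ).trans (le_abs_self A)
    calc a κ * ‖_‖ ≤ |A| * (2 * η + 2 * η) := by
          gcongr
          exact (norm_sub_le _ _).trans (add_le_add i1 i2)
      _ = c / 2 * (|A| / (|A| + 1)) := by rw [hη]; field_simp; ring
      _ ≤ c / 2 * 1 := by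
          gcongr
          rw [div_le_one (by positivity)]; linarith
      _ = c / 2 := mul_one _
  rw [ae_iff] at h2
  simpa only [not_not] using h2

end Brownian

/-! ### The detector -/

/-- The `j`-th term of the maximum, in terms of the partial sums of the centered sequence. -/
lemma sub_mul_weightedNorm_mean_sub {p : ℕ} (A : Matrix (Fin p) (Fin p) ℝ) (X : ℕ → Vec p)
    (b : Vec p) {m j k : ℕ} (hm : 1 ≤ m) (hjk : j < k) :
    ((k : ℝ) - j) * weightedNorm A
      ((((m + j : ℕ) : ℝ) - (1 : ℕ) + 1)⁻¹ • ∑ t ∈ Finset.Icc 1 (m + j), X t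
        - (((m + k : ℕ) : ℝ) - (m + j + 1 : ℕ) + 1)⁻¹ • ∑ t ∈ Finset.Icc (m + j + 1) (m + k), X t)
    = ((m : ℝ) + k) * weightedNorm A
      (((m : ℝ) + j)⁻¹ • ∑ t ∈ Finset.Icc 1 (m + j), (X t - b)
        - ((m : ℝ) + k)⁻¹ • ∑ t ∈ Finset.Icc 1 (m + k), (X t - b)) := by
  have hj : (j : ℝ) < k := by exact_mod_cast hjk
  have hm' : (0 : ℝ) < m := by exact_mod_cast hm
  have hmj : (0 : ℝ) < m + j := by positivity
  have hmk : (0 : ℝ) < m + k := by positivity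
  have hkj : (0 : ℝ) < k - j := sub_pos.mpr hj
  rw [← weightedNorm_smul _ hkj.le, ← weightedNorm_smul _ hmk.le]
  congr 1
  have hsplit : ∑ t ∈ Finset.Icc (m + j + 1) (m + k), X t
      = ∑ t ∈ Finset.Icc 1 (m + k), X t - ∑ t ∈ Finset.Icc 1 (m + j), X t := by
    have hd : Finset.Icc 1 (m + k) = Finset.Icc 1 (m + j) ∪ Finset.Icc (m + j + 1) (m + k) := by
      ext t; simp only [Finset.mem_Icc, Finset.mem_union]; omega
    rw [hd, Finset.sum_union, add_sub_cancel_left]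
    rw [Finset.disjoint_left]; intro t; simp only [Finset.mem_Icc]; omega
  rw [hsplit]
  simp only [Finset.sum_sub_distrib, Finset.sum_const, Nat.card_Icc, Nat.add_sub_cancel,
    ← Nat.cast_smul_eq_nsmul ℝ]
  generalize ∑ t ∈ Finset.Icc 1 (m + k), X t = x
  generalize ∑ t ∈ Finset.Icc 1 (m + j), X t = y
  push_cast
  have e1 : (m : ℝ) + j - 1 + 1 = m + j := by ring
  have e2 : (m : ℝ) + k - (m + j + 1) + 1 = k - j := by ring
  rw [e1, e2]
  simp only [smul_sub, smul_smul]
  rw [mul_inv_cancel₀ hkj.ne', mul_inv_cancel₀ hmk.ne', inv_mul_cancel₀ hmj.ne',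
    inv_mul_cancel₀ hmk.ne']
  simp only [one_smul, mul_one]
  -- The sum up to m+j enters the left side twice: through its own mean, and with coefficient 1
  -- through the later block.
  have e3 : ((m : ℝ) + k) * ((m : ℝ) + j)⁻¹ = ((k : ℝ) - j) * ((m : ℝ) + j)⁻¹ + 1 := by field_simp; ring
  rw [e3, add_smul, one_smul]
  abel

section Detector

variable {Ω : Type*} {p : ℕ} {P : ℕ → Ω → Vec p} {ε : ℕ → Ω → ℝ} {β : ℕ → Vec p} {w : ℝ≥0 → ℝ}
  {A : Matrix (Fin p) (Fin p) ℝ} {m : ℕ} {ω : Ω}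

/-- The normalized contrast `(m + k) ‖s (m + j) / (m + j) - s (m + k) / (m + k)‖` of the partial sums
`s` of `Y_t P_t - b`. -/
noncomputable def contrast (P : ℕ → Ω → Vec p) (ε : ℕ → Ω → ℝ) (β : ℕ → Vec p)
    (A : Matrix (Fin p) (Fin p) ℝ) (m : ℕ) (ω : Ω) (b : Vec p) (j k : ℕ) : ℝ :=
  ((m : ℝ) + k) * weightedNorm A⁻¹
    (((m : ℝ) + j)⁻¹ • ∑ t ∈ Finset.Icc 1 (m + j), (score P ε β t ω - b)
      - ((m : ℝ) + k)⁻¹ • ∑ t ∈ Finset.Icc 1 (m + k), (score P ε β t ω - b))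

lemma exists_lt_of_lt_detector (hm : 1 ≤ m) (b : Vec p) {c : ℝ}
    (h : (c : EReal) < detector P ε β w A m ω) :
    ∃ k j : ℕ, j < k ∧
      c < w ((k : ℝ≥0) / (m : ℝ≥0)) * ((√(m : ℝ))⁻¹ * contrast P ε β A m ω b j k) := by
  unfold detector monitorSup at h
  obtain ⟨k, h⟩ := lt_iSup_iff.mp h
  obtain ⟨hk, h⟩ := lt_iSup_iff.mp h
  have : Nonempty (Fin k) := ⟨⟨0, hk⟩⟩
  unfold monitorStat at h
  obtain ⟨j, hj⟩ := exists_eq_ciSup_of_finite (f := fun j : Fin k => ((k : ℝ) - (j : ℕ)) *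
    weightedNorm A⁻¹ (scoreMean P ε β ω 1 (m + j) - scoreMean P ε β ω (m + j + 1) (m + k)))
  beta_reduce at h
  rw [← hj] at h
  refine ⟨k, j, j.2, ?_⟩
  have e := sub_mul_weightedNorm_mean_sub A⁻¹ (fun t => score P ε β t ω) b hm j.2
  unfold contrast
  rw [← e]
  exact EReal.coe_lt_coe_iff.mp h

lemma lt_detector (hm : 1 ≤ m) (b : Vec p) {c : ℝ} {j k : ℕ} (hjk : j < k)
    (hw : 0 ≤ w ((k : ℝ≥0) / (m : ℝ≥0)))
    (h : c < w ((k : ℝ≥0) / (m : ℝ≥0)) * ((√(m : ℝ))⁻¹ * contrast P ε β A m ω b j k)) :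
    (c : EReal) < detector P ε β w A m ω := by
  unfold detector monitorSup
  refine lt_iSup_iff.mpr ⟨k, lt_iSup_iff.mpr ⟨by omega, ?_⟩⟩
  rw [EReal.coe_lt_coe_iff]
  refine h.trans_le ?_
  unfold monitorStat
  beta_reduce
  refine mul_le_mul_of_nonneg_left (mul_le_mul_of_nonneg_left ?_ (by positivity)) hw
  have e := sub_mul_weightedNorm_mean_sub A⁻¹ (fun t => score P ε β t ω) b hm hjk
  unfold contrast
  rw [← e]
  exact le_ciSup (f := fun j : Fin k => ((k : ℝ) - (j : ℕ)) *
    weightedNorm A⁻¹ (scoreMean P ε β ω 1 (m + j) - scoreMean P ε β ω (m + j + 1) (m + k)))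
    (Set.finite_range _).bddAbove ⟨j, hjk⟩

end Detector

/-! ### Weight functions -/

lemma cutoffWeight_nonneg {wt : ℝ≥0 → ℝ} {tw : ℝ≥0} {Tw : ℝ≥0∞} (hw : IsWeight wt tw Tw) (t : ℝ≥0) :
    0 ≤ cutoffWeight wt tw Tw t := by
  unfold cutoffWeight
  split_ifs
  · exact (hw.pos t).le
  · exact le_rfl

/-- The function `t ↦ (t + 1) w(t)` is bounded. -/
lemma exists_add_one_mul_cutoffWeight_le {wt : ℝ≥0 → ℝ} {tw : ℝ≥0} {Tw : ℝ≥0∞}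
    (hw : IsWeight wt tw Tw) : ∃ A : ℝ, ∀ t : ℝ≥0, ((t : ℝ) + 1) * cutoffWeight wt tw Tw t ≤ A := by
  have hcpt : ∀ T : ℝ≥0, ∃ A : ℝ, 0 ≤ A ∧ ∀ t : ℝ≥0, t ≤ T → ((t : ℝ) + 1) * wt t ≤ A := by
    intro T
    have hc : ContinuousOn (fun t : ℝ≥0 => ((t : ℝ) + 1) * wt t) (Set.Icc 0 T) := by
      have := hw.continuous
      fun_prop
    obtain ⟨A, hA⟩ := (isCompact_Icc.image_of_continuousOn hc).bddAbove
    refine ⟨max A 0, le_max_right _ _, fun t ht => ?_⟩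
    exact (hA ⟨t, ⟨zero_le, ht⟩, rfl⟩).trans (le_max_left _ _)
  have hle : ∀ t : ℝ≥0, ((t : ℝ) + 1) * cutoffWeight wt tw Tw t ≤ ((t : ℝ) + 1) * wt t := by
    intro t
    gcongr
    unfold cutoffWeight
    split_ifs
    · exact le_rfl
    · exact (hw.pos t).le
  by_cases hT : Tw = ⊤
  · obtain ⟨B, hB, -⟩ := EReal.lt_iff_exists_real_btwn.mp (hw.limsup_lt hT)
    obtain ⟨T, hT'⟩ := eventually_atTop.mp (eventually_lt_of_limsup_lt hB)
    -- Beyond time 1 one has t + 1 ≤ 2t, so the bound on t w̃(t) suffices there.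
    obtain ⟨A, hA0, hA⟩ := hcpt (max T 1)
    refine ⟨max A (2 * B), fun t => (hle t).trans ?_⟩
    rcases le_total t (max T 1) with h | h
    · exact (hA t h).trans (le_max_left _ _)
    · refine le_trans ?_ (le_max_right _ _)
      have h1 : (t : ℝ) * wt t < B := EReal.coe_lt_coe_iff.mp (hT' t ((le_max_left _ _).trans h))
      have h2 : (1 : ℝ) ≤ t := by exact_mod_cast (le_max_right _ _).trans h
      nlinarith [hw.pos t]
  · lift Tw to ℝ≥0 using hT
    obtain ⟨A, hA0, hA⟩ := hcpt Tw
    refine ⟨A, fun t => ?_⟩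
    by_cases h : t ≤ Tw
    · exact (hle t).trans (hA t h)
    · have : cutoffWeight wt tw Tw t = 0 := by
        unfold cutoffWeight
        rw [if_neg]
        rintro ⟨-, h2⟩
        exact h (by exact_mod_cast h2)
      rw [this, mul_zero]
      exact hA0

/-! ### Convergence in probability -/

lemma exists_forall_dist_lt_imp_mem {m n : Type*} [Fintype m] [Fintype n] {U : Set (m → n → ℝ)}
    {G : m → n → ℝ} (hU : U ∈ 𝓝 G) :
    ∃ r : ℝ, 0 < r ∧ ∀ A : m → n → ℝ, (∀ i j, dist (A i j) (G i j) < r) → A ∈ U := by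
  obtain ⟨r, hr, hrU⟩ := Metric.mem_nhds_iff.mp hU
  refine ⟨r, hr, fun A hA => hrU ?_⟩
  rw [Metric.mem_ball, dist_pi_lt_iff hr]
  intro i
  rw [dist_pi_lt_iff hr]
  exact hA i

section InProb

variable {Ω : Type*} [MeasurableSpace Ω] {μ : Measure Ω} {p : ℕ}
  {Γhat : ℕ → Ω → Matrix (Fin p) (Fin p) ℝ} {G : Matrix (Fin p) (Fin p) ℝ}

lemma MatrixTendstoInProb.tendsto_measure_notMem (h : MatrixTendstoInProb μ Γhat G)
    {U : Set (Matrix (Fin p) (Fin p) ℝ)} (hU : U ∈ 𝓝 G) :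
    Tendsto (fun m => μ {ω | Γhat m ω ∉ U}) atTop (𝓝 0) := by
  obtain ⟨r, hr, hrU⟩ := exists_forall_dist_lt_imp_mem (U := U) (G := G) hU
  have h1 : Tendsto (fun m => ∑ i, ∑ j, μ {ω | r ≤ dist (Γhat m ω i j) (G i j)}) atTop (𝓝 0) := by
    rw [show (0 : ℝ≥0∞) = ∑ i : Fin p, ∑ j : Fin p, (0 : ℝ≥0∞) by simp]
    exact tendsto_finsetSum _ fun i _ => tendsto_finsetSum _ fun j _ =>
      tendstoInMeasure_iff_dist.mp (h i j) r hr
  refine tendsto_of_tendsto_of_tendsto_of_le_of_le tendsto_const_nhds h1 (fun _ => zero_le)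
    fun m => ?_
  have hsub : {ω | Γhat m ω ∉ U} ⊆ ⋃ i, ⋃ j, {ω | r ≤ dist (Γhat m ω i j) (G i j)} := by
    intro ω hω
    by_contra hne
    simp only [Set.mem_iUnion, Set.mem_ofPred_eq, not_exists, not_le] at hne
    exact hω (hrU _ hne)
  refine (measure_mono hsub).trans ((measure_iUnion_fintype_le _ _).trans ?_)
  exact Finset.sum_le_sum fun i _ => measure_iUnion_fintype_le _ _

/-- Otherwise the complement of C is a neighbourhood of G, so the probability of lying in C would
tend to 0, although it is eventually 1. -/
lemma MatrixTendstoInProb.mem_of_isClosed [IsProbabilityMeasure μ] (h : MatrixTendstoInProb μ Γhat G)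
    {C : Set (Matrix (Fin p) (Fin p) ℝ)} (hC : IsClosed C)
    (hΓ : ∀ᶠ m in atTop, ∀ᵐ ω ∂μ, Γhat m ω ∈ C) : G ∈ C := by
  by_contra hG
  have h1 := h.tendsto_measure_notMem (hC.isOpen_compl.mem_nhds hG)
  have h2 : Tendsto (fun m => μ {ω | Γhat m ω ∉ Cᶜ}) atTop (𝓝 1) := by
    refine tendsto_const_nhds.congr' ?_
    filter_upwards [hΓ] with m hm
    have : {ω | Γhat m ω ∉ Cᶜ} =ᵐ[μ] Set.univ := by
      filter_upwards [hm] with ω hω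
      exact propext (iff_of_true (fun h => h hω) trivial)
    rw [measure_congr this, measure_univ]
  exact zero_ne_one (tendsto_nhds_unique h1 h2)

lemma isClosed_posSemidef : IsClosed {A : Matrix (Fin p) (Fin p) ℝ | A.PosSemidef} := by
  have : {A : Matrix (Fin p) (Fin p) ℝ | A.PosSemidef}
      = {A | Aᵀ = A} ∩ ⋂ x : Fin p → ℝ, {A | 0 ≤ x ⬝ᵥ (A *ᵥ x)} := by
    ext A
    simp only [Set.mem_inter_iff, Set.mem_iInter, Set.mem_ofPred_eq,
      Matrix.posSemidef_iff_dotProduct_mulVec, Matrix.IsHermitian,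
      Matrix.conjTranspose_eq_transpose_of_trivial, star_trivial]
  rw [this]
  refine (isClosed_eq (Continuous.matrix_transpose continuous_id) continuous_id).inter
    (isClosed_iInter fun x => isClosed_le continuous_const ?_)
  exact Continuous.dotProduct continuous_const (Continuous.matrix_mulVec continuous_id continuous_const)

/-- Positive semidefinite matrices form a closed set, and a nonsingular one among them is positive
definite. -/
lemma MatrixTendstoInProb.posDef [IsProbabilityMeasure μ] (h : MatrixTendstoInProb μ Γhat G)
    (hΓ : ∀ᶠ m in atTop, ∀ᵐ ω ∂μ, (Γhat m ω).PosDef) (hG : IsUnit G.det) : G.PosDef := by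
  have : G.PosSemidef := h.mem_of_isClosed isClosed_posSemidef
    (hΓ.mono fun m hm => hm.mono fun ω hω => hω.posSemidef)
  exact this.posDef_iff_det_ne_zero.mpr hG.ne_zero

end InProb

/-! ### The limit process -/

/-- The rescaled process `√m (W₂(m) / m - (W₂(m) + W₁(j)) / (m + j))`. -/
noncomputable def bridgeProcess {Ω : Type*} {p : ℕ} (W₁ W₂ : ℝ≥0 → Ω → Vec p) (m : ℕ)
    (q : Fin p × ℕ) (ω : Ω) : ℝ :=
  √(m : ℝ) * ((m : ℝ)⁻¹ - ((m : ℝ) + q.2)⁻¹) * W₂ m ω q.1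
    - √(m : ℝ) * ((m : ℝ) + q.2)⁻¹ * W₁ q.2 ω q.1

section Bridge

variable {Ω Ω' : Type*} [MeasurableSpace Ω] [MeasurableSpace Ω'] {p : ℕ} {μ : Measure Ω}
  {μ' : Measure Ω'} {W₁ W₂ : ℝ≥0 → Ω → Vec p}
  {W : ℝ≥0 → Ω' → Vec p} {m : ℕ}

lemma isGaussianProcess_bridgeProcess (h₁ : IsStdBrownian μ W₁) (h₂ : IsStdBrownian μ W₂)
    (hI : IndepFun (fun ω t => W₁ t ω) (fun ω t => W₂ t ω) μ) :
    IsGaussianProcess (bridgeProcess W₁ W₂ m) μ := by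
  have hm : Measurable fun (f : ℝ≥0 → Vec p) (q : Fin p × ℝ≥0) => f q.2 q.1 := by
    refine measurable_pi_lambda _ fun q => ?_
    exact (EuclideanSpace.proj (𝕜 := ℝ) q.1).continuous.measurable.comp (measurable_pi_apply q.2)
  have hG := isGaussianProcess_sumElim h₁.jointlyGaussian h₂.jointlyGaussian (hI.comp hm hm)
  refine isGaussianProcess_of_mem_span hG fun q => ?_
  have e : bridgeProcess W₁ W₂ m q
      = (√(m : ℝ) * ((m : ℝ)⁻¹ - ((m : ℝ) + q.2)⁻¹)) • (fun ω => W₂ m ω q.1)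
        - (√(m : ℝ) * ((m : ℝ) + q.2)⁻¹) • (fun ω => W₁ q.2 ω q.1) := by
    funext ω; simp [bridgeProcess]
  rw [e]
  exact Submodule.sub_mem _
    (Submodule.smul_mem _ _ (Submodule.subset_span ⟨Sum.inr (q.1, (m : ℝ≥0)), rfl⟩))
    (Submodule.smul_mem _ _ (Submodule.subset_span ⟨Sum.inl (q.1, (q.2 : ℝ≥0)), rfl⟩))

/-- For j ≤ k the W₂ part contributes jk / ((m+j)(m+k)) and the W₁ part mj / ((m+j)(m+k)); their sum
is j/(m+j). -/
lemma covariance_bridgeProcess [IsProbabilityMeasure μ] (h₁ : IsStdBrownian μ W₁) (h₂ : IsStdBrownian μ W₂)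
    (hI : IndepFun (fun ω t => W₁ t ω) (fun ω t => W₂ t ω) μ) (hm : 1 ≤ m) (q r : Fin p × ℕ) :
    cov[bridgeProcess W₁ W₂ m q, bridgeProcess W₁ W₂ m r; μ]
      = if q.1 = r.1 then min ((q.2 : ℝ) / (m + q.2)) ((r.2 : ℝ) / (m + r.2)) else 0 := by
  have hm0 : (0 : ℝ) < m := by exact_mod_cast hm
  have cross : ∀ (i j : Fin p) (s t : ℝ≥0), cov[fun ω => W₁ s ω i, fun ω => W₂ t ω j; μ] = 0 := by
    intro i j s t
    have hp : ∀ (k : Fin p) (u : ℝ≥0), Measurable fun f : ℝ≥0 → Vec p => f u k := fun k u =>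
      (EuclideanSpace.proj (𝕜 := ℝ) k).continuous.measurable.comp (measurable_pi_apply u)
    exact (hI.comp (hp i s) (hp j t)).covariance_eq_zero (h₁.memLp i s) (h₂.memLp j t)
  unfold bridgeProcess
  rw [covariance_fun_sub_fun_sub ((h₂.memLp _ _).const_mul _) ((h₁.memLp _ _).const_mul _)
    ((h₂.memLp _ _).const_mul _) ((h₁.memLp _ _).const_mul _)]
  simp only [covariance_const_mul_left, covariance_const_mul_right, h₁.covariance_eq,
    h₂.covariance_eq, cross]
  rw [covariance_comm (fun ω => W₂ _ ω _), cross]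
  split_ifs with h
  · wlog hqr : q.2 ≤ r.2 generalizing q r
    · have := this r q h.symm (by omega)
      rw [min_comm ((q.2 : ℝ) / _), ← this, min_comm ((q.2 : ℝ≥0) : ℝ)]
      ring
    · have hqr' : (q.2 : ℝ) ≤ r.2 := by exact_mod_cast hqr
      have e1 : min (((q.2 : ℝ≥0)) : ℝ) (r.2 : ℝ≥0) = q.2 := by
        push_cast; exact min_eq_left hqr'
      have e2 : min ((q.2 : ℝ) / (m + q.2)) ((r.2 : ℝ) / (m + r.2)) = (q.2 : ℝ) / (m + q.2) := by
        apply min_eq_left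
        rw [div_le_div_iff₀ (by positivity) (by positivity)]
        nlinarith
      rw [e1, e2, min_self]
      push_cast
      have hs : √(m : ℝ) * √(m : ℝ) = m := Real.mul_self_sqrt hm0.le
      have e3 : ∀ x y z w v : ℝ, √(m : ℝ) * x * (√(m : ℝ) * y * v) = m * (x * y * v) := by
        intro x y z w v; linear_combination (x * y * v) * hs
      rw [e3 _ _ 0 0, e3 _ _ 0 0]
      field_simp
      ring_nf
      rw [Real.sq_sqrt hm0.le]
      ring
  · ring

lemma identDistrib_bridgeProcess [IsProbabilityMeasure μ] (h₁ : IsStdBrownian μ W₁) (h₂ : IsStdBrownian μ W₂)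
    (hI : IndepFun (fun ω t => W₁ t ω) (fun ω t => W₂ t ω) μ) (hW : IsStdBrownian μ' W)
    (hm : 1 ≤ m) :
    IdentDistrib (fun ω q => bridgeProcess W₁ W₂ m q ω)
      (fun ω (q : Fin p × ℕ) => W ((q.2 : ℝ≥0) / ((m : ℝ≥0) + q.2)) ω q.1) μ μ' := by
  refine identDistrib_of_covariance_eq (isGaussianProcess_bridgeProcess h₁ h₂ hI)
    (Y := fun (q : Fin p × ℕ) ω => W ((q.2 : ℝ≥0) / ((m : ℝ≥0) + q.2)) ω q.1) ?_ ?_ ?_ ?_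
  · exact isGaussianProcess_of_mem_span hW.jointlyGaussian fun q =>
      Submodule.subset_span ⟨(q.1, (q.2 : ℝ≥0) / ((m : ℝ≥0) + q.2)), rfl⟩
  · intro q
    unfold bridgeProcess
    rw [integral_sub, integral_const_mul, integral_const_mul, h₁.integral_eq_zero,
      h₂.integral_eq_zero, mul_zero, mul_zero, sub_zero]
    · exact ((h₂.memLp _ _).integrable one_le_two).const_mul _
    · exact ((h₁.memLp _ _).integrable one_le_two).const_mul _
  · exact fun q => hW.integral_eq_zero _ _
  · intro q r
    rw [covariance_bridgeProcess h₁ h₂ hI hm, hW.covariance_eq]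
    push_cast
    rfl

/-- The event that the discretized limit statistic exceeds a level has the same probability when
computed from two independent Brownian motions and from one. -/
lemma measure_exists_lt_eq [IsProbabilityMeasure μ] (h₁ : IsStdBrownian μ W₁) (h₂ : IsStdBrownian μ W₂)
    (hI : IndepFun (fun ω t => W₁ t ω) (fun ω t => W₂ t ω) μ) (hW : IsStdBrownian μ' W)
    (hm : 1 ≤ m) (a : ℕ → ℝ) (c : ℝ) :
    μ {ω | ∃ k j : ℕ, j < k ∧ c < a k * ‖(√(m : ℝ) * ((m : ℝ) + j)⁻¹) • (W₂ m ω + W₁ j ω)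
        - (√(m : ℝ) * ((m : ℝ) + k)⁻¹) • (W₂ m ω + W₁ k ω)‖}
      = μ' {ω | ∃ k j : ℕ, j < k ∧ c < a k * ‖W ((j : ℝ≥0) / ((m : ℝ≥0) + j)) ω
        - W ((k : ℝ≥0) / ((m : ℝ≥0) + k)) ω‖} := by
  let B : Set (Fin p × ℕ → ℝ) := {x | ∃ k j : ℕ, j < k ∧
    c < a k * ‖(WithLp.toLp 2 fun i => x (i, j) - x (i, k) : Vec p)‖}
  have hB : MeasurableSet B := by
    refine measurableSet_setOfPred.mpr (Measurable.exists fun k => Measurable.exists fun j =>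
      Measurable.and measurable_const ?_)
    refine measurableSet_setOfPred.mp (measurableSet_lt measurable_const
      (Measurable.const_mul (Measurable.norm ?_) _))
    refine (WithLp.measurable_toLp 2 _).comp (measurable_pi_lambda _ fun i => ?_)
    exact (measurable_pi_apply _).sub (measurable_pi_apply _)
  have h := (identDistrib_bridgeProcess h₁ h₂ hI hW hm).measure_mem_eq hB
  refine Eq.trans (congrArg μ ?_) h
  ext ω
  simp only [Set.mem_preimage, B, Set.mem_ofPred_eq]
  refine exists_congr fun k => exists_congr fun j => and_congr Iff.rfl ?_
  -- The common term W₂(m)/m drops out of the difference of two values of `bridgeProcess`, which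
  -- leaves the contrast with opposite sign.
  rw [← norm_neg]
  have e : -((√(m : ℝ) * ((m : ℝ) + j)⁻¹) • (W₂ m ω + W₁ j ω)
        - (√(m : ℝ) * ((m : ℝ) + k)⁻¹) • (W₂ m ω + W₁ k ω))
      = WithLp.toLp 2 fun i => bridgeProcess W₁ W₂ m (i, j) ω - bridgeProcess W₁ W₂ m (i, k) ω := by
    ext i
    simp [bridgeProcess]
    ring
  rw [e]

end Bridge

/-! ### The linear model -/

lemma continuous_linear_score {p : ℕ} (L : Vec p →ₗ[ℝ] Vec p) (b v : Vec p) :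
    Continuous fun y : Vec p × ℝ => L ((y.1.ofLp ⬝ᵥ b.ofLp + y.2) • y.1 - v) := by
  have h1 : Continuous fun y : Vec p × ℝ => y.1.ofLp ⬝ᵥ b.ofLp := by
    unfold dotProduct
    fun_prop
  have h2 : Continuous fun y : Vec p × ℝ => (y.1.ofLp ⬝ᵥ b.ofLp + y.2) • y.1 - v := by
    fun_prop
  exact L.continuous_of_finiteDimensional.comp h2

lemma measurable_linear_score_apply {p : ℕ} (L : Vec p →ₗ[ℝ] Vec p) (b v : Vec p) (t : ℕ) :
    Measurable fun (z : (ℕ → Vec p) × (ℕ → ℝ)) =>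
      L (((z.1 t).ofLp ⬝ᵥ b.ofLp + z.2 t) • z.1 t - v) := by
  have hx : Measurable fun z : (ℕ → Vec p) × (ℕ → ℝ) => (z.1 t, z.2 t) := by fun_prop
  have h := Measurable.comp (continuous_linear_score L b v).measurable hx
  unfold Function.comp at h
  beta_reduce at h
  exact h

lemma measurable_linear_score {p : ℕ} (L : Vec p →ₗ[ℝ] Vec p) (b v : Vec p) :
    Measurable fun (z : (ℕ → Vec p) × (ℕ → ℝ)) (t : ℕ) =>
      L (((z.1 t).ofLp ⬝ᵥ b.ofLp + z.2 t) • z.1 t - v) :=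
  measurable_pi_lambda _ (measurable_linear_score_apply L b v)

lemma score_apply {Ω : Type*} {p : ℕ} (P : ℕ → Ω → Vec p) (ε : ℕ → Ω → ℝ) (β : ℕ → Vec p) (t : ℕ) (ω : Ω) (i : Fin p) :
    score P ε β t ω i = ∑ j, β t j * (P t ω i * P t ω j) + ε t ω * P t ω i := by
  simp only [score, response, dotProduct, PiLp.smul_apply, smul_eq_mul, add_mul, Finset.sum_mul]
  congr 1
  exact Finset.sum_congr rfl fun j _ => by ring

section Model

variable {Ω : Type*} [MeasurableSpace Ω] {p : ℕ} {μ : Measure Ω} {P : ℕ → Ω → Vec p}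
  {ε : ℕ → Ω → ℝ}

lemma momentMatrix_transpose (μ : Measure Ω) (P : ℕ → Ω → Vec p) :
    (momentMatrix μ P)ᵀ = momentMatrix μ P := by
  ext i j
  simp only [momentMatrix, Matrix.transpose_apply, Matrix.of_apply, mul_comm]

lemma StrictlyStationary.identDistrib_one {E : Type*} [MeasurableSpace E] {X : ℕ → Ω → E}
    (h : StrictlyStationary μ X) {t : ℕ} (ht : 1 ≤ t) : IdentDistrib (X t) (X 1) μ μ := by
  have h1 := (h (t - 1)).comp (measurable_pi_apply 0)
  have e : 0 + 1 + (t - 1) = t := by omega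
  simpa only [Function.comp_def, e, zero_add] using h1

lemma IsLinearModel.integral_mul_eq (h : IsLinearModel μ P ε) {t : ℕ} (ht : 1 ≤ t) (i j : Fin p) :
    ∫ ω, P t ω i * P t ω j ∂μ = momentMatrix μ P i j := by
  have hm : Measurable fun x : Vec p => x i * x j := by fun_prop
  exact ((h.stationary_predictors.identDistrib_one ht).comp hm).integral_eq

lemma IsLinearModel.memLp_apply (h : IsLinearModel μ P ε) {t : ℕ} (ht : 1 ≤ t) (i : Fin p) :
    MemLp (fun ω => P t ω i) 2 μ :=
  (EuclideanSpace.proj (𝕜 := ℝ) i).comp_memLp' (h.memLp_predictors t ht)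

lemma IsLinearModel.indepFun_apply (h : IsLinearModel μ P ε) {t : ℕ} (ht : 1 ≤ t) (i : Fin p) :
    IndepFun (ε t) (fun ω => P t ω i) μ := by
  have hm : Measurable fun x : ℕ → Vec p => x (t - 1) i :=
    (EuclideanSpace.proj (𝕜 := ℝ) i).continuous.measurable.comp (measurable_pi_apply (t - 1))
  have h1 := (h.indep.comp hm (measurable_pi_apply (t - 1))).symm
  simpa only [Function.comp_def, Nat.sub_add_cancel ht] using h1

lemma IsLinearModel.integrable_mul_apply (h : IsLinearModel μ P ε) {t : ℕ} (ht : 1 ≤ t)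
    (i j : Fin p) : Integrable (fun ω => P t ω i * P t ω j) μ :=
  (h.memLp_apply ht i).integrable_mul (h.memLp_apply ht j)

/-- The moment matrix cancels out of the statistic. -/
lemma monitorStat_betaHat (hM : IsUnit (momentMatrix μ P).det) (β : ℕ → Vec p)
    (G : Matrix (Fin p) (Fin p) ℝ) (ω : Ω) (m k : ℕ) :
    monitorStat (betaHat μ P ε β ω) ((momentMatrix μ P)⁻¹ * G * (momentMatrix μ P)⁻¹) m k
      = monitorStat (scoreMean P ε β ω) G m k := by
  unfold monitorStat betaHat
  simp_rw [← map_sub, weightedNorm_conj_inv (momentMatrix_transpose μ P) hM]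

variable [IsProbabilityMeasure μ]

lemma IsLinearModel.integrable_error_mul (h : IsLinearModel μ P ε) {t : ℕ} (ht : 1 ≤ t)
    (i : Fin p) : Integrable (fun ω => ε t ω * P t ω i) μ :=
  (h.indepFun_apply ht i).integrable_mul (h.integrable_errors t ht)
    ((h.memLp_apply ht i).integrable one_le_two)

lemma IsLinearModel.integrable_score_apply (h : IsLinearModel μ P ε) (β : ℕ → Vec p) {t : ℕ}
    (ht : 1 ≤ t) (i : Fin p) : Integrable (fun ω => score P ε β t ω i) μ := by
  simp_rw [score_apply]
  exact (integrable_finsetSum _ fun j _ => (h.integrable_mul_apply ht i j).const_mul _).add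
    (h.integrable_error_mul ht i)

/-- `𝔼[P_t Y_t] = M β_t`. -/
lemma IsLinearModel.integral_score (h : IsLinearModel μ P ε) (β : ℕ → Vec p) {t : ℕ} (ht : 1 ≤ t) :
    ∫ ω, score P ε β t ω ∂μ = Matrix.toEuclideanLin (momentMatrix μ P) (β t) := by
  ext i
  rw [eval_integral_piLp (fun i => h.integrable_score_apply β ht i)]
  simp_rw [score_apply]
  rw [integral_add (integrable_finsetSum _ fun j _ => (h.integrable_mul_apply ht i j).const_mul _)
    (h.integrable_error_mul ht i), integral_finsetSum _
      fun j _ => (h.integrable_mul_apply ht i j).const_mul _]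
  have h0 : ∫ ω, ε t ω * P t ω i ∂μ = 0 := by
    have := (h.indepFun_apply ht i).integral_mul_eq_mul_integral
      (h.integrable_errors t ht).aestronglyMeasurable (h.memLp_apply ht i).aestronglyMeasurable
    rw [h.centered_errors t ht, zero_mul] at this
    exact this
  rw [h0, add_zero, ofLp_toEuclideanLin]
  simp only [integral_const_mul, h.integral_mul_eq ht, Matrix.mulVec, dotProduct]
  exact Finset.sum_congr rfl fun j _ => mul_comm _ _

lemma IsLinearModel.influence_eq (h : IsLinearModel μ P ε) (β : ℕ → Vec p) {t : ℕ} (ht : 1 ≤ t)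
    (ω : Ω) : influence μ P ε β t ω = Matrix.toEuclideanLin (momentMatrix μ P)⁻¹
      (score P ε β t ω - Matrix.toEuclideanLin (momentMatrix μ P) (β t)) := by
  rw [influence, h.integral_score β ht]

lemma toEuclideanLin_mul_apply (A B : Matrix (Fin p) (Fin p) ℝ) (v : Vec p) :
    Matrix.toEuclideanLin A (Matrix.toEuclideanLin B v) = Matrix.toEuclideanLin (A * B) v := by
  ext i
  simp only [ofLp_toEuclideanLin, Matrix.mulVec_mulVec]

lemma toEuclideanLin_one_apply (v : Vec p) :
    Matrix.toEuclideanLin (1 : Matrix (Fin p) (Fin p) ℝ) v = v := by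
  ext i
  simp only [ofLp_toEuclideanLin, Matrix.one_mulVec]

lemma IsLinearModel.score_eq (h : IsLinearModel μ P ε) (hM : IsUnit (momentMatrix μ P).det)
    (β : ℕ → Vec p) {t : ℕ} (ht : 1 ≤ t) (ω : Ω) :
    score P ε β t ω = Matrix.toEuclideanLin (momentMatrix μ P) (influence μ P ε β t ω + β t) := by
  rw [map_add, h.influence_eq β ht, toEuclideanLin_mul_apply, Matrix.mul_nonsing_inv _ hM,
    toEuclideanLin_one_apply, sub_add_cancel]

/-- By independence the pair (P, ε) is jointly stationary. With constant β the centring M β is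
constant, so the influence function is one fixed map applied at each time. -/
lemma IsLinearModel.strictlyStationary_influence (h : IsLinearModel μ P ε) {β : ℕ → Vec p}
    (hβ : ∀ t, 1 ≤ t → β t = β 1) : StrictlyStationary μ (influence μ P ε β) := by
  intro s
  set M := momentMatrix μ P
  have hsP : Measurable fun (x : ℕ → Vec p) (t : ℕ) => x (t + s) :=
    measurable_pi_lambda _ fun t => measurable_pi_apply _
  have hsε : Measurable fun (x : ℕ → ℝ) (t : ℕ) => x (t + s) :=
    measurable_pi_lambda _ fun t => measurable_pi_apply _
  have hi : IndepFun (fun ω (t : ℕ) => P (t + 1 + s) ω) (fun ω (t : ℕ) => ε (t + 1 + s) ω) μ := by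
    have := h.indep.comp hsP hsε
    simpa only [Function.comp_def, add_right_comm] using this
  have hpair := (h.stationary_predictors s).prodMk (h.stationary_errors s) hi h.indep
  have hfin := hpair.comp (measurable_linear_score (Matrix.toEuclideanLin M⁻¹) (β 1)
    (Matrix.toEuclideanLin M (β 1)))
  have e : ∀ t : ℕ, 1 ≤ t → ∀ ω, influence μ P ε β t ω = Matrix.toEuclideanLin M⁻¹
      (((P t ω).ofLp ⬝ᵥ (β 1).ofLp + ε t ω) • P t ω - Matrix.toEuclideanLin M (β 1)) := by
    intro t ht ω
    rw [h.influence_eq β ht, score, response, hβ t ht]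
  have e1 : (fun ω (t : ℕ) => influence μ P ε β (t + 1 + s) ω) = fun ω t =>
      Matrix.toEuclideanLin M⁻¹ (((P (t + 1 + s) ω).ofLp ⬝ᵥ (β 1).ofLp + ε (t + 1 + s) ω)
        • P (t + 1 + s) ω - Matrix.toEuclideanLin M (β 1)) := by
    funext ω t; exact e _ (by omega) ω
  have e2 : (fun ω (t : ℕ) => influence μ P ε β (t + 1) ω) = fun ω t =>
      Matrix.toEuclideanLin M⁻¹ (((P (t + 1) ω).ofLp ⬝ᵥ (β 1).ofLp + ε (t + 1) ω)
        • P (t + 1) ω - Matrix.toEuclideanLin M (β 1)) := by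
    funext ω t; exact e _ (by omega) ω
  rw [e1, e2]
  unfold Function.comp at hfin
  beta_reduce at hfin
  exact hfin

/-- The long-run variances of `Y_t P_t` and of the influence functions are related by
`Γ = M Σ M`. -/
lemma IsLinearModel.longRunVariance_eq (h : IsLinearModel μ P ε)
    (hM : IsUnit (momentMatrix μ P).det) {β : ℕ → Vec p} {S Γ : Matrix (Fin p) (Fin p) ℝ}
    (hS : HasLongRunVariance μ (influence μ P ε β) S)
    (hΓ : HasLongRunVariance μ (score P ε β) Γ) :
    Γ = momentMatrix μ P * S * momentMatrix μ P := by
  set M := momentMatrix μ P with hMdef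
  have hcov : ∀ n : ℤ, autocov μ (score P ε β) n = M * autocov μ (influence μ P ε β) n * M := by
    intro n
    have hexp : ∀ t : ℕ, 1 ≤ t → ∀ i : Fin p, (fun ω => score P ε β t ω i)
        = fun ω => ∑ k, M i k * influence μ P ε β t ω k + (M *ᵥ (β t).ofLp) i := by
      intro t ht i
      funext ω
      rw [h.score_eq hM β ht, map_add]
      rfl
    have hmem : ∀ t : ℕ, 1 ≤ t → ∀ i : Fin p, MemLp (fun ω => influence μ P ε β t ω i) 2 μ :=
      fun t ht i => (EuclideanSpace.proj (𝕜 := ℝ) i).comp_memLp' (hS.1 t ht)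
    ext i j
    unfold autocov
    rw [Matrix.of_apply, hexp _ (by omega), hexp _ (by omega)]
    have hm1 : ∀ t : ℕ, 1 ≤ t → ∀ i k : Fin p,
        MemLp (fun ω => M i k * influence μ P ε β t ω k) 2 μ :=
      fun t ht i k => (hmem t ht k).const_mul _
    have hint : ∀ t : ℕ, 1 ≤ t → ∀ i : Fin p,
        Integrable (fun ω => ∑ k, M i k * influence μ P ε β t ω k) μ := fun t ht i =>
      (memLp_finsetSum _ fun k _ => hm1 t ht i k).integrable one_le_two
    -- The deterministic shifts M β_t do not affect covariances, so β may vary in time.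
    rw [covariance_add_const_left (hint _ (by omega) _), covariance_add_const_right
      (hint _ (by omega) _), covariance_fun_sum_fun_sum (fun k => hm1 _ (by omega) _ k)
      (fun k => hm1 _ (by omega) _ k)]
    simp only [covariance_const_mul_left, covariance_const_mul_right, Matrix.mul_apply,
      Matrix.of_apply, Finset.sum_mul]
    rw [Finset.sum_comm]
    refine Finset.sum_congr rfl fun k _ => Finset.sum_congr rfl fun l _ => ?_
    have : M j k = M k j := by
      conv_lhs => rw [hMdef, ← momentMatrix_transpose, Matrix.transpose_apply]
    rw [this]
    ring
  have h1 : Tendsto (fun n : ℕ => ∑ k ∈ Finset.Icc (-(n : ℤ)) n, autocov μ (score P ε β) k) atTop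
      (𝓝 (M * S * M)) := by
    simp_rw [hcov, ← Finset.sum_mul, ← Finset.mul_sum]
    have hc : Continuous fun A : Matrix (Fin p) (Fin p) ℝ => M * A * M :=
      (Continuous.matrix_mul continuous_const continuous_id).matrix_mul continuous_const
    exact (hc.tendsto S).comp hS.2
  exact tendsto_nhds_unique hΓ.2 h1

end Model

/-! ### The level of the test -/

/-- The pairs of nonnegative rational times `s ≤ t`. -/
abbrev RatPair := {q : ℚ≥0 × ℚ≥0 // q.1 ≤ q.2}

/-- The statistic of the limit process at a pair of rational times. -/
noncomputable def limitStat {p : ℕ} (w : ℝ≥0 → ℝ) (W : ℝ≥0 → Vec p) (q : RatPair) : ℝ :=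
  (((q.1.2 : ℝ≥0) : ℝ) + 1) * w (q.1.2 : ℝ≥0)
    * ‖W ((q.1.1 : ℝ≥0) / ((q.1.1 : ℝ≥0) + 1)) - W ((q.1.2 : ℝ≥0) / ((q.1.2 : ℝ≥0) + 1))‖

lemma lt_limitSup_of_lt_limitStat {p : ℕ} {w : ℝ≥0 → ℝ} {W : ℝ≥0 → Vec p} {q : RatPair} {c : ℝ}
    (h : c < limitStat w W q) : (c : EReal) < limitSup w W := by
  have hq : (q.1.1 : ℝ≥0) ≤ q.1.2 := by exact_mod_cast q.2
  refine lt_iSup_iff.mpr ⟨q.1.2, lt_iSup_iff.mpr ⟨q.1.1, lt_iSup_iff.mpr ⟨hq, ?_⟩⟩⟩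
  exact EReal.coe_lt_coe_iff.mpr h

lemma limitSup_nonneg {p : ℕ} (w : ℝ≥0 → ℝ) (W : ℝ≥0 → Vec p) : (0 : EReal) ≤ limitSup w W := by
  refine le_trans ?_ (le_iSup_of_le 0 (le_iSup_of_le 0 (le_iSup_of_le le_rfl le_rfl)))
  simp

/-- The grid times j/m and k/m are rational, and t = k/m satisfies t/(t+1) = k/(m+k). -/
lemma exists_lt_limitStat_of_grid {p : ℕ} {w : ℝ≥0 → ℝ} {W : ℝ≥0 → Vec p} {c : ℝ} {m j k : ℕ}
    (hm : 1 ≤ m) (hjk : j < k)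
    (h : c < (((((k : ℝ≥0) / (m : ℝ≥0) : ℝ≥0) : ℝ) + 1) * w ((k : ℝ≥0) / (m : ℝ≥0)))
      * ‖W ((j : ℝ≥0) / ((m : ℝ≥0) + j)) - W ((k : ℝ≥0) / ((m : ℝ≥0) + k))‖) :
    ∃ q : RatPair, c < limitStat w W q := by
  have hm0 : (m : ℝ≥0) ≠ 0 := by positivity
  have e : ∀ i : ℕ, (((i : ℚ≥0) / (m : ℚ≥0) : ℚ≥0) : ℝ≥0) = (i : ℝ≥0) / m := fun i => by push_cast; rfl
  have e2 : ∀ i : ℕ, (i : ℝ≥0) / m / ((i : ℝ≥0) / m + 1) = (i : ℝ≥0) / (m + i) := fun i => by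
    field_simp
    rw [add_comm]
  refine ⟨⟨((j : ℚ≥0) / m, (k : ℚ≥0) / m), ?_⟩, ?_⟩
  · have : (j : ℚ≥0) ≤ k := by exact_mod_cast hjk.le
    exact div_le_div_of_nonneg_right this zero_le
  · unfold limitStat
    simp only [e, e2]
    exact h

lemma measurable_limitStat {Ω : Type*} [MeasurableSpace Ω] {p : ℕ} {W : ℝ≥0 → Ω → Vec p}
    (hW : ∀ t, Measurable (W t)) (w : ℝ≥0 → ℝ) (q : RatPair) :
    Measurable fun ω => limitStat w (fun t => W t ω) q :=
  ((hW _).sub (hW _)).norm.const_mul _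

/-- The upper level probabilities of the limit statistic are continuous at positive levels. -/
lemma IsStdBrownian.exists_measure_limitStat_le {Ω : Type*} [MeasurableSpace Ω] {μ : Measure Ω}
    [IsProbabilityMeasure μ] {p : ℕ} {W : ℝ≥0 → Ω → Vec p} (hW : IsStdBrownian μ W) {w : ℝ≥0 → ℝ}
    (hw : ∀ t, 0 ≤ w t) {A : ℝ} (hA : ∀ t : ℝ≥0, ((t : ℝ) + 1) * w t ≤ A) {c : ℝ} (hc : 0 < c)
    {α : ℝ≥0∞} (hα : μ {ω | ∃ q, c < limitStat w (fun t => W t ω) q} ≤ α) (hα' : α ≠ ⊤)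
    {η : ℝ≥0} (hη : 0 < η) :
    ∃ c' : ℝ, 0 < c' ∧ c' < c ∧ μ {ω | ∃ q, c' < limitStat w (fun t => W t ω) q} ≤ α + η := by
  set E : ℝ → Set Ω := fun x => {ω | ∃ q, x < limitStat w (fun t => W t ω) q} with hE
  have hEm : ∀ x, MeasurableSet (E x) := fun x => by
    refine measurableSet_setOfPred.mpr (Measurable.exists fun q => ?_)
    exact measurableSet_setOfPred.mp
      (measurableSet_lt measurable_const (measurable_limitStat hW.measurable w q))
  have hanti : Antitone fun n : ℕ => E (c - 1 / ((n : ℝ) + 1)) := by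
    intro a b hab ω hω
    obtain ⟨q, hq⟩ := hω
    refine ⟨q, lt_of_le_of_lt ?_ hq⟩
    have : (1 : ℝ) / (b + 1) ≤ 1 / (a + 1) := by
      have : (a : ℝ) ≤ b := by exact_mod_cast hab
      gcongr
    linarith
  have hlim := tendsto_measure_iInter_atTop (μ := μ)
    (fun n : ℕ => (hEm (c - 1 / ((n : ℝ) + 1))).nullMeasurableSet) hanti ⟨0, measure_ne_top _ _⟩
  have hle1 : ∀ t : ℝ≥0, t / (t + 1) ≤ 1 := fun t => by
    rw [div_le_one (by positivity)]; exact le_self_add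
  have hnull := hW.measure_iSup_eq_zero (ι := RatPair)
    (u := fun q => (q.1.1 : ℝ≥0) / ((q.1.1 : ℝ≥0) + 1))
    (v := fun q => (q.1.2 : ℝ≥0) / ((q.1.2 : ℝ≥0) + 1))
    (a := fun q => (((q.1.2 : ℝ≥0) : ℝ) + 1) * w (q.1.2 : ℝ≥0))
    (fun q => mul_nonneg (by positivity) (hw _)) (fun q => hA _) (fun q => hle1 _)
    (fun q => hle1 _) hc
  -- The intersection is the event that the supremum is at least c. Outside `E c` the supremum
  -- equals c, which has probability zero.
  have hbound : μ (⋂ n : ℕ, E (c - 1 / ((n : ℝ) + 1))) ≤ α := by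
    refine (measure_mono (t := E c ∪ {ω | (∀ q : RatPair, limitStat w (fun t => W t ω) q ≤ c) ∧
      ∀ n : ℕ, ∃ q : RatPair, c - 1 / ((n : ℝ) + 1) < limitStat w (fun t => W t ω) q}) ?_).trans
        ((measure_union_le _ _).trans ?_)
    · intro ω hω
      by_cases h : ω ∈ E c
      · exact Or.inl h
      · refine Or.inr ⟨fun q => ?_, fun n => Set.mem_iInter.mp hω n⟩
        by_contra hq
        exact h ⟨q, not_le.mp hq⟩
    · rw [show μ {ω | (∀ q : RatPair, limitStat w (fun t => W t ω) q ≤ c) ∧ ∀ n : ℕ, ∃ q : RatPair,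
        c - 1 / ((n : ℝ) + 1) < limitStat w (fun t => W t ω) q} = 0 from hnull, add_zero]
      exact hα
  have hlt : μ (⋂ n : ℕ, E (c - 1 / ((n : ℝ) + 1))) < α + η :=
    hbound.trans_lt (ENNReal.lt_add_right hα' (by simpa using hη.ne'))
  have hev := hlim.eventually (gt_mem_nhds hlt)
  have hpos : ∀ᶠ n : ℕ in atTop, (1 : ℝ) / (n + 1) < c :=
    (tendsto_one_div_add_atTop_nhds_zero_nat (𝕜 := ℝ)).eventually (gt_mem_nhds hc)
  obtain ⟨n, hn1, hn2⟩ := (hev.and hpos).exists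
  refine ⟨c - 1 / ((n : ℝ) + 1), by linarith, ?_, hn1.le⟩
  have : (0 : ℝ) < 1 / ((n : ℝ) + 1) := by positivity
  linarith

lemma norm_sum_sub_le {E : Type*} [NormedAddCommGroup E] [NormedSpace ℝ E] {Z : ℕ → E}
    {R : E →ₗ[ℝ] E} {V₁ : ℕ → E} {V₂ : E} {m : ℕ} {K ξ : ℝ} (hK : 0 ≤ K) (hξ : 0 < ξ)
    (h0 : V₁ 0 = 0)
    (h₁ : ∀ k : ℕ, 1 ≤ k → ‖∑ t ∈ Finset.Icc (m + 1) (m + k), Z t - R (V₁ k)‖ ≤ K * (k : ℝ) ^ ξ)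
    (h₂ : ‖∑ t ∈ Finset.Icc 1 m, Z t - R V₂‖ ≤ K * (m : ℝ) ^ ξ) (j : ℕ) :
    ‖∑ t ∈ Finset.Icc 1 (m + j), Z t - R (V₂ + V₁ j)‖ ≤ 2 * K * ((m : ℝ) + j) ^ ξ := by
  have hsplit : ∑ t ∈ Finset.Icc 1 (m + j), Z t
      = ∑ t ∈ Finset.Icc 1 m, Z t + ∑ t ∈ Finset.Icc (m + 1) (m + j), Z t := by
    have hd : Finset.Icc 1 (m + j) = Finset.Icc 1 m ∪ Finset.Icc (m + 1) (m + j) := by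
      ext t; simp only [Finset.mem_Icc, Finset.mem_union]; omega
    rw [hd, Finset.sum_union]
    rw [Finset.disjoint_left]; intro t; simp only [Finset.mem_Icc]; omega
  have h1' : ‖∑ t ∈ Finset.Icc (m + 1) (m + j), Z t - R (V₁ j)‖ ≤ K * (j : ℝ) ^ ξ := by
    -- The approximation after time m is assumed only from k = 1 on; j = 0 requires W₁(0) = 0.
    rcases Nat.eq_zero_or_pos j with rfl | hj
    · simp only [add_zero, h0, map_zero, sub_zero]
      rw [Finset.Icc_eq_empty (by omega), Finset.sum_empty, norm_zero]
      positivity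
    · exact h₁ j hj
  have e : ∑ t ∈ Finset.Icc 1 (m + j), Z t - R (V₂ + V₁ j)
      = (∑ t ∈ Finset.Icc 1 m, Z t - R V₂) + (∑ t ∈ Finset.Icc (m + 1) (m + j), Z t - R (V₁ j)) := by
    rw [hsplit, map_add]; abel
  rw [e]
  have hm' : (m : ℝ) ^ ξ ≤ ((m : ℝ) + j) ^ ξ := by gcongr; simp
  have hj' : (j : ℝ) ^ ξ ≤ ((m : ℝ) + j) ^ ξ := by gcongr; simp
  calc _ ≤ K * (m : ℝ) ^ ξ + K * (j : ℝ) ^ ξ := (norm_add_le _ _).trans (add_le_add h₂ h1')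
    _ ≤ K * ((m : ℝ) + j) ^ ξ + K * ((m : ℝ) + j) ^ ξ := by gcongr
    _ = _ := by ring

/-- Each mean has error at most 2K (m+i)^(ξ-1) ≤ 2K m^(ξ-1), as ξ < 1. The bound is therefore
uniform in j and k, which allows an infinite monitoring horizon. -/
lemma norm_mean_sub_mean_le {E : Type*} [NormedAddCommGroup E] [NormedSpace ℝ E] {s V : ℕ → E}
    {R Φ : E →ₗ[ℝ] E} {m : ℕ} (hm : 1 ≤ m) {K ξ C : ℝ} (hK : 0 ≤ K) (hξ : ξ < 1) (hC : 0 ≤ C)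
    (hΦR : ∀ v, ‖Φ (R v)‖ = ‖v‖) (hΦ : ∀ v, ‖Φ v‖ ≤ C * ‖v‖)
    (h : ∀ j : ℕ, ‖s j - R (V j)‖ ≤ 2 * K * ((m : ℝ) + j) ^ ξ) (j k : ℕ) :
    ‖Φ (((m : ℝ) + j)⁻¹ • s j - ((m : ℝ) + k)⁻¹ • s k)‖
      ≤ ‖((m : ℝ) + j)⁻¹ • V j - ((m : ℝ) + k)⁻¹ • V k‖ + 4 * C * K * (m : ℝ) ^ (ξ - 1) := by
  have hm0 : (0 : ℝ) < m := by exact_mod_cast hm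
  have hr : ∀ i : ℕ, ‖((m : ℝ) + i)⁻¹ • (s i - R (V i))‖ ≤ 2 * K * (m : ℝ) ^ (ξ - 1) := by
    intro i
    have hmi : (0 : ℝ) < m + i := by positivity
    rw [norm_smul, Real.norm_of_nonneg (by positivity)]
    calc ((m : ℝ) + i)⁻¹ * ‖s i - R (V i)‖ ≤ ((m : ℝ) + i)⁻¹ * (2 * K * ((m : ℝ) + i) ^ ξ) := by
          gcongr; exact h i
      _ = 2 * K * ((m : ℝ) + i) ^ (ξ - 1) := by
          rw [Real.rpow_sub_one hmi.ne']; field_simp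
      _ ≤ 2 * K * (m : ℝ) ^ (ξ - 1) := by
          have : ((m : ℝ) + i) ^ (ξ - 1) ≤ (m : ℝ) ^ (ξ - 1) :=
            Real.rpow_le_rpow_of_nonpos hm0 (by simp) (by linarith)
          gcongr
  have e : ((m : ℝ) + j)⁻¹ • s j - ((m : ℝ) + k)⁻¹ • s k
      = R (((m : ℝ) + j)⁻¹ • V j - ((m : ℝ) + k)⁻¹ • V k)
        + (((m : ℝ) + j)⁻¹ • (s j - R (V j)) - ((m : ℝ) + k)⁻¹ • (s k - R (V k))) := by
    simp only [map_sub, map_smul, smul_sub]; abel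
  rw [e, map_add]
  refine (norm_add_le _ _).trans ?_
  rw [hΦR]
  gcongr
  calc _ ≤ C * (2 * K * (m : ℝ) ^ (ξ - 1) + 2 * K * (m : ℝ) ^ (ξ - 1)) := by
        refine (hΦ _).trans ?_
        gcongr
        exact (norm_sub_le _ _).trans (add_le_add (hr j) (hr k))
    _ = _ := by ring

lemma tendsto_sqrt_mul_rpow_sub_one {ξ : ℝ} (hξ : ξ < 1 / 2) :
    Tendsto (fun m : ℕ => √(m : ℝ) * (m : ℝ) ^ (ξ - 1)) atTop (𝓝 0) := by
  have h := (tendsto_rpow_neg_atTop (y := 1 / 2 - ξ) (by linarith)).comp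
    (tendsto_natCast_atTop_atTop (R := ℝ))
  refine h.congr' ?_
  filter_upwards [eventually_ge_atTop 1] with m hm
  have hm0 : (0 : ℝ) < m := by exact_mod_cast hm
  rw [Function.comp_apply, Real.sqrt_eq_rpow, ← Real.rpow_add hm0]
  congr 1; ring

lemma posDef_of_conj {p : ℕ} {M S : Matrix (Fin p) (Fin p) ℝ} (hMs : Mᵀ = M) (hM : IsUnit M.det)
    (hS : IsUnit S.det) (h : (M * S * M).PosDef) : S.PosDef := by
  have h1 := h.posSemidef.conjTranspose_mul_mul_same M⁻¹
  have h2 : (M⁻¹)ᴴ * (M * S * M) * M⁻¹ = S := by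
    rw [Matrix.conjTranspose_eq_transpose_of_trivial, Matrix.transpose_nonsing_inv, hMs,
      ← Matrix.mul_assoc, ← Matrix.mul_assoc, Matrix.nonsing_inv_mul _ hM, Matrix.one_mul,
      Matrix.mul_assoc, Matrix.mul_nonsing_inv _ hM, Matrix.mul_one]
  rw [h2] at h1
  exact h1.posDef_iff_det_ne_zero.mpr hS.ne_zero

lemma weightedNorm_of_isEmpty (A : Matrix (Fin 0) (Fin 0) ℝ) (v : Vec 0) : weightedNorm A v = 0 := by
  simp [weightedNorm]

/-- If the weight is positive at some positive time, the limit statistic is a.s. positive. -/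
lemma IsStdBrownian.ae_exists_limitStat_pos {Ω : Type*} [MeasurableSpace Ω] {μ : Measure Ω} {p : ℕ}
    {W : ℝ≥0 → Ω → Vec p} (hW : IsStdBrownian μ W) {w : ℝ≥0 → ℝ} (i : Fin p) {t : ℚ≥0}
    (ht : 0 < t) (hwt : 0 < w (t : ℝ≥0)) :
    ∀ᵐ ω ∂μ, ∃ q, 0 < limitStat w (fun s => W s ω) q := by
  have ht' : (0 : ℝ≥0) < t := by exact_mod_cast ht
  set u : ℝ≥0 := (t : ℝ≥0) / ((t : ℝ≥0) + 1) with hu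
  have hu0 : u ≠ 0 := by positivity
  have hlaw := (hW.brownian i).hasLaw_eval u
  have := nullSingletonClass_gaussianReal (μ := 0) hu0
  have h0 : ∀ᵐ x ∂(gaussianReal 0 u), x ≠ 0 := by
    rw [ae_iff]; simp
  rw [← hlaw.map_eq] at h0
  have h1 := ae_of_ae_map hlaw.aemeasurable h0
  filter_upwards [h1, hW.ae_zero] with ω hω hω0
  refine ⟨⟨(0, t), ht.le⟩, ?_⟩
  unfold limitStat
  refine mul_pos (mul_pos (by positivity) hwt) (norm_pos_iff.mpr ?_)
  simp only [NNRat.cast_zero, zero_div, hω0, zero_sub, neg_ne_zero, ← hu]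
  intro h
  apply hω
  rw [h]; rfl

section Level

variable {Ω : Type*} [MeasurableSpace Ω] {p : ℕ} {μ : Measure Ω} {P : ℕ → Ω → Vec p}
  {ε : ℕ → Ω → ℝ}

lemma sum_score_sub_eq [IsProbabilityMeasure μ] (hLM : IsLinearModel μ P ε)
    (hM : IsUnit (momentMatrix μ P).det) {β : ℕ → Vec p} {b : Vec p} {n : ℕ}
    (hβ : ∀ t, 1 ≤ t → t ≤ n → β t = b) (ω : Ω) :
    ∑ t ∈ Finset.Icc 1 n, (score P ε β t ω - Matrix.toEuclideanLin (momentMatrix μ P) b)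
      = Matrix.toEuclideanLin (momentMatrix μ P)
        (∑ t ∈ Finset.Icc 1 n, influence μ P ε β t ω) := by
  rw [map_sum]
  refine Finset.sum_congr rfl fun t ht => ?_
  obtain ⟨h1, h2⟩ := Finset.mem_Icc.mp ht
  rw [hLM.score_eq hM β h1, hβ t h1 h2, map_add, add_sub_cancel_right]

/-- The pathwise comparison of the statistic with the discretized limit statistic. -/
lemma lt_of_lt_contrast [IsProbabilityMeasure μ] (hLM : IsLinearModel μ P ε)
    (hM : IsUnit (momentMatrix μ P).det) {β : ℕ → Vec p} (hβ : ∀ t, 1 ≤ t → β t = β 1)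
    {R Φ : Vec p →ₗ[ℝ] Vec p} {Γ A : Matrix (Fin p) (Fin p) ℝ} {m : ℕ} (hm : 1 ≤ m) {ω : Ω}
    {V₁ : ℕ → Vec p} {V₂ : Vec p} {K ξ C δ B c c' c'' : ℝ} (hK : 0 ≤ K) (hξ0 : 0 < ξ) (hξ : ξ < 1)
    (hC : 0 ≤ C) (hΦR : ∀ v, ‖Φ (R v)‖ = ‖v‖) (hΦC : ∀ v, ‖Φ v‖ ≤ C * ‖v‖)
    (hΦ : ∀ v, weightedNorm Γ⁻¹ (Matrix.toEuclideanLin (momentMatrix μ P) v) = ‖Φ v‖)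
    (h0 : V₁ 0 = 0)
    (h₁ : ∀ k : ℕ, 1 ≤ k → ‖∑ t ∈ Finset.Icc (m + 1) (m + k), influence μ P ε β t ω - R (V₁ k)‖
      ≤ K * (k : ℝ) ^ ξ)
    (h₂ : ‖∑ t ∈ Finset.Icc 1 m, influence μ P ε β t ω - R V₂‖ ≤ K * (m : ℝ) ^ ξ)
    (hδ : 0 < δ) (hA : ∀ v : Vec p, weightedNorm A⁻¹ v ≤ (1 + δ) * weightedNorm Γ⁻¹ v)
    (hc : c = (1 + δ) * c'')
    {w : ℝ≥0 → ℝ} (hw : ∀ t, 0 ≤ w t) (hB : ∀ t : ℝ≥0, ((t : ℝ) + 1) * w t ≤ B)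
    (herr : B * (4 * C * K) * (√(m : ℝ) * (m : ℝ) ^ (ξ - 1)) ≤ c'' - c') {j k : ℕ}
    (h : c < w ((k : ℝ≥0) / (m : ℝ≥0)) * ((√(m : ℝ))⁻¹ *
      contrast P ε β A m ω (Matrix.toEuclideanLin (momentMatrix μ P) (β 1)) j k)) :
    c' < (((((k : ℝ≥0) / (m : ℝ≥0) : ℝ≥0) : ℝ) + 1) * w ((k : ℝ≥0) / (m : ℝ≥0)))
      * ‖(√(m : ℝ) * ((m : ℝ) + j)⁻¹) • (V₂ + V₁ j) - (√(m : ℝ) * ((m : ℝ) + k)⁻¹) • (V₂ + V₁ k)‖ := by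
  have hm0 : (0 : ℝ) < m := by exact_mod_cast hm
  set M := momentMatrix μ P
  set s : ℕ → Vec p := fun i => ∑ t ∈ Finset.Icc 1 (m + i), influence μ P ε β t ω with hs
  have hcon : contrast P ε β A m ω (Matrix.toEuclideanLin M (β 1)) j k
      ≤ (1 + δ) * (((m : ℝ) + k) * (‖((m : ℝ) + j)⁻¹ • (V₂ + V₁ j) - ((m : ℝ) + k)⁻¹ • (V₂ + V₁ k)‖
        + 4 * C * K * (m : ℝ) ^ (ξ - 1))) := by
    unfold contrast
    rw [sum_score_sub_eq hLM hM (fun t ht _ => hβ t ht), sum_score_sub_eq hLM hM (fun t ht _ => hβ t ht),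
      ← map_smul, ← map_smul, ← map_sub]
    have h3 := norm_mean_sub_mean_le (s := s) (V := fun i => V₂ + V₁ i) (R := R) (Φ := Φ) hm hK hξ hC
      hΦR hΦC (norm_sum_sub_le hK hξ0 h0 h₁ h₂) j k
    rw [← hΦ] at h3
    exact (mul_le_mul_of_nonneg_left ((hA _).trans (mul_le_mul_of_nonneg_left h3 (by positivity)))
      (by positivity)).trans (le_of_eq (by ring))
  set a : ℝ := ((((k : ℝ≥0) / (m : ℝ≥0) : ℝ≥0) : ℝ) + 1) * w ((k : ℝ≥0) / (m : ℝ≥0)) with ha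
  have haB : a ≤ B := hB _
  have ha0 : 0 ≤ a := mul_nonneg (by positivity) (hw _)
  have hsm : √(m : ℝ) * √(m : ℝ) = m := Real.mul_self_sqrt hm0.le
  have hs0 : 0 < √(m : ℝ) := Real.sqrt_pos.mpr hm0
  set D := ‖((m : ℝ) + j)⁻¹ • (V₂ + V₁ j) - ((m : ℝ) + k)⁻¹ • (V₂ + V₁ k)‖ with hD
  have e1 : ‖(√(m : ℝ) * ((m : ℝ) + j)⁻¹) • (V₂ + V₁ j) - (√(m : ℝ) * ((m : ℝ) + k)⁻¹) • (V₂ + V₁ k)‖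
      = √(m : ℝ) * D := by
    rw [mul_smul, mul_smul, ← smul_sub, norm_smul, Real.norm_of_nonneg hs0.le]
  rw [e1]
  -- Since (m+k)/√m = √m (k/m + 1), the factor (t+1) w(t) of the limit appears at t = k/m.
  have e2 : w ((k : ℝ≥0) / (m : ℝ≥0)) * ((√(m : ℝ))⁻¹ * ((m : ℝ) + k)) = √(m : ℝ) * a := by
    rw [ha]
    push_cast
    have : (√(m : ℝ))⁻¹ * ((m : ℝ) + k) = √(m : ℝ) * ((k : ℝ) / m + 1) := by
      field_simp
      rw [sq, hsm]; ring
    rw [this]; ring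
  have h4 : c < (1 + δ) * (a * (√(m : ℝ) * D) + a * (4 * C * K) * (√(m : ℝ) * (m : ℝ) ^ (ξ - 1))) := by
    refine h.trans_le ?_
    calc _ ≤ w ((k : ℝ≥0) / (m : ℝ≥0)) * ((√(m : ℝ))⁻¹ * _) := by
          refine mul_le_mul_of_nonneg_left (mul_le_mul_of_nonneg_left hcon (by positivity)) (hw _)
      _ = (1 + δ) * ((w ((k : ℝ≥0) / (m : ℝ≥0)) * ((√(m : ℝ))⁻¹ * ((m : ℝ) + k)))
            * (D + 4 * C * K * (m : ℝ) ^ (ξ - 1))) := by ring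
      _ = _ := by rw [e2]; ring
  rw [hc] at h4
  have h5 := lt_of_mul_lt_mul_left h4 (by positivity)
  have h6 : a * (4 * C * K) * (√(m : ℝ) * (m : ℝ) ^ (ξ - 1))
      ≤ B * (4 * C * K) * (√(m : ℝ) * (m : ℝ) ^ (ξ - 1)) := by gcongr
  linarith

variable [IsProbabilityMeasure μ] {Ω' : Type*} [MeasurableSpace Ω'] {μ' : Measure Ω'}
  [IsProbabilityMeasure μ'] {W : ℝ≥0 → Ω' → Vec p} {Γhat : ℕ → Ω → Matrix (Fin p) (Fin p) ℝ}
  {wt : ℝ≥0 → ℝ} {tw : ℝ≥0} {Tw : ℝ≥0∞} {Γ : Matrix (Fin p) (Fin p) ℝ} {β : ℕ → Vec p}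

lemma limsup_measure_detector_le_of_pos (hLM : IsLinearModel μ P ε)
    (hM : IsUnit (momentMatrix μ P).det) (hw : IsWeight wt tw Tw) (hβ : ∀ t, 1 ≤ t → β t = β 1)
    (happ : ApproximationAssumption μ (influence μ P ε β))
    (hΓ : HasLongRunVariance μ (score P ε β) Γ) (hΓdet : IsUnit Γ.det)
    (hpd : ∀ᶠ m in atTop, ∀ᵐ ω ∂μ, (Γhat m ω).PosDef) (hconv : MatrixTendstoInProb μ Γhat Γ)
    {c : ℝ} (hc : 0 < c) (hW : IsStdBrownian μ' W) {α : ℝ≥0∞} (hα' : α ≠ ⊤)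
    (hα : μ' {ω | (c : EReal) < limitSup (cutoffWeight wt tw Tw) (fun t => W t ω)} ≤ α) :
    limsup (fun m : ℕ => μ {ω | (c : EReal) <
      detector P ε β (cutoffWeight wt tw Tw) (Γhat m ω) m ω}) atTop ≤ α := by
  obtain ⟨S, hS, hSdet, ξ, hξ0, hξ1, W₁, W₂, hWs, hB1, hB2⟩ := happ
  set M := momentMatrix μ P with hMdef
  set w := cutoffWeight wt tw Tw with hwdef
  have hw0 : ∀ t, 0 ≤ w t := cutoffWeight_nonneg hw
  obtain ⟨B, hB⟩ := exists_add_one_mul_cutoffWeight_le hw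
  have hΓeq : Γ = M * S * M := hLM.longRunVariance_eq hM hS hΓ
  have hΓpd : Γ.PosDef := hconv.posDef hpd hΓdet
  have hSpd : S.PosDef := posDef_of_conj (momentMatrix_transpose μ P) hM hSdet (hΓeq ▸ hΓpd)
  obtain ⟨L, hL, -⟩ := exists_clm_weightedNorm_inv hΓpd
  set R := Matrix.toEuclideanLin (open scoped MatrixOrder in CFC.sqrt S) with hR
  let Φc : Vec p →L[ℝ] Vec p := L.comp (LinearMap.toContinuousLinearMap (Matrix.toEuclideanLin M))
  have hΦ : ∀ v, weightedNorm Γ⁻¹ (Matrix.toEuclideanLin M v) = ‖Φc.toLinearMap v‖ := fun v => hL _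
  have hΦR : ∀ v, ‖Φc.toLinearMap (R v)‖ = ‖v‖ := fun v => by
    rw [← hΦ, hΓeq]
    exact weightedNorm_inv_mul_sqrt (momentMatrix_transpose μ P) hM hSpd v
  refine ENNReal.le_of_forall_pos_le_add fun η hη _ => ?_
  have hη4 : 0 < η / 4 := by positivity
  obtain ⟨c', hc'0, hc'c, hc'⟩ := hW.exists_measure_limitStat_le hw0 hB hc
    ((measure_mono fun ω hω => by
      obtain ⟨q, hq⟩ := hω; exact lt_limitSup_of_lt_limitStat hq).trans hα) hα' hη4
  -- The slack between c' and c is shared: c/c'' = 1 + δ absorbs the error of Γ̂ multiplicatively,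
  -- and c'' - c' absorbs the error of the invariance principle.
  set c'' := (c + c') / 2 with hc''
  have hc''0 : 0 < c'' := by positivity
  set δ := c / c'' - 1 with hδdef
  have hδ : 0 < δ := by
    rw [hδdef, sub_pos, one_lt_div hc''0, hc'']; linarith
  have hcδ : c = (1 + δ) * c'' := by
    rw [hδdef]; field_simp; ring
  obtain ⟨K₁, hK₁⟩ := hB1 (η / 4 : ℝ≥0) (by exact_mod_cast hη4)
  obtain ⟨K₂, hK₂⟩ := hB2 (η / 4 : ℝ≥0) (by exact_mod_cast hη4)
  set K : ℝ := max (K₁ : ℝ) K₂ with hK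
  have hK0 : 0 ≤ K := le_max_of_le_left K₁.2
  have herr : ∀ᶠ m : ℕ in atTop,
      B * (4 * ‖Φc‖ * K) * (√(m : ℝ) * (m : ℝ) ^ (ξ - 1)) ≤ c'' - c' := by
    have h := (tendsto_sqrt_mul_rpow_sub_one hξ1).const_mul (B * (4 * ‖Φc‖ * K))
    rw [mul_zero] at h
    exact h.eventually (ge_mem_nhds (by rw [hc'']; linarith))
  have hU := hconv.tendsto_measure_notMem (eventually_weightedNorm_inv_le hΓpd hδ)
  have hU' := hU.eventually (ge_mem_nhds (show (0 : ℝ≥0∞) < ((η / 4 : ℝ≥0) : ℝ≥0∞) by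
    exact_mod_cast hη4))
  refine limsup_le_of_le (by isBoundedDefault) ?_
  filter_upwards [hK₁, hK₂, herr, hU', eventually_ge_atTop 1] with m h1 h2 h3 h4 hm
  obtain ⟨hs1, hs2, hs12⟩ := hWs m
  set a : ℕ → ℝ := fun k => ((((k : ℝ≥0) / (m : ℝ≥0) : ℝ≥0) : ℝ) + 1) * w ((k : ℝ≥0) / (m : ℝ≥0))
  set E₀ : Set Ω := {ω | ∃ k j : ℕ, j < k ∧
    c' < a k * ‖(√(m : ℝ) * ((m : ℝ) + j)⁻¹) • (W₂ m m ω + W₁ m j ω)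
        - (√(m : ℝ) * ((m : ℝ) + k)⁻¹) • (W₂ m m ω + W₁ m k ω)‖} with hE₀
  have hE₀le : μ E₀ ≤ α + (η / 4 : ℝ≥0) := by
    rw [hE₀, measure_exists_lt_eq hs1 hs2 hs12 hW hm a c']
    refine (measure_mono ?_).trans hc'
    rintro ω ⟨k, j, hjk, h⟩
    exact exists_lt_limitStat_of_grid hm hjk h
  set E₁ : Set Ω := {ω | (K₁ : ℝ≥0∞) < ⨆ k : ℕ, ⨆ _ : 1 ≤ k, ENNReal.ofReal
    (‖(∑ t ∈ Finset.Icc (m + 1) (m + k), influence μ P ε β t ω) - R (W₁ m (k : ℝ≥0) ω)‖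
      / (k : ℝ) ^ ξ)} with hE₁
  set E₂ : Set Ω := {ω | (K₂ : ℝ≥0∞) < ENNReal.ofReal
    (‖(∑ t ∈ Finset.Icc 1 m, influence μ P ε β t ω) - R (W₂ m (m : ℝ≥0) ω)‖ / (m : ℝ) ^ ξ)} with hE₂
  set E₃ : Set Ω := {ω | Γhat m ω ∉ {A | ∀ v : Vec p,
    weightedNorm A⁻¹ v ≤ (1 + δ) * weightedNorm Γ⁻¹ v}} with hE₃
  have hE₄ : μ {ω | ¬ W₁ m 0 ω = 0} = 0 := ae_iff.mp hs1.ae_zero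
  -- Outside the failures of the two approximations, of the closeness of Γ̂ and of W₁(0) = 0, an
  -- exceedance of the detector forces one of the Gaussian statistic.
  have hsub : {ω | (c : EReal) < detector P ε β w (Γhat m ω) m ω}
      ⊆ E₀ ∪ (E₁ ∪ (E₂ ∪ (E₃ ∪ {ω | ¬ W₁ m 0 ω = 0}))) := by
    intro ω hω
    by_contra hne
    simp only [Set.mem_union, not_or] at hne
    obtain ⟨n0, n1, n2, n3, n4⟩ := hne
    obtain ⟨k, j, hjk, hlt⟩ := exists_lt_of_lt_detector hm (Matrix.toEuclideanLin M (β 1)) hω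
    refine n0 ⟨k, j, hjk, ?_⟩
    have hle : ∀ {x y : ℝ} {κ : ℝ≥0}, 0 < y → (κ : ℝ) ≤ K → ENNReal.ofReal (x / y) ≤ κ →
        x ≤ K * y := by
      intro x y κ hy hκ hx
      have := (ENNReal.ofReal_le_iff_le_toReal ENNReal.coe_ne_top).mp hx
      rw [ENNReal.coe_toReal] at this
      exact (div_le_iff₀ hy).mp (this.trans hκ)
    refine lt_of_lt_contrast hLM hM hβ (Φ := Φc.toLinearMap) (R := R) (Γ := Γ) (A := Γhat m ω) hm
      (V₁ := fun i => W₁ m (i : ℝ≥0) ω) (V₂ := W₂ m (m : ℝ≥0) ω) hK0 hξ0 (by linarith)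
      (norm_nonneg Φc) hΦR (fun v => Φc.le_opNorm v) hΦ ?_ ?_ ?_ hδ ?_ hcδ hw0 hB h3 hlt
    · simpa using n4
    · intro i hi
      have hi0 : (0 : ℝ) < i := by exact_mod_cast hi
      refine hle (κ := K₁) (by positivity) (le_max_left _ _) ?_
      refine le_trans ?_ (not_lt.mp n1)
      exact le_iSup₂_of_le i hi le_rfl
    · have hm0 : (0 : ℝ) < m := by exact_mod_cast hm
      exact hle (κ := K₂) (by positivity) (le_max_right _ _) (not_lt.mp n2)
    · exact not_not.mp n3
  calc μ {ω | (c : EReal) < detector P ε β w (Γhat m ω) m ω}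
      ≤ μ E₀ + (μ E₁ + (μ E₂ + (μ E₃ + μ {ω | ¬ W₁ m 0 ω = 0}))) := by
        refine (measure_mono hsub).trans ((measure_union_le _ _).trans ?_)
        gcongr
        refine (measure_union_le _ _).trans ?_
        gcongr
        refine (measure_union_le _ _).trans ?_
        gcongr
        exact measure_union_le _ _
    _ ≤ (α + (η / 4 : ℝ≥0)) + ((η / 4 : ℝ≥0) + ((η / 4 : ℝ≥0) + ((η / 4 : ℝ≥0) + 0))) := by
        gcongr
        · exact h4
        · exact hE₄.le
    _ = α + η := by
        rw [add_assoc, add_zero, ← ENNReal.coe_add, ← ENNReal.coe_add, ← ENNReal.coe_add]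
        congr 2
        ring

/-- Under the null hypothesis monitoring has asymptotic level `α`. -/
lemma limsup_measure_detector_le (hLM : IsLinearModel μ P ε)
    (hM : IsUnit (momentMatrix μ P).det) (hw : IsWeight wt tw Tw) (hβ : ∀ t, 1 ≤ t → β t = β 1)
    (happ : ApproximationAssumption μ (influence μ P ε β))
    (hΓ : HasLongRunVariance μ (score P ε β) Γ) (hΓdet : IsUnit Γ.det)
    (hpd : ∀ᶠ m in atTop, ∀ᵐ ω ∂μ, (Γhat m ω).PosDef) (hconv : MatrixTendstoInProb μ Γhat Γ)
    {c : ℝ} (hW : IsStdBrownian μ' W) {α : ℝ≥0∞} (hα' : α < 1)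
    (hα : μ' {ω | (c : EReal) < limitSup (cutoffWeight wt tw Tw) (fun t => W t ω)} ≤ α) :
    limsup (fun m : ℕ => μ {ω | (c : EReal) <
      detector P ε β (cutoffWeight wt tw Tw) (Γhat m ω) m ω}) atTop ≤ α := by
  have hnot : ¬ ∀ᵐ ω ∂μ', (c : EReal) < limitSup (cutoffWeight wt tw Tw) (fun t => W t ω) := by
    intro h
    have h1 : μ' {ω | (c : EReal) < limitSup (cutoffWeight wt tw Tw) (fun t => W t ω)} = 1 := by
      rw [measure_congr (eventuallyEq_univ.mpr h), measure_univ]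
    rw [h1] at hα
    exact (hα.trans_lt hα').false
  -- For c < 0 the limit supremum always exceeds c, which α < 1 excludes. For c = 0, a positive
  -- detector reveals a positive weight at some rational time k/m > 0 and p > 0; the limit statistic
  -- would then be positive almost surely.
  rcases lt_trichotomy c 0 with hc | rfl | hc
  · refine absurd (Eventually.of_forall fun ω => ?_) hnot
    refine lt_of_lt_of_le ?_ (limitSup_nonneg _ _)
    exact_mod_cast hc
  · refine limsup_le_of_le (by isBoundedDefault) ?_
    filter_upwards [eventually_ge_atTop 1] with m hm
    have : {ω | ((0 : ℝ) : EReal) < detector P ε β (cutoffWeight wt tw Tw) (Γhat m ω) m ω} = ∅ := by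
      refine Set.eq_empty_iff_forall_notMem.mpr fun ω hω => hnot ?_
      obtain ⟨k, j, hjk, hlt⟩ := exists_lt_of_lt_detector hm 0 hω
      have hwpos : 0 < cutoffWeight wt tw Tw ((k : ℝ≥0) / (m : ℝ≥0)) := by
        refine lt_of_le_of_ne (cutoffWeight_nonneg hw _) fun h => ?_
        rw [← h, zero_mul] at hlt
        exact hlt.false
      rcases Nat.eq_zero_or_pos p with rfl | hp
      · simp [contrast, weightedNorm_of_isEmpty] at hlt
      · have hk0 : (0 : ℚ≥0) < (k : ℚ≥0) / m := by
          have h1 : (0 : ℚ≥0) < k := by exact_mod_cast (by omega : 0 < k)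
          have h2 : (0 : ℚ≥0) < m := by exact_mod_cast hm
          exact div_pos h1 h2
        have e : ((((k : ℚ≥0) / (m : ℚ≥0) : ℚ≥0)) : ℝ≥0) = (k : ℝ≥0) / m := by push_cast; rfl
        filter_upwards [hW.ae_exists_limitStat_pos ⟨0, hp⟩ hk0 (e ▸ hwpos)] with ω' ⟨q, hq⟩
        exact lt_limitSup_of_lt_limitStat hq
    rw [this, measure_empty]
    exact zero_le
  · exact limsup_measure_detector_le_of_pos hLM hM hw hβ happ hΓ hΓdet hpd hconv hc hW
      (hα'.trans ENNReal.one_lt_top).ne hα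

end Level

/-! ### Consistency under the alternative. -/

lemma exists_norm_le_norm_toEuclideanLin {p : ℕ} {M : Matrix (Fin p) (Fin p) ℝ}
    (hM : IsUnit M.det) : ∃ C : ℝ, 0 < C ∧ ∀ v : Vec p, ‖v‖ ≤ C * ‖Matrix.toEuclideanLin M v‖ := by
  set T := LinearMap.toContinuousLinearMap (Matrix.toEuclideanLin M⁻¹) with hT
  refine ⟨‖T‖ + 1, by positivity, fun v => ?_⟩
  have h1 : T (Matrix.toEuclideanLin M v) = v := by
    change Matrix.toEuclideanLin M⁻¹ (Matrix.toEuclideanLin M v) = v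
    rw [toEuclideanLin_mul_apply, Matrix.nonsing_inv_mul _ hM, toEuclideanLin_one_apply]
  calc ‖v‖ = ‖T (Matrix.toEuclideanLin M v)‖ := by rw [h1]
    _ ≤ ‖T‖ * ‖Matrix.toEuclideanLin M v‖ := T.le_opNorm _
    _ ≤ _ := by gcongr; linarith

lemma exists_le_of_forall_le {wt : ℝ≥0 → ℝ} {tw : ℝ≥0} {Tw : ℝ≥0∞} (hw : IsWeight wt tw Tw)
    (C : ℝ≥0) : ∃ q : ℝ, 0 < q ∧ ∀ t ≤ C, q ≤ wt t := by
  obtain ⟨x, -, hx⟩ := (isCompact_Icc (a := (0 : ℝ≥0)) (b := C)).exists_isMinOn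
    ⟨0, by simp⟩ hw.continuous.continuousOn
  exact ⟨wt x, hw.pos x, fun t ht => hx ⟨zero_le, ht⟩⟩

/-- Subadditivity, 1 ≤ μ(A) + μ(Aᶜ), replaces the complement formula, so the sets need not be
measurable. -/
lemma tendsto_measure_one_of_forall_subset {Ω : Type*} [MeasurableSpace Ω] {μ : Measure Ω}
    [IsProbabilityMeasure μ] {A : ℕ → Set Ω}
    (h : ∀ δ : ℝ≥0∞, 0 < δ → ∀ᶠ m in atTop, μ (A m)ᶜ ≤ δ) :
    Tendsto (fun m => μ (A m)) atTop (𝓝 1) := by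
  refine tendsto_order.2 ⟨fun a ha => ?_, fun a ha => Eventually.of_forall fun m =>
    prob_le_one.trans_lt ha⟩
  have hpos : 0 < (1 - a) / 2 := ENNReal.half_pos (tsub_pos_of_lt ha).ne'
  filter_upwards [h _ hpos] with m hm
  by_contra hle
  have h1 : (1 : ℝ≥0∞) ≤ μ (A m) + μ (A m)ᶜ := by
    rw [← measure_univ (μ := μ), ← Set.union_compl_self (A m)]
    exact measure_union_le _ _
  have h2 : (1 : ℝ≥0∞) < a + (1 - a) := by
    refine h1.trans_lt ((add_le_add (not_lt.mp hle) hm).trans_lt ?_)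
    exact ENNReal.add_lt_add_left (ha.trans ENNReal.one_lt_top).ne
      (ENNReal.half_lt_self (tsub_pos_of_lt ha).ne' (by finiteness))
  rw [add_tsub_cancel_of_le ha.le] at h2
  exact h2.false

/-- A drift visible up to time `k₀` is visible, up to a factor, at time `k₀` and at time
`k₀ + 1`. -/
lemma exists_le_contrast {Ω : Type*} {p : ℕ} {P : ℕ → Ω → Vec p} {ε : ℕ → Ω → ℝ}
    {β : ℕ → Vec p} {A : Matrix (Fin p) (Fin p) ℝ} {l : ℝ} (hl : 0 < l)
    (hA : ∀ v : Vec p, l * ‖v‖ ≤ weightedNorm A⁻¹ v) {m j k₀ k : ℕ} (hj : j < k₀)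
    (hk : k = k₀ ∨ k = k₀ + 1) (b : Vec p) (ω : Ω) :
    ∃ i, i < k ∧ l / 2 * (((m : ℝ) + k₀) *
      ‖((m : ℝ) + j)⁻¹ • ∑ t ∈ Finset.Icc 1 (m + j), (score P ε β t ω - b)
        - ((m : ℝ) + k₀)⁻¹ • ∑ t ∈ Finset.Icc 1 (m + k₀), (score P ε β t ω - b)‖)
      ≤ contrast P ε β A m ω b i k := by
  set x : ℕ → Vec p := fun i => ((m : ℝ) + i)⁻¹ • ∑ t ∈ Finset.Icc 1 (m + i), (score P ε β t ω - b)
    with hx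
  have hcon : ∀ i i' : ℕ, ((m : ℝ) + i') * (l * ‖x i - x i'‖) ≤ contrast P ε β A m ω b i i' := by
    intro i i'
    exact mul_le_mul_of_nonneg_left (hA _) (by positivity)
  change ∃ i, i < k ∧ l / 2 * (((m : ℝ) + k₀) * ‖x j - x k₀‖) ≤ _
  rcases hk with rfl | rfl
  · refine ⟨j, hj, le_trans ?_ (hcon j k)⟩
    have : 0 ≤ l * (((m : ℝ) + k) * ‖x j - x k‖) := by positivity
    linarith
  -- By the triangle inequality through the mean at k₀ + 1, one of the starting points j and k₀
  -- retains half of the contrast. No noise bound at the extra time is needed.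
  · have htri : ‖x j - x k₀‖ ≤ ‖x j - x (k₀ + 1)‖ + ‖x k₀ - x (k₀ + 1)‖ := by
      rw [norm_sub_rev (x k₀)]; exact norm_sub_le_norm_sub_add_norm_sub _ _ _
    have key : ∀ i, ‖x j - x k₀‖ ≤ 2 * ‖x i - x (k₀ + 1)‖ →
        l / 2 * (((m : ℝ) + k₀) * ‖x j - x k₀‖) ≤ contrast P ε β A m ω b i (k₀ + 1) := by
      intro i hi
      refine le_trans ?_ (hcon i (k₀ + 1))
      calc l / 2 * (((m : ℝ) + k₀) * ‖x j - x k₀‖)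
          ≤ l / 2 * (((m : ℝ) + (k₀ + 1 : ℕ)) * (2 * ‖x i - x (k₀ + 1)‖)) := by
            gcongr; simp
        _ = _ := by ring
    rcases le_total ‖x j - x (k₀ + 1)‖ ‖x k₀ - x (k₀ + 1)‖ with h | h
    · exact ⟨k₀, by omega, key _ (by linarith)⟩
    · exact ⟨j, by omega, key _ (by linarith)⟩

section Consistency

variable {Ω : Type*} [MeasurableSpace Ω] {p : ℕ} {μ : Measure Ω} [IsProbabilityMeasure μ]
  {P : ℕ → Ω → Vec p} {ε : ℕ → Ω → ℝ}

/-- The contrast between the means before the change and up to a later time is at least the drift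
minus the noise. -/
lemma drift_sub_noise_le (hLM : IsLinearModel μ P ε)
    (hM : IsUnit (momentMatrix μ P).det) {C : ℝ}
    (hMC : ∀ v : Vec p, ‖v‖ ≤ C * ‖Matrix.toEuclideanLin (momentMatrix μ P) v‖)
    {β : ℕ → Vec p} {b₁ b₂ : Vec p} {m κ n : ℕ} (hm : 1 ≤ m) (hκ : 1 ≤ κ)
    (hb₁ : ∀ t, 1 ≤ t → t < m + κ → β t = b₁) (hb₂ : ∀ t, m + κ ≤ t → β t = b₂) (ω : Ω) :
    ((n : ℝ) + 1) * ‖b₁ - b₂‖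
      - ((n : ℝ) + 1) / ((m : ℝ) + κ - 1) * ‖∑ t ∈ Finset.Icc 1 (m + κ - 1), influence μ P ε β t ω‖
      - ‖∑ t ∈ Finset.Icc (m + κ) (m + κ + n), influence μ P ε β t ω‖
    ≤ C * (((m : ℝ) + (κ + n : ℕ)) *
      ‖((m : ℝ) + (κ - 1 : ℕ))⁻¹ • ∑ t ∈ Finset.Icc 1 (m + (κ - 1)),
          (score P ε β t ω - Matrix.toEuclideanLin (momentMatrix μ P) b₁)
        - ((m : ℝ) + (κ + n : ℕ))⁻¹ • ∑ t ∈ Finset.Icc 1 (m + (κ + n)),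
          (score P ε β t ω - Matrix.toEuclideanLin (momentMatrix μ P) b₁)‖) := by
  set M := momentMatrix μ P
  have hm1 : (1 : ℝ) ≤ m := by exact_mod_cast hm
  have hκ1 : (1 : ℝ) ≤ κ := by exact_mod_cast hκ
  have hn0 : (0 : ℝ) ≤ n := n.cast_nonneg
  set S := ∑ t ∈ Finset.Icc 1 (m + κ - 1), influence μ P ε β t ω
  set T := ∑ t ∈ Finset.Icc (m + κ) (m + κ + n), influence μ P ε β t ω with hT
  have e1 : ∑ t ∈ Finset.Icc 1 (m + (κ - 1)), (score P ε β t ω - Matrix.toEuclideanLin M b₁)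
      = Matrix.toEuclideanLin M S := by
    rw [sum_score_sub_eq hLM hM (fun t h1 h2 => hb₁ t h1 (by omega)),
      show m + (κ - 1) = m + κ - 1 by omega]
  have e2 : ∑ t ∈ Finset.Icc 1 (m + (κ + n)), (score P ε β t ω - Matrix.toEuclideanLin M b₁)
      = Matrix.toEuclideanLin M (S + (T + ((n : ℝ) + 1) • (b₂ - b₁))) := by
    have hu : Finset.Icc 1 (m + (κ + n))
        = Finset.Icc 1 (m + (κ - 1)) ∪ Finset.Icc (m + κ) (m + κ + n) := by
      ext t; simp only [Finset.mem_Icc, Finset.mem_union]; omega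
    have hd : Disjoint (Finset.Icc 1 (m + (κ - 1))) (Finset.Icc (m + κ) (m + κ + n)) := by
      refine Finset.disjoint_left.mpr fun t => ?_
      simp only [Finset.mem_Icc]; omega
    rw [hu, Finset.sum_union hd, e1, map_add]
    congr 1
    have h3 : ∀ t ∈ Finset.Icc (m + κ) (m + κ + n),
        score P ε β t ω - Matrix.toEuclideanLin M b₁
          = Matrix.toEuclideanLin M (influence μ P ε β t ω + (b₂ - b₁)) := by
      intro t ht
      have h4 := (Finset.mem_Icc.mp ht).1
      rw [hLM.score_eq hM β (by omega), hb₂ t h4, ← map_sub, add_sub_assoc]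
    rw [Finset.sum_congr rfl h3, ← map_sum, Finset.sum_add_distrib, Finset.sum_const,
      Nat.card_Icc, show m + κ + n + 1 - (m + κ) = n + 1 by omega, ← Nat.cast_smul_eq_nsmul ℝ]
    push_cast
    rfl
  rw [e1, e2, ← map_smul, ← map_smul, ← map_sub]
  set a : ℝ := (m : ℝ) + κ - 1 with ha
  have ha0 : 0 < a := by rw [ha]; linarith
  have ea : (m : ℝ) + (κ - 1 : ℕ) = a := by rw [Nat.cast_sub hκ]; push_cast; ring
  have eb : (m : ℝ) + (κ + n : ℕ) = a + (n + 1) := by push_cast; ring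
  rw [ea, eb]
  have hb0 : 0 < a + ((n : ℝ) + 1) := by positivity
  set v := a⁻¹ • S - (a + ((n : ℝ) + 1))⁻¹ • (S + (T + ((n : ℝ) + 1) • (b₂ - b₁))) with hv
  -- Here `a` = m + κ - 1 is the number of observations before the change and n + 1 the number after
  -- it. Solving the definition of `v` for the drift leaves only the noise sums S and T.
  have h5 : ((n : ℝ) + 1) • (b₁ - b₂) = (a + ((n : ℝ) + 1)) • v - (((n : ℝ) + 1) / a) • S + T := by
    have e5 : (a + ((n : ℝ) + 1)) • v
        = ((a + ((n : ℝ) + 1)) * a⁻¹) • S - (S + (T + ((n : ℝ) + 1) • (b₂ - b₁))) := by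
      rw [hv, smul_sub, smul_smul, smul_inv_smul₀ hb0.ne']
    have e6 : (a + ((n : ℝ) + 1)) * a⁻¹ = 1 + ((n : ℝ) + 1) / a := by field_simp
    rw [e5, e6]
    module
  have h6 : ((n : ℝ) + 1) * ‖b₁ - b₂‖
      ≤ (a + ((n : ℝ) + 1)) * ‖v‖ + ((n : ℝ) + 1) / a * ‖S‖ + ‖T‖ := by
    rw [← Real.norm_of_nonneg (show (0 : ℝ) ≤ (n : ℝ) + 1 by positivity), ← norm_smul,
      Real.norm_of_nonneg (show (0 : ℝ) ≤ (n : ℝ) + 1 by positivity), h5]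
    refine (norm_add_le _ _).trans (add_le_add_left ((norm_sub_le _ _).trans ?_) _)
    rw [norm_smul, norm_smul, Real.norm_of_nonneg hb0.le, Real.norm_of_nonneg (by positivity)]
  have h7 := mul_le_mul_of_nonneg_left (hMC v) hb0.le
  linarith [h7, h6]

/-- The pathwise lower bound of the detector under the alternative. -/
lemma lt_detector_of_change (hLM : IsLinearModel μ P ε)
    (hM : IsUnit (momentMatrix μ P).det) {C : ℝ} (hC : 0 < C)
    (hMC : ∀ v : Vec p, ‖v‖ ≤ C * ‖Matrix.toEuclideanLin (momentMatrix μ P) v‖)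
    {β : ℕ → Vec p} {b₁ b₂ : Vec p} {m κ N k : ℕ} (hm : 1 ≤ m) (hκ : 1 ≤ κ) (hN : 1 ≤ N)
    (hNle : N ≤ m + κ - 1)
    (hb₁ : ∀ t, 1 ≤ t → t < m + κ → β t = b₁) (hb₂ : ∀ t, m + κ ≤ t → β t = b₂) {ω : Ω}
    {A : Matrix (Fin p) (Fin p) ℝ} {l : ℝ} (hl : 0 < l)
    (hA : ∀ v : Vec p, l * ‖v‖ ≤ weightedNorm A⁻¹ v) {ca K₁ K₂ q D c : ℝ} (hca : 0 < ca)
    (hK₁ : 0 ≤ K₁) (hK₂ : 0 ≤ K₂) (hq : 0 < q)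
    (h₁ : ‖∑ t ∈ Finset.Icc 1 (m + κ - 1), influence μ P ε β t ω‖ ≤ K₁ * √((m : ℝ) + κ))
    (h₂ : ‖∑ t ∈ Finset.Icc (m + κ) (m + κ + ⌊ca * N⌋₊), influence μ P ε β t ω‖ ≤ K₂ * √(N : ℝ))
    (hk : k = κ + ⌊ca * N⌋₊ ∨ k = κ + ⌊ca * N⌋₊ + 1)
    {w : ℝ≥0 → ℝ} (hwk : q * m ≤ w ((k : ℝ≥0) / (m : ℝ≥0)) * N)
    (hD : √(m : ℝ) * √((m : ℝ) + κ) ≤ D * N)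
    (hc : |c| < q * (l / (2 * C) * (ca * (√(m : ℝ) * ‖b₁ - b₂‖) - ((ca + 1) * K₁ + K₂) * D))) :
    (c : EReal) < detector P ε β w A m ω := by
  set n := ⌊ca * (N : ℝ)⌋₊ with hn
  have hm0 : (0 : ℝ) < m := by exact_mod_cast hm
  have hN0 : (0 : ℝ) < N := by exact_mod_cast hN
  have hNa : (N : ℝ) ≤ (m : ℝ) + κ - 1 := by
    have : (N : ℝ) + 1 ≤ (m : ℝ) + κ := by exact_mod_cast (by omega : N + 1 ≤ m + κ)
    linarith
  obtain ⟨i, hik, hi⟩ := exists_le_contrast (P := P) (ε := ε) (β := β) (m := m) (j := κ - 1)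
    (k₀ := κ + n) hl hA (by omega) hk (Matrix.toEuclideanLin (momentMatrix μ P) b₁) ω
  have hdr := drift_sub_noise_le hLM hM hMC (n := n) hm hκ hb₁ hb₂ ω
  have hwk0 : 0 ≤ w ((k : ℝ≥0) / (m : ℝ≥0)) := by
    have : 0 ≤ w ((k : ℝ≥0) / (m : ℝ≥0)) * N := le_trans (by positivity) hwk
    exact nonneg_of_mul_nonneg_left this hN0
  refine lt_detector hm (Matrix.toEuclideanLin (momentMatrix μ P) b₁) hik hwk0 ?_
  set W := w ((k : ℝ≥0) / (m : ℝ≥0))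
  set X := ((m : ℝ) + (κ + n : ℕ)) *
      ‖((m : ℝ) + (κ - 1 : ℕ))⁻¹ • ∑ t ∈ Finset.Icc 1 (m + (κ - 1)),
          (score P ε β t ω - Matrix.toEuclideanLin (momentMatrix μ P) b₁)
        - ((m : ℝ) + (κ + n : ℕ))⁻¹ • ∑ t ∈ Finset.Icc 1 (m + (κ + n)),
          (score P ε β t ω - Matrix.toEuclideanLin (momentMatrix μ P) b₁)‖
  set S := ‖∑ t ∈ Finset.Icc 1 (m + κ - 1), influence μ P ε β t ω‖
  set T := ‖∑ t ∈ Finset.Icc (m + κ) (m + κ + n), influence μ P ε β t ω‖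
  set d := ‖b₁ - b₂‖
  set r := √((m : ℝ) + κ)
  set s := √(m : ℝ)
  have hs0 : 0 < s := Real.sqrt_pos.mpr hm0
  have hss : s * s = m := Real.mul_self_sqrt hm0.le
  have hn1 : ca * N ≤ (n : ℝ) + 1 := (Nat.lt_floor_add_one _).le
  have hn2 : (n : ℝ) ≤ ca * N := Nat.floor_le (by positivity)
  have hN1 : (1 : ℝ) ≤ N := by exact_mod_cast hN
  -- From n ≤ ca N and 1 ≤ N ≤ m + κ - 1.
  have hratio : ((n : ℝ) + 1) / ((m : ℝ) + κ - 1) ≤ ca + 1 := by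
    rw [div_le_iff₀ (by linarith)]
    nlinarith
  have hNr : √(N : ℝ) ≤ r := Real.sqrt_le_sqrt (by linarith)
  have hS : ((n : ℝ) + 1) / ((m : ℝ) + κ - 1) * S ≤ (ca + 1) * (K₁ * r) := by
    have hS0 : 0 ≤ S := norm_nonneg _
    gcongr
  have hT : T ≤ K₂ * r := h₂.trans (by gcongr)
  have hd : ca * N * d ≤ ((n : ℝ) + 1) * d := by
    have hd0 : 0 ≤ d := norm_nonneg _
    gcongr
  have hX : ca * N * d - ((ca + 1) * K₁ + K₂) * r ≤ C * X := by linarith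
  have hKK : 0 ≤ (ca + 1) * K₁ + K₂ := by positivity
  have hX2 : N * (ca * (s * d) - ((ca + 1) * K₁ + K₂) * D) ≤ s * (C * X) := by
    have e1 := mul_le_mul_of_nonneg_left hX hs0.le
    have e2 := mul_le_mul_of_nonneg_left hD hKK
    linarith
  set B := ca * (s * d) - ((ca + 1) * K₁ + K₂) * D
  -- Bounding |c| rather than c makes drift minus noise positive, so the weight may be replaced by
  -- its lower bound below.
  have hB : 0 < B := by
    have h1 : 0 < q * (l / (2 * C) * B) := (abs_nonneg c).trans_lt hc
    have h2 := pos_of_mul_pos_right h1 hq.le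
    exact pos_of_mul_pos_right h2 (by positivity)
  calc c ≤ |c| := le_abs_self c
    _ < q * (l / (2 * C) * B) := hc
    _ = q * m * (l / (2 * C) * B) * (s⁻¹ * s⁻¹) := by
      rw [← hss]; field_simp
    _ ≤ W * N * (l / (2 * C) * B) * (s⁻¹ * s⁻¹) := by gcongr
    _ = W * (l / (2 * C)) * (s⁻¹ * s⁻¹) * (N * B) := by ring
    _ ≤ W * (l / (2 * C)) * (s⁻¹ * s⁻¹) * (s * (C * X)) := by gcongr
    _ = W * (s⁻¹ * (l / 2 * X)) := by field_simp
    _ ≤ _ := by gcongr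

/-- Consistency from the bounds on the noise and on the weight at the end of a window of length
`ca * N m` after the change. -/
lemma tendsto_measure_lt_detector_of_window (hLM : IsLinearModel μ P ε)
    (hM : IsUnit (momentMatrix μ P).det) {wt : ℝ≥0 → ℝ} {tw : ℝ≥0} {Tw : ℝ≥0∞}
    {β : ℕ → ℕ → Vec p} {κ : ℕ → ℕ} {b₁ b₂ : ℕ → Vec p}
    (h : AlternativeAssumption μ P ε β κ b₁ b₂ wt tw Tw)
    {G : Matrix (Fin p) (Fin p) ℝ} {Γhat : ℕ → Ω → Matrix (Fin p) (Fin p) ℝ}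
    (hpd : ∀ᶠ m in atTop, ∀ᵐ ω ∂μ, (Γhat m ω).PosDef)
    (hconv : MatrixTendstoInProb μ Γhat G) (hG : IsUnit G.det)
    {ca q D : ℝ} (hca : 0 < ca) (hq : 0 < q) {N : ℕ → ℕ}
    (hN : ∀ᶠ m in atTop, 1 ≤ N m ∧ N m ≤ m + κ m - 1)
    (hpost : BoundedInProb μ (fun m ω => ENNReal.ofReal ((√(N m : ℝ))⁻¹ *
      ‖∑ t ∈ Finset.Icc (m + κ m) (m + κ m + ⌊ca * N m⌋₊), influence μ P ε (β m) t ω‖)))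
    {w : ℝ≥0 → ℝ}
    (hw : ∀ᶠ m in atTop, ∃ k : ℕ, (k = κ m + ⌊ca * N m⌋₊ ∨ k = κ m + ⌊ca * N m⌋₊ + 1) ∧
      q * m ≤ w ((k : ℝ≥0) / (m : ℝ≥0)) * N m)
    (hD : ∀ᶠ m : ℕ in atTop, √(m : ℝ) * √((m : ℝ) + κ m) ≤ D * N m) (c : ℝ) :
    Tendsto (fun m : ℕ => μ {ω | (c : EReal) < detector P ε (β m) w (Γhat m ω) m ω})
      atTop (𝓝 1) := by
  obtain ⟨C, hC, hMC⟩ := exists_norm_le_norm_toEuclideanLin hM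
  obtain ⟨l, hl, hlU⟩ := eventually_le_weightedNorm_inv (hconv.posDef hpd hG)
  refine tendsto_measure_one_of_forall_subset fun δ hδ => ?_
  have hδ3 : 0 < δ / 3 := ENNReal.div_pos hδ.ne' (by finiteness)
  obtain ⟨K₁, hK₁⟩ := h.before_change _ hδ3
  obtain ⟨K₂, hK₂⟩ := hpost _ hδ3
  have hU := (hconv.tendsto_measure_notMem hlU).eventually (ge_mem_nhds hδ3)
  have hdrift : ∀ᶠ m : ℕ in atTop, |c| < q * (l / (2 * C) *
      (ca * (√(m : ℝ) * ‖b₁ m - b₂ m‖) - ((ca + 1) * K₁ + K₂) * D)) := by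
    have h1 : Tendsto (fun m : ℕ => q * (l / (2 * C) *
        (ca * (√(m : ℝ) * ‖b₁ m - b₂ m‖) - ((ca + 1) * K₁ + K₂) * D))) atTop atTop :=
      (((h.size.const_mul_atTop hca).atTop_add tendsto_const_nhds).const_mul_atTop
        (by positivity)).const_mul_atTop hq
    exact h1.eventually_gt_atTop _
  filter_upwards [hK₁, hK₂, hU, hdrift, hN, hw, hD, eventually_ge_atTop 1] with
    m h1 h2 h3 h4 ⟨h5, h6⟩ ⟨k, hk, hwk⟩ h8 hm
  have hle : ∀ {x y : ℝ} {K : ℝ≥0}, 0 < y → ¬ (K : ℝ≥0∞) < ENNReal.ofReal (y⁻¹ * x) →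
      x ≤ K * y := by
    intro x y K hy hx
    have h9 := (ENNReal.ofReal_le_iff_le_toReal ENNReal.coe_ne_top).mp (not_lt.mp hx)
    rw [ENNReal.coe_toReal, inv_mul_eq_div] at h9
    exact (div_le_iff₀ hy).mp h9
  have hm0 : (0 : ℝ) < m := by exact_mod_cast hm
  have hN0 : (0 : ℝ) < N m := by exact_mod_cast h5
  have hsub : {ω | (c : EReal) < detector P ε (β m) w (Γhat m ω) m ω}ᶜ ⊆
      {ω | (K₁ : ℝ≥0∞) < ENNReal.ofReal ((√((m : ℝ) + κ m))⁻¹ *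
        ‖∑ t ∈ Finset.Icc 1 (m + κ m - 1), influence μ P ε (β m) t ω‖)} ∪
      ({ω | (K₂ : ℝ≥0∞) < ENNReal.ofReal ((√(N m : ℝ))⁻¹ *
        ‖∑ t ∈ Finset.Icc (m + κ m) (m + κ m + ⌊ca * N m⌋₊), influence μ P ε (β m) t ω‖)} ∪
      {ω | Γhat m ω ∉ {A | ∀ v : Vec p, l * ‖v‖ ≤ weightedNorm A⁻¹ v}}) := by
    intro ω hω
    by_contra hne
    simp only [Set.mem_union, not_or] at hne
    obtain ⟨n1, n2, n3⟩ := hne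
    exact hω (lt_detector_of_change hLM hM hC hMC hm (h.one_le m hm) h5 h6 (h.before_eq m hm)
      (h.after_eq m hm) hl (not_not.mp n3) hca K₁.2 K₂.2 hq
      (hle (Real.sqrt_pos.mpr (by positivity)) n1) (hle (Real.sqrt_pos.mpr hN0) n2) hk hwk h8 h4)
  refine (measure_mono hsub).trans ((measure_union_le _ _).trans ?_)
  refine (add_le_add h1 ((measure_union_le _ _).trans (add_le_add h2 h3))).trans ?_
  rw [← add_assoc, ENNReal.add_thirds]

/-- Under the alternative monitoring is consistent. -/
lemma tendsto_measure_lt_detector (hLM : IsLinearModel μ P ε)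
    (hM : IsUnit (momentMatrix μ P).det) {wt : ℝ≥0 → ℝ} {tw : ℝ≥0} {Tw : ℝ≥0∞}
    (hw : IsWeight wt tw Tw) {β : ℕ → ℕ → Vec p} {κ : ℕ → ℕ} {b₁ b₂ : ℕ → Vec p}
    (h : AlternativeAssumption μ P ε β κ b₁ b₂ wt tw Tw)
    {G : Matrix (Fin p) (Fin p) ℝ} {Γhat : ℕ → Ω → Matrix (Fin p) (Fin p) ℝ}
    (hpd : ∀ᶠ m in atTop, ∀ᵐ ω ∂μ, (Γhat m ω).PosDef)
    (hconv : MatrixTendstoInProb μ Γhat G) (hG : IsUnit G.det) (c : ℝ) :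
    Tendsto (fun m : ℕ => μ {ω | (c : EReal) <
      detector P ε (β m) (cutoffWeight wt tw Tw) (Γhat m ω) m ω}) atTop (𝓝 1) := by
  obtain ⟨ca, hca, hE | hL⟩ := h.after_change
  · obtain ⟨hO, hpost, hcut⟩ := hE
    obtain ⟨C, hC⟩ := hO.bound
    -- The extra 1 leaves room for ending the window one observation later, since 1/m ≤ 1.
    obtain ⟨q, hq, hqC⟩ := exists_le_of_forall_le hw (C + ca + 1).toNNReal
    have hdom : ∀ᶠ m : ℕ in atTop, (κ m : ℝ) / m ≤ C := by
      filter_upwards [hC] with m hm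
      simpa using (le_abs_self _).trans hm
    refine tendsto_measure_lt_detector_of_window hLM hM h hpd hconv hG hca hq
      (N := fun m => m) (D := √(1 + C)) ?_ hpost ?_ ?_ c
    · filter_upwards [eventually_ge_atTop 1] with m hm
      have := h.one_le m hm
      omega
    -- The strict inequality between the cutoffs ensures tw + 1/m ≤ Tw for large m.
    · have hTw : (tw : ℝ≥0∞) < Tw := by
        obtain ⟨m, h1, h2⟩ := hcut.exists
        refine lt_of_lt_of_le ?_ h2
        rw [← ENNReal.ofReal_coe_nnreal]
        exact (ENNReal.ofReal_lt_ofReal_iff (tw.2.trans_lt h1)).mpr h1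
      have hinv : ∀ᶠ m : ℕ in atTop, ENNReal.ofReal ((tw : ℝ) + 1 / (m : ℝ)) ≤ Tw := by
        have h1 : Tendsto (fun m : ℕ => ENNReal.ofReal ((tw : ℝ) + 1 / (m : ℝ))) atTop (𝓝 tw) := by
          rw [← ENNReal.ofReal_coe_nnreal]
          refine ENNReal.tendsto_ofReal ?_
          simpa using (tendsto_one_div_atTop_nhds_zero_nat (𝕜 := ℝ)).const_add (tw : ℝ)
        exact (h1.eventually (gt_mem_nhds hTw)).mono fun _ => le_of_lt
      filter_upwards [hdom, hcut, hinv, eventually_ge_atTop 1] with m h1 ⟨h2, h3⟩ h4 hm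
      have hm0 : (0 : ℝ) < m := by exact_mod_cast hm
      have hm1 : 1 / (m : ℝ) ≤ 1 := by
        rw [div_le_one hm0]; exact_mod_cast hm
      have key : ∀ k : ℕ, (tw : ℝ) ≤ (k : ℝ) / m → (k : ℝ) / m ≤ C + ca + 1 →
          ENNReal.ofReal ((k : ℝ) / m) ≤ Tw →
          q * m ≤ cutoffWeight wt tw Tw ((k : ℝ≥0) / (m : ℝ≥0)) * (m : ℝ) := by
        intro k k1 k2 k3
        gcongr
        have e : (((k : ℝ≥0) / (m : ℝ≥0) : ℝ≥0) : ℝ) = (k : ℝ) / m := by push_cast; rfl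
        rw [cutoffWeight, if_pos]
        · exact hqC _ (NNReal.le_toNNReal_of_coe_le (e ▸ k2))
        · rw [← NNReal.coe_le_coe, e, ← ENNReal.ofReal_coe_nnreal, e]
          exact ⟨k1, k3⟩
      have hfl : (⌊ca * (m : ℝ)⌋₊ : ℝ) ≤ ca * m := Nat.floor_le (by positivity)
      have hadd : (κ m : ℝ) / m + ca = (κ m + ca * m) / m := by field_simp
      have hk0 : ((κ m + ⌊ca * (m : ℝ)⌋₊ : ℕ) : ℝ) / m ≤ (κ m : ℝ) / m + ca := by
        rw [hadd]
        push_cast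
        gcongr
      have hk1 : ((κ m + ⌊ca * (m : ℝ)⌋₊ + 1 : ℕ) : ℝ) / m
          = ((κ m + ⌊ca * (m : ℝ)⌋₊ : ℕ) : ℝ) / m + 1 / m := by
        push_cast; ring
      -- Because of the floor the window may end just before tw, where the weight vanishes. One more
      -- observation brings the time to at least κ/m + ca > tw, and it stays below tw + 1/m ≤ Tw.
      by_cases htw : (tw : ℝ) ≤ ((κ m + ⌊ca * (m : ℝ)⌋₊ : ℕ) : ℝ) / m
      · exact ⟨_, Or.inl rfl, key _ htw (by linarith) ((ENNReal.ofReal_le_ofReal hk0).trans h3)⟩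
      · refine ⟨_, Or.inr rfl, key _ ?_ (by linarith) ?_⟩
        · refine h2.le.trans ?_
          have h5 := (Nat.lt_floor_add_one (ca * (m : ℝ))).le
          rw [hadd]
          refine div_le_div_of_nonneg_right ?_ hm0.le
          push_cast
          linarith
        · rw [hk1]
          refine (ENNReal.ofReal_le_ofReal ?_).trans h4
          linarith
    · filter_upwards [hdom, eventually_ge_atTop 1] with m h1 hm
      have hm0 : (0 : ℝ) < m := by exact_mod_cast hm
      rw [div_le_iff₀ hm0] at h1
      calc √(m : ℝ) * √((m : ℝ) + κ m) ≤ √(m : ℝ) * √((1 + C) * m) := by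
            gcongr; linarith
        _ = √(1 + C) * (√(m : ℝ) * √(m : ℝ)) := by
            rw [Real.sqrt_mul' _ hm0.le]; ring
        _ = _ := by rw [Real.mul_self_sqrt hm0.le]
  · obtain ⟨hlate, hpost, rfl, hlim⟩ := hL
    obtain ⟨q, hq0, hqlim⟩ := EReal.lt_iff_exists_real_btwn.mp hlim
    have hq : 0 < q := by exact_mod_cast hq0
    have hev : ∀ᶠ t : ℝ≥0 in atTop, q < (t : ℝ) * wt t :=
      (eventually_lt_of_lt_liminf hqlim).mono fun t ht => EReal.coe_lt_coe_iff.mp ht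
    have hk : Tendsto (fun m : ℕ => ((κ m + ⌊ca * (κ m : ℝ)⌋₊ : ℕ) : ℝ≥0) / (m : ℝ≥0))
        atTop atTop := by
      rw [← NNReal.tendsto_coe_atTop]
      refine tendsto_atTop_mono (fun m => ?_) hlate
      push_cast
      gcongr
      simp
    refine tendsto_measure_lt_detector_of_window hLM hM h hpd hconv hG hca
      -- At the end of the window k ≤ (1 + ca) κ, so (k/m) w̃(k/m) > q yields w̃(k/m) κ ≥ q m / (1 +
      -- ca). The value √2 comes from m + κ ≤ 2κ.
      (q := q / (1 + ca)) (by positivity) (N := κ) (D := √2) ?_ hpost ?_ ?_ c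
    · filter_upwards [eventually_ge_atTop 1] with m hm
      have := h.one_le m hm
      omega
    · filter_upwards [hk.eventually hev, hk.eventually (eventually_ge_atTop tw),
        eventually_ge_atTop 1] with m h1 h2 hm
      refine ⟨_, Or.inl rfl, ?_⟩
      have hm0 : (0 : ℝ) < m := by exact_mod_cast hm
      have hκ0 : (0 : ℝ) < κ m := by exact_mod_cast h.one_le m hm
      rw [cutoffWeight, if_pos ⟨h2, le_top⟩]
      set x := wt (((κ m + ⌊ca * (κ m : ℝ)⌋₊ : ℕ) : ℝ≥0) / (m : ℝ≥0))
      have hx : 0 < x := hw.pos _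
      have hfl : (⌊ca * (κ m : ℝ)⌋₊ : ℝ) ≤ ca * κ m := Nat.floor_le (by positivity)
      push_cast at h1
      rw [div_mul_eq_mul_div, lt_div_iff₀ hm0] at h1
      rw [div_mul_eq_mul_div, div_le_iff₀ (by positivity)]
      have h3 : ((κ m : ℝ) + ⌊ca * (κ m : ℝ)⌋₊) * x ≤ (κ m + ca * κ m) * x := by gcongr
      linarith
    · filter_upwards [hlate.eventually_ge_atTop 1, eventually_ge_atTop 1] with m h1 hm
      have hm0 : (0 : ℝ) < m := by exact_mod_cast hm
      rw [le_div_iff₀ hm0, one_mul] at h1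
      have hκ0 : (0 : ℝ) ≤ κ m := Nat.cast_nonneg _
      calc √(m : ℝ) * √((m : ℝ) + κ m) ≤ √(κ m : ℝ) * √(2 * κ m) := by
            gcongr; linarith
        _ = √2 * (√(κ m : ℝ) * √(κ m : ℝ)) := by
            rw [Real.sqrt_mul' _ hκ0]; ring
        _ = _ := by rw [Real.mul_self_sqrt hκ0]

end Consistency

end LinearMonitoring

theorem mainTheorem5 {Ω : Type*} [MeasurableSpace Ω] {μ : Measure Ω} [IsProbabilityMeasure μ]
    {p : ℕ} (P : ℕ → Ω → Vec p) (ε : ℕ → Ω → ℝ) (hLM : IsLinearModel μ P ε)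
    (hM : IsUnit (momentMatrix μ P).det)
    (wt : ℝ≥0 → ℝ) (tw : ℝ≥0) (Tw : ℝ≥0∞) (hw : IsWeight wt tw Tw) :
    -- the moment matrix cancels out of the statistic
    (∀ (β : ℕ → Vec p) (G : Matrix (Fin p) (Fin p) ℝ), G.PosDef → ∀ (ω : Ω) (m k : ℕ),
      1 ≤ m → 1 ≤ k →
      monitorStat (betaHat μ P ε β ω) ((momentMatrix μ P)⁻¹ * G * (momentMatrix μ P)⁻¹) m k
        = monitorStat (scoreMean P ε β ω) G m k) ∧
    -- (i) the null hypothesis: stationarity of the influence functions and asymptotic level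
    (∀ β : ℕ → Vec p, (∀ t, 1 ≤ t → β t = β 1) →
      StrictlyStationary μ (influence μ P ε β) ∧
      (ApproximationAssumption μ (influence μ P ε β) →
        ∀ (Γ : Matrix (Fin p) (Fin p) ℝ) (Γhat : ℕ → Ω → Matrix (Fin p) (Fin p) ℝ),
          HasLongRunVariance μ (score P ε β) Γ → IsUnit Γ.det →
          (∀ m i j, Measurable fun ω => Γhat m ω i j) →
          (∀ᶠ m in atTop, ∀ᵐ ω ∂μ, (Γhat m ω).PosDef) →
          MatrixTendstoInProb μ Γhat Γ →
          ∀ (α c : ℝ), 0 < α → α < 1 →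
          ∀ {Ω' : Type*} [MeasurableSpace Ω'] (μ' : Measure Ω') [IsProbabilityMeasure μ']
            (W : ℝ≥0 → Ω' → Vec p), IsStdBrownian μ' W →
            μ' {ω | (c : EReal) < limitSup (cutoffWeight wt tw Tw) (fun t => W t ω)}
              ≤ ENNReal.ofReal α →
            limsup (fun m : ℕ => μ {ω | (c : EReal) <
              detector P ε β (cutoffWeight wt tw Tw) (Γhat m ω) m ω}) atTop
              ≤ ENNReal.ofReal α)) ∧
    -- (ii) the alternative: consistency
    (∀ (β : ℕ → ℕ → Vec p) (kstar : ℕ → ℕ) (b₁ b₂ : ℕ → Vec p),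
      AlternativeAssumption μ P ε β kstar b₁ b₂ wt tw Tw →
      ∀ (G : Matrix (Fin p) (Fin p) ℝ) (Γhat : ℕ → Ω → Matrix (Fin p) (Fin p) ℝ),
        (∀ m i j, Measurable fun ω => Γhat m ω i j) →
        (∀ᶠ m in atTop, ∀ᵐ ω ∂μ, (Γhat m ω).PosDef) →
        MatrixTendstoInProb μ Γhat G → IsUnit G.det →
        ∀ c : ℝ, Tendsto (fun m : ℕ => μ {ω | (c : EReal) <
          detector P ε (β m) (cutoffWeight wt tw Tw) (Γhat m ω) m ω}) atTop (𝓝 1)) := by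
  refine ⟨fun β G hG ω m k _ _ => monitorStat_betaHat hM β G ω m k, fun β hβ =>
    ⟨hLM.strictlyStationary_influence hβ, ?_⟩, ?_⟩
  · intro happ Γ Γhat hΓ hΓdet _ hpd hconv α c _ hα1 Ω' _ μ' _ W hW hα
    exact limsup_measure_detector_le hLM hM hw hβ happ hΓ hΓdet hpd hconv hW
      (ENNReal.ofReal_lt_one.mpr hα1) hα
  · intro β kstar b₁ b₂ h G Γhat _ hpd hconv hG c
    exact tendsto_measure_lt_detector hLM hM hw h hpd hconv hG c
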